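/- **Setting.** Fix $k\ge 0$. On one probability space let, for every $n$, $\mathbf x_1,\dots,\mathbf x_k\in\mathbb R^n$ be (random or deterministic) vectors, and let $(X_1,\dots,X_k)$ be a random vector with finite moments of all orders. Assume that almost surely, as $n\to\infty$, $(\mathbf x_1,\dots,\mathbf x_k)\overset{W}{\to}(X_1,\dots,X_k)$, i.e. $\frac1n\sum_{i=1}^n f(x_1[i],\dots,x_k[i])\to\mathbb E f(X_1,\dots,X_k)$ for every continuous $f$ with $|f(x)|\le C(1+\|x\|_2^p)$ for some $C>0$ and $p\ge1$. (The notation $\overset{W}{\to}$ is used likewise for other vectors.) Write $\langle\mathbf y\rangle=\frac1n\sum_{i}y[i]$, and apply functions to $(\mathbf x_1,\dots,\mathbf x_k)$ row by row. A *diagonal tensor network* $T=(\mathcal V,\mathcal E,\{q_v\}_{v\in\mathcal V})$ in $k$ variables is a finite undirected tree whose vertices $v$ are labelled by polynomials $q_v:\mathbb R^k\to\mathbb R$. Its value on a symmetric $\mathbf W\in\mathbb R^{n\times n}$ is $$\operatorname{val}_T(\mathbf W;\mathbf x_1,\dots,\mathbf x_k)=\frac1n\sum_{\mathbf i\in[n]^{\mathcal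 V}}\ \prod_{v\in\mathcal V}q_v(x_1[i_v],\dots,x_k[i_v])\prod_{(u,v)\in\mathcal E}W[i_u,i_v].$$ Suppose that for every vertex $v$ of $T$, almost surely $\lim_{n\to\infty}\langle q_v(\mathbf x_1,\dots,\mathbf x_k)\rangle=0$. **(a)** Let $\mathbf W=\mathbf W_n\in\mathbb R^{n\times n}$ be generalized Wigner matrices with deterministic variance profiles $\mathbf S=\mathbf S_n$: $\mathbf W$ is symmetric, the entries $W[i,j]$, $i\le j$, are independent with mean $0$ and variance $S[i,j]/n$; $\lim_{n\to\infty}n\max_{i,j}\mathbb E|W[i,j]|^p=0$ for each integer $p\ge3$; $\max_{i,j}S[i,j]\le C$ for a constant $C>0$ and all $n$; and $\lim_{n\to\infty}\max_i|\frac1n\sum_jS[i,j]-1|=0$. Suppose that $\mathbf W_n$ is independent of $(\mathbf x_1,\dots,\mathbf x_k)$ for each $n$, and that, with $\mathbf s_i$ the $i$-th row of $\mathbf S$, for every polynomial $q:\mathbb R^k\to\mathbb R$, almost surely $$\max_{1\le i\le n}\big|\langle q(\mathbf x_1,\dots,\mathbf x_k)\odot\mathbf s_i\rangle-\langle q(\mathbf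 x_1,\dots,\mathbf x_k)\rangle\langle\mathbf s_i\rangle\big|\to0 .$$ Then the limit value of $T$ is $0$: almost surely $\lim_{n\to\infty}\operatorname{val}_T(\mathbf W;\mathbf x_1,\dots,\mathbf x_k)=0$. **(b)** Let $\mathbf W=\mathbf W_n=\mathbf O\,\mathrm{diag}(\mathbf d)\,\mathbf O^\top\in\mathbb R^{n\times n}$ be symmetric generalized invariant matrices with limit spectral distribution $D$: almost surely $\mathbf d\overset{W}{\to}D$, where $D$ has compact support and $\operatorname{Var}[D]>0$; $\mathbf O=\mathbf\Pi_V\mathbf H\mathbf\Pi_E$ with $\mathbf H$ a (deterministic or random) orthogonal matrix and $\mathbf\Pi_V,\mathbf\Pi_E$ uniformly random signed permutation matrices, independent of each other and of $(\mathbf d,\mathbf H)$; and for every $\varepsilon>0$, almost surely for all large $n$, $\max_{i,j}|H[i,j]|<n^{-1/2+\varepsilon}$. (A uniformly random signed permutation matrix is $\mathbf P\,\mathrm{diag}(\xi[1],\dots,\xi[n])$ with $\mathbf P$ a uniformly random permutation matrix and $\xi[i]$ independent uniform signs, independent of $\mathbf P$.) Suppose that $\mathbf W$ is independent of $\mathbf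 x_1,\dots,\mathbf x_k$, in either of two senses: the sequence $(\mathbf W_n)_n$ is independent of the sequence of tuples $(\mathbf x_1,\dots,\mathbf x_k)$ indexed by $n$; or, for every $n$, $(\mathbf\Pi_V,\mathbf\Pi_E,\mathbf d,\mathbf H)$ is independent of $(\mathbf x_1,\dots,\mathbf x_k)$. Suppose also that almost surely $\lim_{n\to\infty}\frac1n\operatorname{Tr}\mathbf W=0$. Then the limit value of $T$ is $0$: almost surely $\lim_{n\to\infty}\operatorname{val}_T(\mathbf W;\mathbf x_1,\dots,\mathbf x_k)=0$. -/

import Mathlib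

open MeasureTheory ProbabilityTheory Filter Topology
open scoped ENNReal

noncomputable section

/-- A diagonal tensor network in `k` variables on the vertex set `V`: a tree on `V`, each of whose
vertices is labelled by a real polynomial in `k` variables. -/
structure DiagonalTensorNetwork (V : Type*) (k : ℕ) where
  graph : SimpleGraph V
  isTree : graph.IsTree
  q : V → MvPolynomial (Fin k) ℝ

/-- The vector `q(x_1, …, x_k) ∈ ℝⁿ`: the polynomial `q` is applied to every row.
The vectors `x_1, …, x_k ∈ ℝⁿ` are given by their rows, `x i j = x_j[i]`. -/
def polyRow {k n : ℕ} (q : MvPolynomial (Fin k) ℝ) (x : Fin n → EuclideanSpace ℝ (Fin k))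
    (i : Fin n) : ℝ :=
  MvPolynomial.eval (fun j => x i j) q

/-- The empirical average `⟨y⟩` of the coordinates of a vector. -/
def empAvg {n : ℕ} (y : Fin n → ℝ) : ℝ := (1 / (n : ℝ)) * ∑ i, y i

/-- The entry `A[i_u, i_v]` attached to an edge `e = {u, v}`. An orientation of the edge is chosen;
it does not matter for a symmetric matrix, see `edgeEntry_mk`. -/
def edgeEntry {V : Type*} {n : ℕ} (A : Matrix (Fin n) (Fin n) ℝ) (i : V → Fin n) (e : Sym2 V) : ℝ :=
  A (i (Quot.out e).1) (i (Quot.out e).2)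

theorem edgeEntry_mk {V : Type*} {n : ℕ} {A : Matrix (Fin n) (Fin n) ℝ} (hA : A.IsSymm)
    (i : V → Fin n) (u v : V) : edgeEntry A i s(u, v) = A (i u) (i v) := by
  have h : s((Quot.out s(u, v)).1, (Quot.out s(u, v)).2) = s(u, v) := Quot.out_eq (s(u, v))
  unfold edgeEntry
  rcases Sym2.eq_iff.1 h with ⟨h1, h2⟩ | ⟨h1, h2⟩
  · rw [h1, h2]
  · rw [h1, h2]
    exact hA.apply _ _

open Classical in
/-- The value of a diagonal tensor network on a symmetric matrix `A` and `k` vectors (by rows):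
`(1/n) ∑_{i ∈ [n]^V} ∏_v q_v(x_1[i_v], …, x_k[i_v]) ∏_{{u,v} ∈ E} A[i_u, i_v]`. -/
def DiagonalTensorNetwork.val {V : Type*} [Fintype V] {k n : ℕ} (T : DiagonalTensorNetwork V k)
    (A : Matrix (Fin n) (Fin n) ℝ) (x : Fin n → EuclideanSpace ℝ (Fin k)) : ℝ :=
  (1 / (n : ℝ)) * ∑ i : V → Fin n,
    (∏ v : V, polyRow (T.q v) x (i v)) * ∏ e ∈ T.graph.edgeFinset, edgeEntry A i e

/-- Wasserstein convergence of every order `p ≥ 1` of the empirical distributions of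
`y n 0, …, y n (n-1)` to the law `ν`, by convergence of averages of continuous functions of
polynomial growth. -/
def WassersteinTendsto {E : Type*} [NormedAddCommGroup E] [MeasurableSpace E]
    (y : ∀ n : ℕ, Fin n → E) (ν : Measure E) : Prop :=
  ∀ p : ℕ, 1 ≤ p → ∀ f : E → ℝ, Continuous f →
    (∃ C : ℝ, 0 < C ∧ ∀ v, |f v| ≤ C * (1 + ‖v‖ ^ p)) →
    Tendsto (fun n : ℕ => empAvg (fun i => f (y n i))) atTop (𝓝 (∫ v, f v ∂ν))

/-- All moments of the law `ν` are finite. -/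
def FiniteMoments {E : Type*} [NormedAddCommGroup E] [MeasurableSpace E] (ν : Measure E) : Prop :=
  ∀ p : ℕ, Integrable (fun v => ‖v‖ ^ p) ν

/-- The Borel structure of matrices, that is, the product one. -/
instance instMeasurableSpaceRealMatrix (n : ℕ) : MeasurableSpace (Matrix (Fin n) (Fin n) ℝ) :=
  inferInstanceAs (MeasurableSpace (Fin n → Fin n → ℝ))

/-- `W n`, `n = 0, 1, 2, …`, is a sequence of generalized Wigner matrices with deterministic
variance profiles `S n`. No relation between the matrices of different sizes is imposed. -/
structure IsGeneralizedWigner {Ω : Type*} [MeasurableSpace Ω] (μ : Measure Ω)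
    (W : ∀ n : ℕ, Ω → Matrix (Fin n) (Fin n) ℝ) (S : ∀ n : ℕ, Matrix (Fin n) (Fin n) ℝ) :
    Prop where
  measurable : ∀ n, Measurable (W n)
  symm : ∀ n, ∀ᵐ ω ∂μ, (W n ω).IsSymm
  indep : ∀ n, iIndepFun
    (fun (p : {p : Fin n × Fin n // p.1 ≤ p.2}) (ω : Ω) => W n ω p.1.1 p.1.2) μ
  memLp_two : ∀ n i j, MemLp (fun ω => W n ω i j) 2 μ
  mean : ∀ n i j, ∫ ω, W n ω i j ∂μ = 0
  variance : ∀ n i j, Var[fun ω => W n ω i j; μ] = S n i j / n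
  moments : ∀ p : ℕ, 3 ≤ p →
    Tendsto (fun n : ℕ => (n : ℝ≥0∞) * ⨆ i : Fin n, ⨆ j : Fin n, ∫⁻ ω, ‖W n ω i j‖ₑ ^ p ∂μ)
      atTop (𝓝 0)
  profile_bounded : ∃ C : ℝ, 0 < C ∧ ∀ n i j, S n i j ≤ C
  profile_rows : Tendsto (fun n : ℕ => ⨆ i : Fin n, |(1 / (n : ℝ)) * ∑ j, S n i j - 1|)
    atTop (𝓝 0)

/-- The signed permutation matrix `P Ξ`, with `P` the permutation matrix of `σ` and
`Ξ = diag(ξ)`. -/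
def signedPermMatrix {n : ℕ} (σ : Equiv.Perm (Fin n)) (ξ : Fin n → ℤˣ) :
    Matrix (Fin n) (Fin n) ℝ :=
  σ.permMatrix ℝ * Matrix.diagonal (fun i => ((ξ i : ℤ) : ℝ))

/-- The law of a uniformly random signed permutation `P Ξ`: the permutation is uniform, the signs
are independent fair signs, independent of the permutation. -/
def uniformSignedPerm (n : ℕ) : Measure (Matrix (Fin n) (Fin n) ℝ) :=
  ((PMF.uniformOfFintype (Equiv.Perm (Fin n) × (Fin n → ℤˣ))).map
    (fun s => signedPermMatrix s.1 s.2)).toMeasure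

/-- `W n = O D Oᵀ`, with `D = diag (d n)` and `O = PV n * H n * PE n`, is a sequence of symmetric
generalized invariant matrices with limit spectral distribution `ν`. No relation between the
matrices of different sizes is imposed. -/
structure IsSymGeneralizedInvariant {Ω : Type*} [MeasurableSpace Ω] (μ : Measure Ω)
    (W : ∀ n : ℕ, Ω → Matrix (Fin n) (Fin n) ℝ) (d : ∀ n : ℕ, Ω → Fin n → ℝ)
    (H PV PE : ∀ n : ℕ, Ω → Matrix (Fin n) (Fin n) ℝ) (ν : Measure ℝ) : Prop where
  measurable_d : ∀ n, Measurable (d n)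
  measurable_H : ∀ n, Measurable (H n)
  measurable_PV : ∀ n, Measurable (PV n)
  measurable_PE : ∀ n, Measurable (PE n)
  eq : ∀ n ω, W n ω =
    (PV n ω * H n ω * PE n ω) * Matrix.diagonal (d n ω) * (PV n ω * H n ω * PE n ω).transpose
  spectrum_tendsto : ∀ᵐ ω ∂μ, WassersteinTendsto (fun n => d n ω) ν
  compact_support : ∃ K : Set ℝ, IsCompact K ∧ ν Kᶜ = 0
  variance_pos : 0 < Var[id; ν]
  orthogonal : ∀ n, ∀ᵐ ω ∂μ, H n ω ∈ Matrix.orthogonalGroup (Fin n) ℝ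
  law_PV : ∀ n, μ.map (PV n) = uniformSignedPerm n
  law_PE : ∀ n, μ.map (PE n) = uniformSignedPerm n
  indep_PV_PE : ∀ n, IndepFun (PV n) (PE n) μ
  indep_perm : ∀ n, IndepFun (fun ω => (PV n ω, PE n ω)) (fun ω => (d n ω, H n ω)) μ
  delocalized : ∀ ε : ℝ, 0 < ε → ∀ᵐ ω ∂μ, ∀ᶠ n : ℕ in atTop, ∀ i j,
    |H n ω i j| < (n : ℝ) ^ (-(1 / 2 : ℝ) + ε)

end

universe u

noncomputable section

open scoped Classical

/-! ### Sums over maps into `Fin n`, grouped by their kernels -/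

/-! Both parts have the same scheme. With the vectors fixed, the fourth central moment of the value
over the randomness of `W` is `O(n⁻²)`, so by Borel–Cantelli the value differs from its conditional
mean by a null sequence (`ae_tendsto_zero_of_conditional`). It remains to show that this mean tends
to `0`. Throughout, labellings `i : V → Fin n` are grouped by their kernel, that is, by the
partition of the vertices that they induce. There are at most `n ^ c` labellings with a given kernel
of `c` classes. Weights that depend only on the kernel decouple from the vectors
(`sum_prod_abs_mul_le`), so that only empirical moments of the vectors enter.

(a) Expand the mean over kernels. After the vertices are identified, the distinct matrix entries in
use are the classes of parallel edges. Let there be `r` of them; connectedness leaves at most `r +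
1` vertex classes. An entry used once gives `0`. At most `r` vertex classes give `O(1/n)`. An entry
used at least three times brings in the vanishing higher moments. In the remaining case every entry
is used exactly twice and the quotient graph is a tree with `r` edges. As `|V| = 2r + 1`, its `r +
1` classes cannot all have two elements, so some vertex `v` is alone in its class. Stripping leaves
and using the flatness of the variance profile, the sum over the tree factorizes asymptotically into
averages over the classes (`abs_graphAvg_sub_le`), one of which is `⟨q_v⟩ → 0`. For the
concentration the fourth power is expanded over four copies of the tree. A copy that shares no entry
with the others contributes `0`; otherwise the copies form at most two connected pieces
(`MConn.numClasses_four_le`), which gives `n⁻⁴ · n²`.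

(b) Subdividing each edge turns the value into a sum over a bipartite graph with weights `O[i_v,
k_e]`. The signs of `Π_E` cancel, because every subdivision vertex has degree two. For a connected
bipartite graph with even degrees the sum of products of entries of `H` is at most `n` in absolute
value (`abs_sum_bipWeight_le`): orthogonality removes vertices of degree two, and delocalization
with counting settles degrees at least four. Under the random signed permutations the expected
weight of a labelling depends only on the two kernels, and it vanishes if some row index occurs an
odd number of times. The mean is therefore, for each pair of kernels, bounded by a constant times a
bounded weight times a normalized sum of the `q_v` times a normalized sum of the eigenvalues. A
singleton class makes one of these sums vanish in the limit, by `⟨q_v⟩ → 0` or `Tr W / n → 0`.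
Without singletons there are at most `|E|` classes in all, and delocalization makes the weight
vanish. The concentration comes from a Poincaré inequality for transpositions and sign flips,
strengthened to fourth moments. The effect of one transposition involves only labellings that hit
one of two values, and four copies hitting a common value form a connected graph.

If only the sequences `W` and `x` are assumed independent, the factors of `W` need not be
independent of `x`. The statement is then proved on the product of two copies of the probability
space and transferred back through the law of the pair. -/

theorem empAvg_nonneg {n : ℕ} {y : Fin n → ℝ} (hy : ∀ i, 0 ≤ y i) : 0 ≤ empAvg y :=
  mul_nonneg (by positivity) (Finset.sum_nonneg fun i _ => hy i)

theorem sum_eq_mul_empAvg {n : ℕ} (y : Fin n → ℝ) : ∑ i, y i = n * empAvg y := by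
  unfold empAvg
  rcases Nat.eq_zero_or_pos n with rfl | hn
  · simp
  · have : (n : ℝ) ≠ 0 := by positivity
    field_simp

theorem abs_empAvg_le {n : ℕ} (y : Fin n → ℝ) : |empAvg y| ≤ empAvg fun i => |y i| := by
  unfold empAvg
  rw [abs_mul, abs_of_nonneg (by positivity : (0 : ℝ) ≤ 1 / n)]
  gcongr
  exact Finset.abs_sum_le_sum_abs _ _

theorem empAvg_le_of_le {n : ℕ} {y : Fin n → ℝ} {c : ℝ} (hc : 0 ≤ c) (hy : ∀ i, y i ≤ c) :
    empAvg y ≤ c := by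
  unfold empAvg
  rcases Nat.eq_zero_or_pos n with rfl | hn
  · simpa using hc
  · have : (0 : ℝ) < n := by positivity
    calc (1 / (n : ℝ)) * ∑ i, y i ≤ (1 / (n : ℝ)) * ∑ _i : Fin n, c := by
          gcongr with i; exact hy i
      _ = c := by simp; field_simp

theorem empAvg_mono {n : ℕ} {y z : Fin n → ℝ} (h : ∀ i, y i ≤ z i) : empAvg y ≤ empAvg z := by
  unfold empAvg
  gcongr with i
  exact h i

/-- Averaging over the cyclic shifts of `Fin n`, which leave `K` unchanged, turns the factor `g (i
v)` into the mean of `g`. -/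
theorem sum_mul_of_perm_invariant {V : Type*} [Fintype V] {n : ℕ} (K : (V → Fin n) → ℝ)
    (hK : ∀ (τ : Equiv.Perm (Fin n)) (i : V → Fin n), K (fun v => τ (i v)) = K i)
    (g : Fin n → ℝ) (v : V) : ∑ i, g (i v) * K i = empAvg g * ∑ i, K i := by
  rcases Nat.eq_zero_or_pos n with rfl | hn
  · have : IsEmpty (V → Fin 0) := ⟨fun f => (f v).elim0⟩
    simp
  have : NeZero n := ⟨hn.ne'⟩
  have hn' : (n : ℝ) ≠ 0 := by positivity
  have key : ∀ c : Fin n, ∑ i : V → Fin n, g (i v) * K i = ∑ i, g (c + i v) * K i := by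
    intro c
    rw [← Equiv.sum_comp (Equiv.arrowCongr (Equiv.refl V) (Equiv.addLeft c))]
    refine Finset.sum_congr rfl fun i _ => ?_
    have := hK (Equiv.addLeft c) i
    simp only [Equiv.coe_addLeft] at this
    change g (c + i v) * K (fun v => c + i v) = _
    rw [this]
  have h2 : (n : ℝ) * ∑ i : V → Fin n, g (i v) * K i = (∑ a, g a) * ∑ i, K i := by
    calc (n : ℝ) * ∑ i : V → Fin n, g (i v) * K i
        = ∑ c : Fin n, ∑ i : V → Fin n, g (c + i v) * K i := by
          rw [Finset.sum_congr rfl fun c _ => (key c).symm]; simp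
      _ = ∑ i : V → Fin n, (∑ c, g (c + i v)) * K i := by
          rw [Finset.sum_comm]; simp [Finset.sum_mul]
      _ = ∑ i : V → Fin n, (∑ a, g a) * K i := by
          refine Finset.sum_congr rfl fun i _ => ?_
          rw [← Equiv.sum_comp (Equiv.addRight (i v)) g]; rfl
      _ = _ := by rw [Finset.mul_sum]
  unfold empAvg
  field_simp
  linarith

/-- A sum of empirical moments of order `N`. -/
def momentSum {V : Type*} [Fintype V] {n : ℕ} (q : V → Fin n → ℝ) (N : ℕ) : ℝ :=
  1 + ∑ v, empAvg fun a => |q v a| ^ N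

theorem one_le_momentSum {V : Type*} [Fintype V] {n : ℕ} (q : V → Fin n → ℝ) (N : ℕ) :
    1 ≤ momentSum q N := by
  unfold momentSum
  have : 0 ≤ ∑ v, empAvg fun a => |q v a| ^ N :=
    Finset.sum_nonneg fun v _ => empAvg_nonneg fun a => by positivity
  linarith

/-- The product is at most the `|V|`-th power of its largest factor; the summand `1` serves the
empty product. -/
theorem prod_abs_le_one_add_sum {V : Type*} [Fintype V] (y : V → ℝ) :
    ∏ v, |y v| ≤ 1 + ∑ v, |y v| ^ Fintype.card V := by
  rcases isEmpty_or_nonempty V with hV | hV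
  · simp
  obtain ⟨m, -, hm⟩ := Finset.exists_max_image (Finset.univ : Finset V) (fun v => |y v|)
    Finset.univ_nonempty
  have h1 : ∏ v, |y v| ≤ ∏ _v : V, |y m| :=
    Finset.prod_le_prod (fun v _ => abs_nonneg _) fun v hv => hm v hv
  have h2 : |y m| ^ Fintype.card V ≤ ∑ v, |y v| ^ Fintype.card V :=
    Finset.single_le_sum (f := fun v => |y v| ^ Fintype.card V) (fun v _ => by positivity)
      (Finset.mem_univ m)
  simp only [Finset.prod_const, Finset.card_univ] at h1
  linarith

/-- This is the decoupling device: the product over vertices is replaced by a sum of powers at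
single vertices, and each of these is averaged out because `K` does not distinguish between indices.
No bound on the entries of `q` is needed, only one on moments. -/
theorem sum_prod_abs_mul_le {V : Type*} [Fintype V] {n : ℕ} (q : V → Fin n → ℝ)
    (K : (V → Fin n) → ℝ) (hK0 : ∀ i, 0 ≤ K i)
    (hK : ∀ (τ : Equiv.Perm (Fin n)) (i : V → Fin n), K (fun v => τ (i v)) = K i) :
    ∑ i, (∏ v, |q v (i v)|) * K i ≤ momentSum q (Fintype.card V) * ∑ i, K i := by
  calc ∑ i, (∏ v, |q v (i v)|) * K i
      ≤ ∑ i, (1 + ∑ v, |q v (i v)| ^ Fintype.card V) * K i := by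
        gcongr with i
        · exact hK0 i
        · exact prod_abs_le_one_add_sum fun v => q v (i v)
    _ = ∑ i, K i + ∑ v, ∑ i, |q v (i v)| ^ Fintype.card V * K i := by
        rw [Finset.sum_comm, ← Finset.sum_add_distrib]
        refine Finset.sum_congr rfl fun i _ => ?_
        rw [add_mul, one_mul, Finset.sum_mul]
    _ = momentSum q (Fintype.card V) * ∑ i, K i := by
        unfold momentSum
        rw [add_mul, one_mul, Finset.sum_mul]
        congr 1
        refine Finset.sum_congr rfl fun v _ => ?_
        exact sum_mul_of_perm_invariant K hK (fun a => |q v a| ^ Fintype.card V) v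

instance instFintypeSetoid (V : Type*) [Finite V] : Fintype (Setoid V) :=
  @Fintype.ofFinite _ (Finite.of_injective (fun s : Setoid V => (s : V → V → Prop))
    fun s t h => Setoid.ext fun a b => by simpa using congrFun (congrFun h a) b)

/-- The number of classes of an equivalence relation. -/
def numClasses {V : Type*} (s : Setoid V) : ℕ := Nat.card (Quotient s)

theorem numClasses_lt {V : Type*} [Finite V] {s t : Setoid V} (h : s < t) :
    numClasses t < numClasses s := by
  have hsurj : Function.Surjective (Quotient.map' id fun a b hab => h.le hab :
      Quotient s → Quotient t) := by
    intro q
    induction q using Quotient.inductionOn' with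
    | h a => exact ⟨Quotient.mk'' a, rfl⟩
  refine lt_of_le_of_ne (Nat.card_le_card_of_surjective _ hsurj) fun heq => ?_
  have hbij := (Nat.bijective_iff_surjective_and_card (f := (Quotient.map' id fun a b hab => h.le hab :
      Quotient s → Quotient t))).2 ⟨hsurj, heq.symm⟩
  refine h.not_ge fun a b hab => ?_
  have : (Quotient.mk'' a : Quotient s) = Quotient.mk'' b := by
    apply hbij.1
    exact Quotient.sound' hab
  exact Quotient.exact' this

/-- The maps that are constant on the classes of `s` are the maps on the quotient. -/
def liftEquiv {V α : Type*} (s : Setoid V) : (Quotient s → α) ≃ {i : V → α // s ≤ Setoid.ker i} where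
  toFun j := ⟨fun v => j (Quotient.mk'' v), fun a b hab => by
    rw [Setoid.ker_def]; exact congrArg j (Quotient.sound' hab)⟩
  invFun i := fun q => Quotient.liftOn' q i.1 fun a b hab => i.2 hab
  left_inv j := by
    funext q
    induction q using Quotient.inductionOn' with
    | h a => rfl
  right_inv i := rfl

theorem sum_le_ker {V α M : Type*} [Fintype V] [Fintype α] [AddCommMonoid M] (s : Setoid V)
    (φ : (V → α) → M) :
    ∑ i with s ≤ Setoid.ker i, φ i = ∑ j : Quotient s → α, φ fun v => j (Quotient.mk'' v) := by
  rw [← Finset.sum_subtype_eq_sum_filter, Finset.subtype_univ, ← Equiv.sum_comp (liftEquiv s)]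
  rfl

theorem card_ker_le {V : Type*} [Fintype V] (s : Setoid V) (n : ℕ) :
    Finset.card {i : V → Fin n | s ≤ Setoid.ker i} = n ^ numClasses s := by
  have := sum_le_ker (α := Fin n) s (fun _ => (1 : ℕ))
  simp only [Finset.sum_const, smul_eq_mul, mul_one, Finset.card_univ, Fintype.card_fun,
    Fintype.card_fin] at this
  rw [this, numClasses, Nat.card_eq_fintype_card]

theorem card_ker_eq_le {V : Type*} [Fintype V] (s : Setoid V) (n : ℕ) :
    Finset.card {i : V → Fin n | Setoid.ker i = s} ≤ n ^ numClasses s := by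
  rw [← card_ker_le]
  apply Finset.card_le_card
  intro i
  simp only [Finset.mem_filter, Finset.mem_univ, true_and]
  exact fun h => h.ge

theorem sum_eq_sum_ker {V α M : Type*} [Fintype V] [Fintype α] [AddCommMonoid M]
    (φ : (V → α) → M) : ∑ i, φ i = ∑ s : Setoid V, ∑ i with Setoid.ker i = s, φ i :=
  (Finset.sum_fiberwise _ _ _).symm

theorem sum_le_ker_eq {V α M : Type*} [Fintype V] [Fintype α] [AddCommMonoid M] (s : Setoid V)
    (φ : (V → α) → M) :
    ∑ i with s ≤ Setoid.ker i, φ i = ∑ i with Setoid.ker i = s, φ i +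
      ∑ t with s < t, ∑ i with Setoid.ker i = t, φ i := by
  have h : ∑ i with s ≤ Setoid.ker i, φ i
      = ∑ t with s ≤ t, ∑ i with Setoid.ker i = t, φ i := by
    rw [Finset.sum_filter, sum_eq_sum_ker, Finset.sum_filter]
    refine Finset.sum_congr rfl fun t _ => ?_
    split_ifs with ht
    · exact Finset.sum_congr rfl fun i hi => by
        rw [if_pos]; rwa [(Finset.mem_filter.1 hi).2]
    · exact Finset.sum_eq_zero fun i hi => by
        rw [if_neg]; rwa [(Finset.mem_filter.1 hi).2]
  rw [h]
  have : (Finset.univ.filter fun t => s ≤ t) = insert s (Finset.univ.filter fun t => s < t) := by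
    ext t
    simp [le_iff_eq_or_lt, eq_comm]
  rw [this, Finset.sum_insert (by simp)]

theorem ker_perm_comp {V α : Type*} (τ : Equiv.Perm α) (i : V → α) :
    Setoid.ker (fun v => τ (i v)) = Setoid.ker i := by
  ext a b
  simp [Setoid.ker_def]

/-- The orbits of the permutations of the index set on labellings are exactly the kernels, so
permutation-invariant weights are functions of the kernel. -/
theorem exists_perm_of_ker_eq {V α : Type*} [Finite α] {i j : V → α}
    (h : Setoid.ker i = Setoid.ker j) : ∃ τ : Equiv.Perm α, ∀ v, τ (i v) = j v := by
  have := Fintype.ofFinite α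
  let e : {x // x ∈ Set.range i} ≃ {x // x ∈ Set.range j} :=
    (Setoid.quotientKerEquivRange i).symm.trans
      ((Quotient.congrRight fun a b => by
        rw [h]).trans
        (Setoid.quotientKerEquivRange j))
  refine ⟨e.extendSubtype, fun v => ?_⟩
  rw [Equiv.extendSubtype_apply_of_mem e (i v) ⟨v, rfl⟩]
  have : (Setoid.quotientKerEquivRange i).symm ⟨i v, v, rfl⟩ = Quotient.mk'' v := by
    rw [Equiv.symm_apply_eq]; rfl
  simp only [e, Equiv.trans_apply]
  rw [this]
  rfl

theorem sum_ker_prod_abs_le {V : Type*} [Fintype V] {n : ℕ} (q : V → Fin n → ℝ) (s : Setoid V) :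
    ∑ i with Setoid.ker i = s, ∏ v, |q v (i v)|
      ≤ momentSum q (Fintype.card V) * (n : ℝ) ^ numClasses s := by
  have h := sum_prod_abs_mul_le q (fun i => if Setoid.ker i = s then 1 else 0)
    (fun i => by positivity) fun τ i => by simp only [ker_perm_comp]
  simp only [mul_ite, mul_one, mul_zero] at h
  rw [← Finset.sum_filter, ← Finset.sum_filter] at h
  refine h.trans ?_
  have h1 := one_le_momentSum q (Fintype.card V)
  gcongr
  rw [Finset.sum_const, nsmul_eq_mul, mul_one]
  exact_mod_cast card_ker_eq_le s n

/-- The difference consists of labellings whose kernel is strictly coarser than `s`; these have at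
least one class fewer and hence lose a factor `n`. The sum over `s ≤ ker i` is the one that
factorizes, so this is the passage from injective to unrestricted sums. -/
theorem abs_sum_ker_sub_sum_le_ker_le {V : Type*} [Fintype V] {n : ℕ} (q : V → Fin n → ℝ)
    (s : Setoid V) (φ : (V → Fin n) → ℝ) {B : ℝ} (hB : 0 ≤ B)
    (hφ : ∀ i, s ≤ Setoid.ker i → |φ i| ≤ B * ∏ v, |q v (i v)|) :
    n * |∑ i with Setoid.ker i = s, φ i - ∑ i with s ≤ Setoid.ker i, φ i|
      ≤ Fintype.card (Setoid V) * (B * momentSum q (Fintype.card V)) * (n : ℝ) ^ numClasses s := by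
  have hM := one_le_momentSum q (Fintype.card V)
  rcases Nat.eq_zero_or_pos n with rfl | hn
  · simp only [Nat.cast_zero, zero_mul]; positivity
  rw [sum_le_ker_eq, sub_add_cancel_left, abs_neg]
  have hterm : ∀ t : Setoid V, s < t → n * |∑ i with Setoid.ker i = t, φ i|
      ≤ (B * momentSum q (Fintype.card V)) * (n : ℝ) ^ numClasses s := by
    intro t ht
    calc (n : ℝ) * |∑ i with Setoid.ker i = t, φ i|
        ≤ n * ∑ i with Setoid.ker i = t, B * ∏ v, |q v (i v)| := by
          gcongr
          refine (Finset.abs_sum_le_sum_abs _ _).trans (Finset.sum_le_sum fun i hi => hφ i ?_)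
          rw [(Finset.mem_filter.1 hi).2]; exact ht.le
      _ ≤ n * (B * (momentSum q (Fintype.card V) * (n : ℝ) ^ numClasses t)) := by
          rw [← Finset.mul_sum]
          gcongr
          exact sum_ker_prod_abs_le q t
      _ = (B * momentSum q (Fintype.card V)) * (n : ℝ) ^ (numClasses t + 1) := by ring
      _ ≤ _ := by
          gcongr
          · exact_mod_cast hn
          · exact numClasses_lt ht
  calc (n : ℝ) * |∑ t with s < t, ∑ i with Setoid.ker i = t, φ i|
      ≤ n * ∑ t with s < t, |∑ i with Setoid.ker i = t, φ i| := by
        gcongr; exact Finset.abs_sum_le_sum_abs _ _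
    _ = ∑ t with s < t, n * |∑ i with Setoid.ker i = t, φ i| := Finset.mul_sum _ _ _
    _ ≤ ∑ t : Setoid V with s < t, (B * momentSum q (Fintype.card V)) * (n : ℝ) ^ numClasses s :=
        Finset.sum_le_sum fun t ht => hterm t (Finset.mem_filter.1 ht).2
    _ ≤ _ := by
        rw [Finset.sum_const, nsmul_eq_mul, mul_assoc (Fintype.card (Setoid V) : ℝ)]
        gcongr
        exact Finset.card_le_univ _

theorem sum_inv_pow_numClasses_le {V : Type*} [Fintype V] (n : ℕ) :
    ∑ i : V → Fin n, ((n : ℝ) ^ numClasses (Setoid.ker i))⁻¹ ≤ Fintype.card (Setoid V) := by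
  rw [sum_eq_sum_ker]
  calc ∑ s : Setoid V, ∑ i : V → Fin n with Setoid.ker i = s,
        ((n : ℝ) ^ numClasses (Setoid.ker i))⁻¹ ≤ ∑ _s : Setoid V, (1 : ℝ) := by
        refine Finset.sum_le_sum fun s _ => ?_
        have : ∑ i : V → Fin n with Setoid.ker i = s, ((n : ℝ) ^ numClasses (Setoid.ker i))⁻¹
            = ∑ i : V → Fin n with Setoid.ker i = s, ((n : ℝ) ^ numClasses s)⁻¹ :=
          Finset.sum_congr rfl fun i hi => by rw [(Finset.mem_filter.1 hi).2]
        rw [this, Finset.sum_const, nsmul_eq_mul]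
        have h := card_ker_eq_le s n
        have h' : (Finset.card {i : V → Fin n | Setoid.ker i = s} : ℝ) ≤ (n : ℝ) ^ numClasses s := by
          exact_mod_cast h
        exact mul_inv_le_one_of_le₀ h' (by positivity)
    _ = _ := by simp

/-- If no class of `s` is a singleton, then there are at most `|V| / 2` classes. -/
theorem two_mul_numClasses_le {V : Type*} [Fintype V] (s : Setoid V)
    (hs : ∀ v, ∃ w, w ≠ v ∧ s v w) : 2 * numClasses s ≤ Fintype.card V := by
  have h1 : Fintype.card V = ∑ b : Quotient s, Finset.card {v : V | Quotient.mk'' v = b} :=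
    Finset.card_eq_sum_card_fiberwise (f := fun v : V => (Quotient.mk'' v : Quotient s))
      fun _ _ => Finset.mem_coe.2 (Finset.mem_univ _)
  rw [h1, numClasses, Nat.card_eq_fintype_card]
  calc 2 * Fintype.card (Quotient s) = ∑ _b : Quotient s, 2 := by simp [mul_comm]
    _ ≤ _ := by
      refine Finset.sum_le_sum fun b _ => ?_
      induction b using Quotient.inductionOn' with
      | h v =>
        obtain ⟨w, hwv, hw⟩ := hs v
        rw [Nat.succ_le_iff, Finset.one_lt_card]
        refine ⟨v, by simp, w, ?_, hwv.symm⟩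
        simp only [Finset.mem_filter, Finset.mem_univ, true_and]
        exact Quotient.sound' (s.symm' hw)

/-! ### Sums of products of entries of a delocalized orthogonal matrix over a bipartite graph -/

/-- Connectedness of the bipartite multigraph with edge set `F` and end points `l f`, `r f`. -/
def BipConnected {L R F : Type*} (l : F → L) (r : F → R) : Prop :=
  ∀ (φ : L → Prop) (ψ : R → Prop), (∀ f, φ (l f) ↔ ψ (r f)) → ((∃ x, φ x) ∨ ∃ y, ψ y) →
    (∀ x, φ x) ∧ ∀ y, ψ y

/-- All the vertices `l f` have even degree. -/
def EvenDegrees {L F : Type*} [Fintype F] (l : F → L) : Prop :=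
  ∀ ε : L → ℤˣ, ∏ f, ε (l f) = 1

theorem BipConnected.symm {L R F : Type*} {l : F → L} {r : F → R} (h : BipConnected l r) :
    BipConnected r l := fun φ ψ hf he =>
  (h ψ φ (fun f => (hf f).symm) he.symm).symm

theorem BipConnected.map {L R F L' R' : Type*} {l : F → L} {r : F → R} (h : BipConnected l r)
    {p : L → L'} {p' : R → R'} (hp : Function.Surjective p) (hp' : Function.Surjective p') :
    BipConnected (fun f => p (l f)) fun f => p' (r f) := by
  intro φ ψ hf he
  have := h (fun x => φ (p x)) (fun y => ψ (p' y)) hf (by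
    rcases he with ⟨x, hx⟩ | ⟨y, hy⟩
    · obtain ⟨x, rfl⟩ := hp x; exact Or.inl ⟨x, hx⟩
    · obtain ⟨y, rfl⟩ := hp' y; exact Or.inr ⟨y, hy⟩)
  refine ⟨fun x => ?_, fun y => ?_⟩
  · obtain ⟨x, rfl⟩ := hp x; exact this.1 x
  · obtain ⟨y, rfl⟩ := hp' y; exact this.2 y

theorem EvenDegrees.map {L F L' : Type*} [Fintype F] {l : F → L} (h : EvenDegrees l)
    (p : L → L') : EvenDegrees fun f => p (l f) := fun ε => h fun x => ε (p x)

theorem EvenDegrees.even_card {L F : Type*} [Fintype F] {l : F → L} (h : EvenDegrees l) (x : L) :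
    Even (Finset.card {f | l f = x}) := by
  have := h fun y => if y = x then -1 else 1
  rw [Finset.prod_ite, Finset.prod_const, Finset.prod_const_one, mul_one] at this
  by_contra hodd
  rw [Nat.not_even_iff_odd] at hodd
  rw [hodd.neg_one_pow] at this
  exact absurd this (by decide)

/-- The product of the entries of `H` along the edges of a bipartite graph. -/
def bipWeight {L R F : Type*} [Fintype F] {n : ℕ} (H : Matrix (Fin n) (Fin n) ℝ) (l : F → L)
    (r : F → R) (i : L → Fin n) (k : R → Fin n) : ℝ := ∏ f, H (i (l f)) (k (r f))

/-- The entries of the orthogonal matrix `H` are `n^{-1/2}` up to the factor `g^{1/2}`, where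
`g^m ≤ n`. -/
structure Delocalized {n : ℕ} (H : Matrix (Fin n) (Fin n) ℝ) (g : ℝ) (m : ℕ) : Prop where
  orth : H ∈ Matrix.orthogonalGroup (Fin n) ℝ
  one_le : 1 ≤ g
  pow_le : g ^ m ≤ n
  entry : ∀ i j, n * H i j ^ 2 ≤ g

theorem Delocalized.transpose {n : ℕ} {H : Matrix (Fin n) (Fin n) ℝ} {g : ℝ} {m : ℕ}
    (h : Delocalized H g m) : Delocalized H.transpose g m where
  orth := by
    have := h.orth
    rw [Matrix.mem_orthogonalGroup_iff'] at this
    rw [Matrix.mem_orthogonalGroup_iff]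
    simpa [Matrix.star_eq_conjTranspose] using this
  one_le := h.one_le
  pow_le := h.pow_le
  entry i j := h.entry j i

theorem Delocalized.sum_mul {n : ℕ} {H : Matrix (Fin n) (Fin n) ℝ} {g : ℝ} {m : ℕ}
    (h : Delocalized H g m) (a b : Fin n) : ∑ c, H a c * H b c = if a = b then 1 else 0 := by
  have := h.orth
  rw [Matrix.mem_orthogonalGroup_iff] at this
  have h2 := congrFun (congrFun this a) b
  simpa [Matrix.mul_apply, Matrix.star_eq_conjTranspose, Matrix.one_apply] using h2

theorem Delocalized.n_pos {n : ℕ} {H : Matrix (Fin n) (Fin n) ℝ} {g : ℝ} {m : ℕ}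
    (h : Delocalized H g m) : 1 ≤ (n : ℝ) := (one_le_pow₀ h.one_le).trans h.pow_le

theorem Delocalized.abs_prod_le {n : ℕ} {H : Matrix (Fin n) (Fin n) ℝ} {g : ℝ} {m : ℕ}
    (h : Delocalized H g m) {F : Type*} [Fintype F] {e : ℕ} (he : Fintype.card F = 2 * e)
    (a b : F → Fin n) : |∏ f, H (a f) (b f)| ≤ (g / n) ^ e := by
  have hn := h.n_pos
  have hg := h.one_le
  have hn0 : (0 : ℝ) < n := by linarith
  apply abs_le_of_sq_le_sq _ (by positivity)
  rw [← Finset.prod_pow]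
  calc ∏ f, H (a f) (b f) ^ 2 ≤ ∏ _f : F, g / n := by
        apply Finset.prod_le_prod (fun f _ => sq_nonneg _)
        intro f _
        rw [le_div_iff₀ hn0, mul_comm]
        exact h.entry _ _
    _ = ((g / n) ^ e) ^ 2 := by
        rw [Finset.prod_const, Finset.card_univ, he, pow_mul']

/-- With `2e` edges and all degrees at least four there are at most `e` vertices. So there are at
most `n ^ e` terms, each at most `(g / n) ^ e`, and `g ^ e ≤ g ^ m ≤ n`. -/
theorem Delocalized.abs_sum_le_of_four_le {n : ℕ} {H : Matrix (Fin n) (Fin n) ℝ} {g : ℝ} {m : ℕ}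
    (h : Delocalized H g m) {L R F : Type u} [Fintype L] [Fintype R] [Fintype F]
    (l : F → L) (r : F → R) (hl : ∀ x, 4 ≤ Finset.card {f | l f = x})
    (hr : ∀ x, 4 ≤ Finset.card {f | r f = x}) (heven : Even (Fintype.card F))
    (hF : Fintype.card F ≤ 2 * m) :
    |∑ i, ∑ k, bipWeight H l r i k| ≤ n := by
  obtain ⟨e, he⟩ := heven
  have hn := h.n_pos
  have hg := h.one_le
  have hn0 : (0 : ℝ) < n := by linarith
  have hcard : ∀ {X : Type u} [Fintype X] (p : F → X), (∀ x, 4 ≤ Finset.card {f | p f = x}) →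
      4 * Fintype.card X ≤ Fintype.card F := by
    intro X _ p hp
    have h1 : Fintype.card F = ∑ b : X, Finset.card {f | p f = b} :=
      Finset.card_eq_sum_card_fiberwise fun _ _ => Finset.mem_coe.2 (Finset.mem_univ _)
    rw [h1]
    calc 4 * Fintype.card X = ∑ _b : X, 4 := by simp [mul_comm]
      _ ≤ _ := Finset.sum_le_sum fun b _ => hp b
  have hL := hcard l hl
  have hR := hcard r hr
  calc |∑ i, ∑ k, bipWeight H l r i k|
      ≤ ∑ i : L → Fin n, ∑ k : R → Fin n, (g / n) ^ e := by
        refine (Finset.abs_sum_le_sum_abs _ _).trans (Finset.sum_le_sum fun i _ => ?_)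
        refine (Finset.abs_sum_le_sum_abs _ _).trans (Finset.sum_le_sum fun k _ => ?_)
        exact h.abs_prod_le (by omega) _ _
    _ = (n : ℝ) ^ (Fintype.card L + Fintype.card R) * (g / n) ^ e := by
        simp [pow_add]; ring
    _ ≤ (n : ℝ) ^ e * (g / n) ^ e := by
        gcongr
        omega
    _ = g ^ e := by rw [← mul_pow]; congr 1; field_simp
    _ ≤ g ^ m := pow_le_pow_right₀ hg (by omega)
    _ ≤ n := h.pow_le

/-- Summing over a vertex of degree two identifies its two neighbours. -/
theorem sum_bipWeight_of_degree_two {n : ℕ} {H : Matrix (Fin n) (Fin n) ℝ} {g : ℝ} {m : ℕ}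
    (h : Delocalized H g m) {L R F : Type*} [Fintype L] [Fintype R] [Fintype F]
    (l : F → L) (r : F → R) (r₀ : R) (f₁ f₂ : F) (hne : f₁ ≠ f₂)
    (hf : ∀ f, r f = r₀ ↔ f = f₁ ∨ f = f₂) (s : Setoid L)
    (hs : ∀ i : L → Fin n, s ≤ Setoid.ker i ↔ i (l f₁) = i (l f₂)) :
    ∑ i, ∑ k, bipWeight H l r i k = ∑ i : Quotient s → Fin n, ∑ k : {y // y ≠ r₀} → Fin n,
      bipWeight H (fun f : {f // r f ≠ r₀} => (Quotient.mk'' (l f.1) : Quotient s))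
        (fun f => (⟨r f.1, f.2⟩ : {y // y ≠ r₀})) i k := by
  have h1 : ∀ i : L → Fin n, ∑ k, bipWeight H l r i k
      = if s ≤ Setoid.ker i then ∑ k : {y // y ≠ r₀} → Fin n,
        ∏ f : {f // r f ≠ r₀}, H (i (l f.1)) (k ⟨r f.1, f.2⟩) else 0 := by
    intro i
    rw [← Equiv.sum_comp (Equiv.piSplitAt r₀ fun _ => Fin n).symm, Fintype.sum_prod_type_right]
    have h2 : ∀ (c : Fin n) (k : {y // y ≠ r₀} → Fin n),
        bipWeight H l r i ((Equiv.piSplitAt r₀ fun _ => Fin n).symm (c, k))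
          = (H (i (l f₁)) c * H (i (l f₂)) c) *
            ∏ f : {f // r f ≠ r₀}, H (i (l f.1)) (k ⟨r f.1, f.2⟩) := by
      intro c k
      unfold bipWeight
      rw [← Fintype.prod_subtype_mul_prod_subtype (fun f => r f = r₀)]
      congr 1
      · rw [← Finset.prod_subtype (p := fun f => r f = r₀) {f₁, f₂} (by simp [hf])
          (fun f => H (i (l f)) ((Equiv.piSplitAt r₀ fun _ => Fin n).symm (c, k) (r f))),
          Finset.prod_pair hne]
        have e1 : r f₁ = r₀ := (hf f₁).2 (Or.inl rfl)
        have e2 : r f₂ = r₀ := (hf f₂).2 (Or.inr rfl)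
        simp [e1, e2, Equiv.piSplitAt]
      · refine Finset.prod_congr rfl fun f _ => ?_
        simp [Equiv.piSplitAt, f.2]
    simp only [h2]
    simp only [← Finset.sum_mul, h.sum_mul, ← Finset.mul_sum, hs]
    split_ifs <;> simp
  simp only [h1]
  rw [← Finset.sum_filter, sum_le_ker]
  rfl

theorem exists_pair_of_card_eq_two {F : Type*} [Fintype F] {p : F → Prop}
    (h : Finset.card {f | p f} = 2) : ∃ f₁ f₂, f₁ ≠ f₂ ∧ ∀ f, p f ↔ f = f₁ ∨ f = f₂ := by
  obtain ⟨f₁, f₂, hne, he⟩ := Finset.card_eq_two.1 h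
  refine ⟨f₁, f₂, hne, fun f => ?_⟩
  have : f ∈ Finset.univ.filter p ↔ f ∈ ({f₁, f₂} : Finset F) := by rw [he]
  simpa using this

theorem BipConnected.degree_pos {L R F : Type*} [Fintype F] [Nonempty F] {l : F → L} {r : F → R}
    (h : BipConnected l r) (x : R) : 0 < Finset.card {f | r f = x} := by
  rw [Finset.card_pos]
  by_contra hx
  rw [Finset.not_nonempty_iff_eq_empty, Finset.filter_eq_empty_iff] at hx
  have := h (fun _ => False) (fun y => y = x) (fun f => by simpa using hx (Finset.mem_univ f))
    (Or.inr ⟨x, rfl⟩)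
  obtain ⟨f⟩ := ‹Nonempty F›
  exact this.1 (l f)

/-- Induction on the number of vertices. A vertex of degree two is summed out by orthogonality,
which merges its neighbours and keeps the graph connected with even degrees. When none is left on
either side, all degrees are at least four or there are no edges. -/
theorem abs_sum_bipWeight_le (N : ℕ) : ∀ {L R F : Type u} [Fintype L] [Fintype R] [Fintype F]
    (l : F → L) (r : F → R), BipConnected l r → EvenDegrees l → EvenDegrees r →
    Fintype.card L + Fintype.card R ≤ N → ∀ {n : ℕ} {H : Matrix (Fin n) (Fin n) ℝ} {g : ℝ} {m : ℕ},
    Delocalized H g m → Fintype.card F ≤ 2 * m → |∑ i, ∑ k, bipWeight H l r i k| ≤ n := by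
  induction N with
  | zero =>
    intro L R F _ _ _ l r hc hl hr hN n H g m h hF
    have h1 : IsEmpty L := Fintype.card_eq_zero_iff.1 (by omega)
    have h2 : IsEmpty R := Fintype.card_eq_zero_iff.1 (by omega)
    have h3 : IsEmpty F := ⟨fun f => h1.elim (l f)⟩
    simpa [bipWeight] using h.n_pos
  | succ N ih =>
    have step : ∀ {L R F : Type u} [Fintype L] [Fintype R] [Fintype F]
        (l : F → L) (r : F → R), BipConnected l r → EvenDegrees l → EvenDegrees r →
        Fintype.card L + Fintype.card R ≤ N + 1 → ∀ {n : ℕ} {H : Matrix (Fin n) (Fin n) ℝ} {g : ℝ}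
        {m : ℕ}, Delocalized H g m → Fintype.card F ≤ 2 * m →
        (∃ r₀, Finset.card {f | r f = r₀} = 2) → |∑ i, ∑ k, bipWeight H l r i k| ≤ n := by
      intro L R F _ _ _ l r hc hl hr hN n H g m h hF ⟨r₀, hr₀⟩
      obtain ⟨f₁, f₂, hne, hf⟩ := exists_pair_of_card_eq_two hr₀
      -- The relation generated by the single pair covers also the case `l f₁ = l f₂`, where nothing
      -- is merged and the row has norm one.
      let s : Setoid L := Relation.EqvGen.setoid fun a b => a = l f₁ ∧ b = l f₂
      have hs12 : s (l f₁) (l f₂) := Relation.EqvGen.rel _ _ ⟨rfl, rfl⟩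
      have hs : ∀ i : L → Fin n, s ≤ Setoid.ker i ↔ i (l f₁) = i (l f₂) := by
        intro i
        constructor
        · exact fun hle => hle hs12
        · intro heq
          refine Setoid.eqvGen_le ?_
          rintro a b ⟨rfl, rfl⟩
          exact heq
      rw [sum_bipWeight_of_degree_two h l r r₀ f₁ f₂ hne hf s hs]
      have hmk : (Quotient.mk'' (l f₁) : Quotient s) = Quotient.mk'' (l f₂) := Quotient.sound' hs12
      have e1 : r f₁ = r₀ := (hf f₁).2 (Or.inl rfl)
      have e2 : r f₂ = r₀ := (hf f₂).2 (Or.inr rfl)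
      set l' : {f // r f ≠ r₀} → Quotient s := fun f => Quotient.mk'' (l f.1) with hl'
      set r' : {f // r f ≠ r₀} → {y // y ≠ r₀} := fun f => ⟨r f.1, f.2⟩ with hr'
      have hc' : BipConnected l' r' := by
        intro φ ψ hφψ hex
        have := hc (fun x => φ (Quotient.mk'' x))
          (fun y => if hy : y = r₀ then φ (Quotient.mk'' (l f₁)) else ψ ⟨y, hy⟩) ?_ ?_
        · refine ⟨fun q => ?_, fun y => ?_⟩
          · induction q using Quotient.inductionOn' with
            | h a => exact this.1 a
          · have h3 := this.2 y.1
            rwa [dif_neg y.2] at h3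
        · intro f
          by_cases hfr : r f = r₀
          · simp only [hfr, dite_true]
            rcases (hf f).1 hfr with rfl | rfl
            · rfl
            · rw [hmk]
          · simp only [hfr, dite_false]
            exact hφψ ⟨f, hfr⟩
        · rcases hex with ⟨q, hq⟩ | ⟨y, hy⟩
          · induction q using Quotient.inductionOn' with
            | h a => exact Or.inl ⟨a, hq⟩
          · exact Or.inr ⟨y.1, by simpa [y.2] using hy⟩
      have hle : EvenDegrees l' := by
        intro ε
        have h3 := hl fun x => ε (Quotient.mk'' x)
        rw [← Fintype.prod_subtype_mul_prod_subtype (fun f => r f = r₀),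
          ← Finset.prod_subtype (p := fun f => r f = r₀) {f₁, f₂} (by simp [hf])
          (fun f => ε (Quotient.mk'' (l f))), Finset.prod_pair hne, hmk, Int.units_mul_self,
          one_mul] at h3
        exact h3
      have hre : EvenDegrees r' := by
        intro ε
        have h3 := hr fun y => if hy : y = r₀ then 1 else ε ⟨y, hy⟩
        rw [← Fintype.prod_subtype_mul_prod_subtype (fun f => r f = r₀)] at h3
        rw [Finset.prod_eq_one, one_mul] at h3
        · rw [← h3]
          exact Finset.prod_congr rfl fun f _ => by rw [dif_neg f.2]
        · intro f _
          rw [dif_pos f.2]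
      have hcard : Fintype.card (Quotient s) + Fintype.card {y // y ≠ r₀} ≤ N := by
        have h4 : Fintype.card (Quotient s) ≤ Fintype.card L :=
          Fintype.card_le_of_surjective _ Quotient.mk''_surjective
        have h5 : Fintype.card {y // y ≠ r₀} < Fintype.card R :=
          Fintype.card_subtype_lt (x := r₀) (by simp)
        omega
      convert ih l' r' hc' hle hre hcard h ((Fintype.card_subtype_le _).trans hF)
    intro L R F _ _ _ l r hc hl hr hN n H g m h hF
    by_cases hR : ∃ r₀, Finset.card {f | r f = r₀} = 2
    · exact step l r hc hl hr hN h hF hR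
    by_cases hL : ∃ r₀, Finset.card {f | l f = r₀} = 2
    · have := step r l hc.symm hr hl (by omega) h.transpose hF hL
      rw [Finset.sum_comm] at this
      exact this
    rcases isEmpty_or_nonempty F with hF0 | hF0
    · simp only [bipWeight, Finset.univ_eq_empty, Finset.prod_empty]
      -- Without edges every set of vertices is closed, so connectedness leaves at most one vertex.
      have hcard : Fintype.card L + Fintype.card R ≤ 1 := by
        rcases isEmpty_or_nonempty L with hL0 | ⟨⟨x⟩⟩
        · rcases isEmpty_or_nonempty R with hR0 | ⟨⟨y⟩⟩
          · simp
          · have h6 := (hc (fun _ => True) (fun z => z = y) (fun f => hF0.elim f)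
              (Or.inr ⟨y, rfl⟩)).2
            have : Fintype.card R ≤ 1 := Fintype.card_le_one_iff.2 fun a b => (h6 a).trans (h6 b).symm
            have : Fintype.card L = 0 := Fintype.card_eq_zero
            omega
        · have h6 := hc (fun z => z = x) (fun _ => False) (fun f => hF0.elim f) (Or.inl ⟨x, rfl⟩)
          have : Fintype.card L ≤ 1 :=
            Fintype.card_le_one_iff.2 fun a b => (h6.1 a).trans (h6.1 b).symm
          have : Fintype.card R = 0 := Fintype.card_eq_zero_iff.2 ⟨fun y => h6.2 y⟩
          omega
      have : ∑ i : L → Fin n, ∑ k : R → Fin n, (1 : ℝ)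
          = (n : ℝ) ^ (Fintype.card L + Fintype.card R) := by simp [pow_add]
      rw [this, abs_of_nonneg (by positivity)]
      calc (n : ℝ) ^ (Fintype.card L + Fintype.card R) ≤ (n : ℝ) ^ 1 :=
            pow_le_pow_right₀ h.n_pos hcard
        _ = n := pow_one _
    · have hfour : ∀ d : ℕ, 0 < d → Even d → d ≠ 2 → 4 ≤ d := by
        rintro d h0 ⟨e, rfl⟩ h2; omega
      refine h.abs_sum_le_of_four_le l r (fun x => ?_) (fun x => ?_) ?_ hF
      · exact hfour _ (hc.symm.degree_pos x) (hl.even_card x) fun h2 => hL ⟨x, h2⟩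
      · exact hfour _ (hc.degree_pos x) (hr.even_card x) fun h2 => hR ⟨x, h2⟩
      · have := (hl.map fun _ => ()).even_card ()
        simpa using this

/-- The sum over the maps with prescribed kernels. -/
theorem exists_abs_sum_ker_bipWeight_le {L R F : Type u} [Fintype L] [Fintype R] [Fintype F]
    (l : F → L) (r : F → R) (hr : EvenDegrees r) (p : Setoid L × Setoid R) :
    BipConnected (fun f => (Quotient.mk'' (l f) : Quotient p.1))
      (fun f => (Quotient.mk'' (r f) : Quotient p.2)) →
    EvenDegrees (fun f => (Quotient.mk'' (l f) : Quotient p.1)) →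
    ∃ C : ℝ, 0 ≤ C ∧ ∀ {n : ℕ} {H : Matrix (Fin n) (Fin n) ℝ} {g : ℝ} {m : ℕ},
      Delocalized H g m → Fintype.card F ≤ 2 * m →
      |∑ i with Setoid.ker i = p.1, ∑ k with Setoid.ker k = p.2, bipWeight H l r i k| ≤ C * n := by
  -- Möbius inversion by induction from the coarsest pair downwards: the sum over all kernels above
  -- `(s, t)` is the unrestricted sum of the quotient graph, and the sums for strictly coarser pairs
  -- are already bounded. Connectedness and even degrees pass to coarser quotients. On the left,
  -- even degrees are required only after the identification.
  induction p using WellFoundedGT.induction with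
  | ind p ih =>
    obtain ⟨s, t⟩ := p
    intro hc hl
    simp only at hc hl ih ⊢
    have hgood : ∀ q : Setoid L × Setoid R, (s, t) < q →
        ∃ C : ℝ, 0 ≤ C ∧ ∀ {n : ℕ} {H : Matrix (Fin n) (Fin n) ℝ} {g : ℝ} {m : ℕ},
          Delocalized H g m → Fintype.card F ≤ 2 * m →
          |∑ i with Setoid.ker i = q.1, ∑ k with Setoid.ker k = q.2, bipWeight H l r i k|
            ≤ C * n := by
      intro q hq
      have hle1 : s ≤ q.1 := hq.le.1
      have hle2 : t ≤ q.2 := hq.le.2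
      refine ih q hq ?_ ?_
      · exact hc.map (p := Quotient.map' id fun a b hab => hle1 hab)
          (p' := Quotient.map' id fun a b hab => hle2 hab)
          (fun q => by
            induction q using Quotient.inductionOn' with
            | h a => exact ⟨Quotient.mk'' a, rfl⟩)
          (fun q => by
            induction q using Quotient.inductionOn' with
            | h a => exact ⟨Quotient.mk'' a, rfl⟩)
      · exact hl.map (Quotient.map' id fun a b hab => hle1 hab)
    choose! C hC0 hC using hgood
    refine ⟨1 + ∑ q with (s, t) < q, C q, ?_, ?_⟩
    · have : 0 ≤ ∑ q with (s, t) < q, C q :=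
        Finset.sum_nonneg fun q hq => hC0 q (Finset.mem_filter.1 hq).2
      linarith
    intro n H g m h hF
    let a : Setoid L × Setoid R → ℝ := fun q =>
      ∑ i with Setoid.ker i = q.1, ∑ k with Setoid.ker k = q.2, bipWeight H l r i k
    have hsum : ∑ i : Quotient s → Fin n, ∑ k : Quotient t → Fin n,
        bipWeight H (fun f => (Quotient.mk'' (l f) : Quotient s))
          (fun f => (Quotient.mk'' (r f) : Quotient t)) i k
        = ∑ q with (s, t) ≤ q, a q := by
      have e1 : ∑ i : Quotient s → Fin n, ∑ k : Quotient t → Fin n,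
          bipWeight H (fun f => (Quotient.mk'' (l f) : Quotient s))
            (fun f => (Quotient.mk'' (r f) : Quotient t)) i k
          = ∑ i with s ≤ Setoid.ker i, ∑ k with t ≤ Setoid.ker k, bipWeight H l r i k := by
        rw [sum_le_ker s]
        refine Finset.sum_congr rfl fun i _ => ?_
        rw [sum_le_ker t]
        rfl
      have e2 : ∀ {X : Type u} [Fintype X] (u : Setoid X) (φ : (X → Fin n) → ℝ),
          ∑ i with u ≤ Setoid.ker i, φ i = ∑ v with u ≤ v, ∑ i with Setoid.ker i = v, φ i := by
        intro X _ u φ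
        rw [sum_le_ker_eq]
        have : (Finset.univ.filter fun t => u ≤ t) = insert u (Finset.univ.filter fun t => u < t) := by
          ext t
          simp [le_iff_eq_or_lt, eq_comm]
        rw [this, Finset.sum_insert (by simp)]
      rw [e1, e2]
      have e3 : (Finset.univ.filter fun q : Setoid L × Setoid R => (s, t) ≤ q)
          = (Finset.univ.filter fun u => s ≤ u) ×ˢ (Finset.univ.filter fun u => t ≤ u) := by
        ext q
        simp [Prod.le_def]
      rw [e3, Finset.sum_product]
      refine Finset.sum_congr rfl fun u _ => ?_
      simp only [e2, a]
      rw [Finset.sum_comm]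
    have hall : |∑ q with (s, t) ≤ q, a q| ≤ n := by
      rw [← hsum]
      convert abs_sum_bipWeight_le _ _ _ hc hl (hr.map _) le_rfl h hF
    have e4 : (Finset.univ.filter fun q => (s, t) ≤ q)
        = insert (s, t) (Finset.univ.filter fun q => (s, t) < q) := by
      ext q
      simp [le_iff_eq_or_lt, eq_comm]
    rw [e4, Finset.sum_insert (by simp)] at hall
    have h7 : |∑ q with (s, t) < q, a q| ≤ ∑ q with (s, t) < q, C q * n :=
      (Finset.abs_sum_le_sum_abs _ _).trans
        (Finset.sum_le_sum fun q hq => hC q (Finset.mem_filter.1 hq).2 h hF)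
    rw [← Finset.sum_mul] at h7
    change |a (s, t)| ≤ _
    have h8 : a (s, t) = (a (s, t) + ∑ q with (s, t) < q, a q) - ∑ q with (s, t) < q, a q := by ring
    rw [h8]
    refine (abs_sub _ _).trans ?_
    linarith

/-! ### Poincaré inequalities on finite sets -/

/-- The average of a function over a finite set. -/
def uavg {X : Type*} [Fintype X] (f : X → ℝ) : ℝ := (Fintype.card X : ℝ)⁻¹ * ∑ x, f x

section uavg

variable {X Y : Type*} [Fintype X] [Fintype Y]

theorem uavg_mono {f g : X → ℝ} (h : ∀ x, f x ≤ g x) : uavg f ≤ uavg g := by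
  unfold uavg; gcongr with x; exact h x

theorem uavg_nonneg {f : X → ℝ} (h : ∀ x, 0 ≤ f x) : 0 ≤ uavg f :=
  mul_nonneg (by positivity) (Finset.sum_nonneg fun x _ => h x)

theorem uavg_add (f g : X → ℝ) : uavg (fun x => f x + g x) = uavg f + uavg g := by
  simp [uavg, Finset.sum_add_distrib, mul_add]

theorem uavg_sub (f g : X → ℝ) : uavg (fun x => f x - g x) = uavg f - uavg g := by
  simp [uavg, Finset.sum_sub_distrib, mul_sub]

theorem uavg_const_mul (c : ℝ) (f : X → ℝ) : uavg (fun x => c * f x) = c * uavg f := by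
  simp only [uavg, ← Finset.mul_sum]; ring

theorem uavg_mul_const (c : ℝ) (f : X → ℝ) : uavg (fun x => f x * c) = uavg f * c := by
  simp only [uavg, ← Finset.sum_mul]; ring

theorem uavg_const [Nonempty X] (c : ℝ) : uavg (fun _ : X => c) = c := by
  simp [uavg]

theorem uavg_sum {J : Type*} (s : Finset J) (f : J → X → ℝ) :
    uavg (fun x => ∑ j ∈ s, f j x) = ∑ j ∈ s, uavg (f j) := by
  simp only [uavg, ← Finset.mul_sum]; rw [Finset.sum_comm]

theorem uavg_comp_equiv (e : Y ≃ X) (f : X → ℝ) : uavg (fun y => f (e y)) = uavg f := by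
  unfold uavg; rw [Equiv.sum_comp e f, Fintype.card_congr e]

theorem uavg_prod (f : X × Y → ℝ) : uavg f = uavg fun x => uavg fun y => f (x, y) := by
  simp only [uavg, Fintype.card_prod, Fintype.sum_prod_type, ← Finset.mul_sum, Nat.cast_mul,
    mul_inv]
  ring

theorem uavg_comm (f : X → Y → ℝ) :
    (uavg fun x => uavg fun y => f x y) = uavg fun y => uavg fun x => f x y := by
  simp only [uavg, ← Finset.mul_sum]; rw [Finset.sum_comm]; ring

theorem sq_uavg_le (f : X → ℝ) : uavg f ^ 2 ≤ uavg fun x => f x ^ 2 := by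
  unfold uavg
  rcases isEmpty_or_nonempty X with hX | hX
  · simp
  have h := sq_sum_le_card_mul_sum_sq (s := (Finset.univ : Finset X)) (f := f)
  rw [Finset.card_univ] at h
  have hc : (0 : ℝ) < Fintype.card X := by exact_mod_cast Fintype.card_pos
  rw [mul_pow, inv_pow, inv_mul_le_iff₀ (by positivity)]
  calc (∑ x, f x) ^ 2 ≤ Fintype.card X * ∑ x, f x ^ 2 := h
    _ = _ := by field_simp

theorem uavg_variance_eq [Nonempty X] (f : X → ℝ) :
    uavg (fun x => f x ^ 2) - uavg f ^ 2
      = 2⁻¹ * uavg fun x => uavg fun y => (f x - f y) ^ 2 := by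
  have : ∀ x, (uavg fun y => (f x - f y) ^ 2)
      = f x ^ 2 - 2 * f x * uavg f + uavg fun y => f y ^ 2 := by
    intro x
    have h1 : ∀ y, (f x - f y) ^ 2 = (f x ^ 2 - 2 * f x * f y) + f y ^ 2 := fun y => by ring
    simp only [h1]
    rw [uavg_add, uavg_sub, uavg_const_mul, uavg_const]
  simp only [this]
  rw [uavg_add, uavg_sub, uavg_const, uavg_mul_const, uavg_const_mul]
  ring

/-- The Poincaré inequality for the uniform distribution on `X` and the Dirichlet form of the
maps `T j`, with weights `w j`. -/
def Poincare {J : Type*} [Fintype J] (w : J → ℝ) (T : J → Equiv.Perm X) : Prop :=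
  ∀ f : X → ℝ, uavg (fun x => f x ^ 2) - uavg f ^ 2
    ≤ ∑ j, w j * uavg fun x => (f x - f (T j x)) ^ 2

variable {J J' : Type*} [Fintype J] [Fintype J']

/-- The inequality is applied to `f - m` and to `(f - m) ^ 2`. The first bounds the squared variance
by `W * S`; the second bounds the rest of the fourth moment `A` by `16 * W * S + A / 4`. Absorbing
`A / 4` gives the constant `17 * 4 / 3 ≤ 23`. -/
theorem Poincare.fourth_moment [Nonempty X] {w : J → ℝ} {T : J → Equiv.Perm X}
    (h : Poincare w T) (hw : ∀ j, 0 ≤ w j) (hW : 0 < ∑ j, w j) (f : X → ℝ) :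
    (uavg fun x => (f x - uavg f) ^ 4)
      ≤ 23 * (∑ j, w j) * ∑ j, w j * uavg fun x => (f x - f (T j x)) ^ 4 := by
  set W := ∑ j, w j with hWdef
  set S := ∑ j, w j * uavg fun x => (f x - f (T j x)) ^ 4 with hS
  set m := uavg f
  set A := uavg fun x => (f x - m) ^ 4 with hA
  set V := uavg fun x => (f x - m) ^ 2 with hV
  have h1 : V ^ 2 ≤ W * S := by
    have h2 := h fun x => f x - m
    have h3 : uavg (fun x => f x - m) = 0 := by
      rw [uavg_sub, uavg_const]; exact sub_self _
    rw [h3] at h2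
    have h4 : V ≤ ∑ j, w j * uavg fun x => (f x - f (T j x)) ^ 2 := by
      simpa using h2
    have hV0 : 0 ≤ V := uavg_nonneg fun x => sq_nonneg _
    calc V ^ 2 ≤ (∑ j, w j * uavg fun x => (f x - f (T j x)) ^ 2) ^ 2 := by gcongr
      _ ≤ W * ∑ j, w j * (uavg fun x => (f x - f (T j x)) ^ 2) ^ 2 := by
        apply Finset.sum_sq_le_sum_mul_sum_of_sq_le_mul
        · exact fun j _ => hw j
        · exact fun j _ => mul_nonneg (hw j) (sq_nonneg _)
        · intro j _; exact le_of_eq (by ring)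
      _ ≤ W * S := by
        rw [hS]
        gcongr with j
        · exact hw j
        · refine (sq_uavg_le _).trans (le_of_eq ?_)
          congr 1; funext x; ring
  have h5 : A - V ^ 2 ≤ 16 * W * S + A / 4 := by
    have h2 := h fun x => (f x - m) ^ 2
    have e1 : (uavg fun x => ((f x - m) ^ 2) ^ 2) = A := by
      rw [hA]; congr 1; funext x; ring
    rw [e1] at h2
    refine h2.trans ?_
    have hj : ∀ j, (uavg fun x => ((f x - m) ^ 2 - (f (T j x) - m) ^ 2) ^ 2)
        ≤ 16 * W * (uavg fun x => (f x - f (T j x)) ^ 4) + A / (4 * W) := by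
      intro j
      have e2 : (uavg fun x => (f (T j x) - m) ^ 4) = A := uavg_comp_equiv (T j) fun x => (f x - m) ^ 4
      have e3 : A / (4 * W) = (8 * W)⁻¹ * (A + uavg fun x => (f (T j x) - m) ^ 4) := by
        rw [e2]; field_simp; ring
      rw [e3, hA, ← uavg_add, ← uavg_const_mul, ← uavg_const_mul, ← uavg_add]
      apply uavg_mono
      intro x
      set a := f x - m
      set b := f (T j x) - m
      have e4 : f x - f (T j x) = a - b := by ring
      rw [e4]
      have k1 : (a + b) ^ 4 ≤ 8 * (a ^ 4 + b ^ 4) := by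
        nlinarith [sq_nonneg (a - b), sq_nonneg (a + b), sq_nonneg (a ^ 2 - b ^ 2), sq_nonneg (a * b),
          mul_nonneg (sq_nonneg (a - b)) (sq_nonneg (a + b)), sq_nonneg ((a - b) ^ 2)]
      -- Arithmetic–geometric mean for `(a - b) ^ 2 * (a + b) ^ 2`. The weight is chosen so that the
      -- terms with `(a + b) ^ 4`, summed over `j`, contribute exactly `A / 4`.
      have k2 : (a ^ 2 - b ^ 2) ^ 2 ≤ 16 * W * (a - b) ^ 4 + (64 * W)⁻¹ * (a + b) ^ 4 := by
        have k3 : 0 ≤ (64 * W)⁻¹ * (32 * W * (a - b) ^ 2 - (a + b) ^ 2) ^ 2 := by positivity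
        have k4 : (64 * W)⁻¹ * (32 * W * (a - b) ^ 2 - (a + b) ^ 2) ^ 2
            = 16 * W * (a - b) ^ 4 + (64 * W)⁻¹ * (a + b) ^ 4 - (a ^ 2 - b ^ 2) ^ 2 := by
          field_simp; ring
        linarith
      have k5 : (64 * W)⁻¹ * (a + b) ^ 4 ≤ (64 * W)⁻¹ * (8 * (a ^ 4 + b ^ 4)) := by gcongr
      have k6 : (64 * W)⁻¹ * (8 * (a ^ 4 + b ^ 4)) = (8 * W)⁻¹ * (a ^ 4 + b ^ 4) := by
        field_simp; ring
      linarith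
    calc ∑ j, w j * uavg (fun x => ((f x - m) ^ 2 - (f (T j x) - m) ^ 2) ^ 2)
        ≤ ∑ j, w j * (16 * W * (uavg fun x => (f x - f (T j x)) ^ 4) + A / (4 * W)) := by
          gcongr with j
          · exact hw j
          · exact hj j
      _ = 16 * W * S + W * (A / (4 * W)) := by
          have e5 : ∀ j, w j * (16 * W * (uavg fun x => (f x - f (T j x)) ^ 4) + A / (4 * W))
              = 16 * W * (w j * uavg fun x => (f x - f (T j x)) ^ 4) + w j * (A / (4 * W)) :=
            fun j => by ring
          simp only [e5]
          rw [Finset.sum_add_distrib, ← Finset.mul_sum, ← Finset.sum_mul]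
      _ = 16 * W * S + A / 4 := by field_simp
  have hS0 : 0 ≤ S := Finset.sum_nonneg fun j _ =>
    mul_nonneg (hw j) (uavg_nonneg fun x => by positivity)
  nlinarith [mul_nonneg hW.le hS0]

/-- Tensorization: the variance is the mean of the variances in `y` plus the variance in `x` of the
mean over `y`; Jensen's inequality moves that mean out of the Dirichlet form. -/
theorem Poincare.prod [Nonempty X] [Nonempty Y] {w : J → ℝ} {T : J → Equiv.Perm X}
    {w' : J' → ℝ} {T' : J' → Equiv.Perm Y} (hw : ∀ j, 0 ≤ w j)
    (h : Poincare w T) (h' : Poincare w' T') :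
    Poincare (X := X × Y) (Sum.elim w w') (Sum.elim (fun j => (T j).prodCongr (Equiv.refl Y))
      fun j => (Equiv.refl X).prodCongr (T' j)) := by
  intro f
  rw [Fintype.sum_sum_type]
  simp only [Sum.elim_inl, Sum.elim_inr]
  have h1 : uavg (fun p => f p ^ 2) - uavg f ^ 2
      = (uavg fun x => uavg (fun y => f (x, y) ^ 2) - (uavg fun y => f (x, y)) ^ 2)
        + (uavg (fun x => (uavg fun y => f (x, y)) ^ 2) - (uavg fun x => uavg fun y => f (x, y)) ^ 2) := by
    rw [uavg_sub, uavg_prod, uavg_prod]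
    ring
  rw [h1, add_comm]
  refine add_le_add ((h _).trans ?_) ?_
  · gcongr with j
    · exact hw j
    · rw [uavg_prod]
      apply uavg_mono
      intro x
      rw [← uavg_sub]
      exact sq_uavg_le _
  · calc _ ≤ uavg fun x => ∑ j, w' j * uavg fun y => (f (x, y) - f (x, T' j y)) ^ 2 :=
          uavg_mono fun x => h' fun y => f (x, y)
      _ = _ := by
          rw [uavg_sum]
          refine Finset.sum_congr rfl fun j _ => ?_
          rw [uavg_const_mul, uavg_prod]
          rfl

theorem Poincare.congr {w : J → ℝ} {T : J → Equiv.Perm X} {w' : J' → ℝ} {T' : J' → Equiv.Perm Y}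
    (h : Poincare w T) (e : Y ≃ X) (σ : J' ≃ J) (hw : ∀ j, w' j = w (σ j))
    (hT : ∀ j y, e (T' j y) = T (σ j) (e y)) : Poincare w' T' := by
  intro f
  have h1 := h fun x => f (e.symm x)
  rw [← uavg_comp_equiv e, ← uavg_comp_equiv e] at h1
  simp only [Equiv.symm_apply_apply] at h1
  refine h1.trans (le_of_eq ?_)
  rw [← Equiv.sum_comp σ]
  refine Finset.sum_congr rfl fun j _ => ?_
  rw [hw, ← uavg_comp_equiv e]
  simp only [← hT, Equiv.symm_apply_apply]

end uavg

/-- Flipping the sign with index `a`. -/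
def signFlip {n : ℕ} (a : Fin n) : Equiv.Perm (Fin n → ℤˣ) :=
  Equiv.mulRight (Pi.mulSingle a (-1))

/-- For one sign the variance is exactly a quarter of `(f 1 - f (-1)) ^ 2`; the general case is
tensorization. -/
theorem poincare_signs (n : ℕ) : Poincare (fun _ : Fin n => (1 / 4 : ℝ)) signFlip := by
  induction n with
  | zero =>
    intro f
    simp [uavg]
  | succ n ih =>
    have h0 : Poincare (fun _ : Unit => (1 / 4 : ℝ)) (fun _ => Equiv.mulRight (-1 : ℤˣ)) := by
      intro f
      have hs : ∀ g : ℤˣ → ℝ, uavg g = 2⁻¹ * (g 1 + g (-1)) := by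
        intro g
        have : (Finset.univ : Finset ℤˣ) = {1, -1} := rfl
        simp [uavg, this]
      simp only [hs]
      simp
      nlinarith
    have h1 := h0.prod (fun _ => by norm_num) ih
    refine h1.congr (Fin.consEquiv fun _ => ℤˣ).symm
      ((finSuccEquiv n).trans ((Equiv.optionEquivSumPUnit _).trans (Equiv.sumComm _ _))) ?_ ?_
    · intro j
      refine Fin.cases ?_ (fun j => ?_) j
      · simp
      · simp
    · intro j y
      refine Fin.cases ?_ (fun j => ?_) j
      · simp [signFlip, Fin.consEquiv]
        funext i
        simp [Fin.tail, Fin.succ_ne_zero]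
      · simp [signFlip, Fin.consEquiv]
        funext i
        simp [Fin.tail, Pi.mulSingle_apply]


/-! ### Poincaré inequality for random transpositions -/

theorem sum_decomposeOption {β M : Type*} [Fintype β] [DecidableEq β] [AddCommMonoid M]
    (F : Equiv.Perm (Option β) → M) :
    ∑ σ, F σ = ∑ i : Option β, ∑ s : Equiv.Perm β, F (Equiv.swap none i * s.optionCongr) := by
  rw [← Equiv.sum_comp Equiv.Perm.decomposeOption.symm, Fintype.sum_prod_type]
  simp

theorem uavg_decomposeOption {β : Type*} [Fintype β] [DecidableEq β] (F : Equiv.Perm (Option β) → ℝ) :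
    uavg F = uavg fun i : Option β => uavg fun s : Equiv.Perm β =>
      F (Equiv.swap none i * s.optionCongr) := by
  rw [← uavg_comp_equiv Equiv.Perm.decomposeOption.symm, uavg_prod]
  simp

theorem sum_perm_of_apply_none {β M : Type*} [Fintype β] [DecidableEq β] [AddCommMonoid M]
    (F : Equiv.Perm (Option β) → M) (i : Option β) :
    ∑ s : Equiv.Perm β, F (Equiv.swap none i * s.optionCongr) = ∑ σ with σ none = i, F σ := by
  rw [Finset.sum_filter, sum_decomposeOption, Finset.sum_eq_single i]
  · simp
  · intro j _ hj
    simp [hj]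
  · simp

theorem sum_perm_swap_mul {β : Type*} [Fintype β] [DecidableEq β] (f : Equiv.Perm (Option β) → ℝ)
    (i j : Option β) : ∑ s : Equiv.Perm β, f (Equiv.swap i j * (Equiv.swap none i * s.optionCongr))
      = ∑ s : Equiv.Perm β, f (Equiv.swap none j * s.optionCongr) := by
  rw [sum_perm_of_apply_none (fun σ => f (Equiv.swap i j * σ)) i, sum_perm_of_apply_none f j,
    Finset.sum_filter, Finset.sum_filter, ← Equiv.sum_comp (Equiv.mulLeft (Equiv.swap i j))]
  refine Finset.sum_congr rfl fun σ _ => ?_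
  have : (Equiv.swap i j) (σ none) = i ↔ σ none = j := by
    rw [Equiv.swap_apply_eq_iff, Equiv.swap_apply_left]
  simp only [Equiv.coe_mulLeft, Equiv.Perm.mul_apply, this]
  simp [← mul_assoc]

theorem optionCongr_mul_swap {β : Type*} [DecidableEq β] (s : Equiv.Perm β) (a b : β) :
    (s * Equiv.swap a b).optionCongr = s.optionCongr * Equiv.swap (some a) (some b) := by
  rw [← Equiv.optionCongr_swap]
  ext1 x
  cases x <;> rfl

/-- The Dirichlet form of a function on permutations in the direction of a transposition. -/
def swapEnergy {α : Type*} [Fintype α] [DecidableEq α] (f : Equiv.Perm α → ℝ) (a b : α) : ℝ :=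
  uavg fun σ => (f σ - f (σ * Equiv.swap a b)) ^ 2

theorem swapEnergy_nonneg {α : Type*} [Fintype α] [DecidableEq α] (f : Equiv.Perm α → ℝ) (a b : α) :
    0 ≤ swapEnergy f a b := uavg_nonneg fun _ => sq_nonneg _

/-- Condition on the image `i` of `none`. The conditional variances are those of functions on the
permutations of `β`. The conditional means for `i` and `j` are compared through the bijection `σ ↦
swap i j * σ`. With `j = σ b` this is right multiplication by `swap none b`, so the differences are
energies of the transpositions that move `none`. -/
theorem variance_le_of_option {β : Type*} [Fintype β] [DecidableEq β] {c : ℝ}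
    (ih : ∀ f : Equiv.Perm β → ℝ, uavg (fun x => f x ^ 2) - uavg f ^ 2
      ≤ c * ∑ a, ∑ b, swapEnergy f a b) (f : Equiv.Perm (Option β) → ℝ) :
    uavg (fun x => f x ^ 2) - uavg f ^ 2 ≤ c * ∑ a : β, ∑ b : β, swapEnergy f (some a) (some b)
      + 1 / (2 * Fintype.card (Option β)) * ∑ b, swapEnergy f none b := by
  set g : Option β → ℝ := fun i => uavg fun s : Equiv.Perm β => f (Equiv.swap none i * s.optionCongr)
    with hg
  have h1 : uavg (fun x => f x ^ 2) - uavg f ^ 2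
      = (uavg fun i : Option β => uavg (fun s : Equiv.Perm β =>
          f (Equiv.swap none i * s.optionCongr) ^ 2) - g i ^ 2)
        + (uavg (fun i => g i ^ 2) - uavg g ^ 2) := by
    rw [uavg_sub, uavg_decomposeOption, uavg_decomposeOption f]
    ring
  rw [h1]
  refine add_le_add ?_ ?_
  · calc _ ≤ uavg fun i : Option β => c * ∑ a, ∑ b, swapEnergy
          (fun s : Equiv.Perm β => f (Equiv.swap none i * s.optionCongr)) a b :=
          uavg_mono fun i => ih _
      _ = _ := by
          rw [uavg_const_mul, uavg_sum]
          congr 1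
          refine Finset.sum_congr rfl fun a _ => ?_
          rw [uavg_sum]
          refine Finset.sum_congr rfl fun b _ => ?_
          unfold swapEnergy
          rw [uavg_decomposeOption fun σ => (f σ - f (σ * Equiv.swap (some a) (some b))) ^ 2]
          simp only [optionCongr_mul_swap, mul_assoc]
  · rw [uavg_variance_eq]
    have h2 : ∀ i j, (g i - g j) ^ 2 ≤ uavg fun s : Equiv.Perm β =>
        (f (Equiv.swap none i * s.optionCongr)
          - f (Equiv.swap i j * (Equiv.swap none i * s.optionCongr))) ^ 2 := by
      intro i j
      have : g j = uavg fun s : Equiv.Perm β =>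
          f (Equiv.swap i j * (Equiv.swap none i * s.optionCongr)) := by
        rw [hg]
        unfold uavg
        rw [sum_perm_swap_mul]
      rw [this, hg, ← uavg_sub]
      exact sq_uavg_le _
    have h3 : ∀ σ : Equiv.Perm (Option β),
        ∑ j, (f σ - f (Equiv.swap (σ none) j * σ)) ^ 2
          = ∑ b, (f σ - f (σ * Equiv.swap none b)) ^ 2 := by
      intro σ
      rw [← Equiv.sum_comp σ]
      refine Finset.sum_congr rfl fun b _ => ?_
      rw [Equiv.mul_swap_eq_swap_mul]
    have h4 : (uavg fun i : Option β => uavg fun j => (g i - g j) ^ 2)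
        ≤ uavg fun σ : Equiv.Perm (Option β) => uavg fun j =>
          (f σ - f (Equiv.swap (σ none) j * σ)) ^ 2 := by
      rw [uavg_decomposeOption]
      apply uavg_mono
      intro i
      rw [uavg_comm]
      apply uavg_mono
      intro j
      simpa using h2 i j
    have h5 : (uavg fun σ : Equiv.Perm (Option β) => uavg fun j =>
          (f σ - f (Equiv.swap (σ none) j * σ)) ^ 2)
        = (Fintype.card (Option β) : ℝ)⁻¹ * ∑ b, swapEnergy f none b := by
      have : ∀ σ : Equiv.Perm (Option β), (uavg fun j => (f σ - f (Equiv.swap (σ none) j * σ)) ^ 2)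
          = (Fintype.card (Option β) : ℝ)⁻¹ * ∑ b, (f σ - f (σ * Equiv.swap none b)) ^ 2 := by
        intro σ
        unfold uavg
        rw [h3]
      simp only [this]
      rw [uavg_const_mul, uavg_sum]
      rfl
    rw [h5] at h4
    calc _ ≤ 2⁻¹ * ((Fintype.card (Option β) : ℝ)⁻¹ * ∑ b, swapEnergy f none b) := by gcongr
      _ = _ := by rw [one_div, mul_inv]; ring

/-- The point `c` whose image is conditioned on is averaged over all points. For `N + 1` points this
gives the factor `(N - 1) / (2N) + 1 / (2(N + 1)) ≤ 1 / 2`, so the constant reproduces itself in the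
induction. A fixed `c` would not treat all transpositions equally. -/
theorem variance_perm_le (N : ℕ) : ∀ {α : Type u} [Fintype α] [DecidableEq α], Fintype.card α = N →
    ∀ f : Equiv.Perm α → ℝ, uavg (fun x => f x ^ 2) - uavg f ^ 2
      ≤ 1 / (2 * N) * ∑ a, ∑ b, swapEnergy f a b := by
  induction N with
  | zero =>
    intro α _ _ hα f
    have : IsEmpty α := Fintype.card_eq_zero_iff.1 hα
    simp [uavg]
  | succ N ih =>
    intro α _ _ hα f
    have hc : ∀ c : α, uavg (fun x => f x ^ 2) - uavg f ^ 2
        ≤ 1 / (2 * N) * ∑ a, ∑ b, (if a = c ∨ b = c then 0 else swapEnergy f a b)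
          + 1 / (2 * (N + 1)) * ∑ b, swapEnergy f c b := by
      intro c
      have hcard : Fintype.card {x // x ≠ c} = N := by
        rw [Fintype.card_subtype_compl]; simp [hα]
      let e : Option {x // x ≠ c} ≃ α := Equiv.optionSubtypeNe c
      let E : Equiv.Perm (Option {x // x ≠ c}) ≃ Equiv.Perm α := e.permCongr
      have h1 := variance_le_of_option (ih hcard) fun σ => f (E σ)
      have h2 : ∀ a b, swapEnergy (fun σ => f (E σ)) a b = swapEnergy f (e a) (e b) := by
        intro a b
        unfold swapEnergy
        rw [← uavg_comp_equiv E]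
        congr 1
        funext σ
        have : E (σ * Equiv.swap a b) = E σ * Equiv.swap (e a) (e b) := by
          ext x
          obtain ⟨y, rfl⟩ := e.surjective x
          simp only [E, Equiv.permCongr_apply, Equiv.Perm.mul_apply, e.injective.swap_apply,
            Equiv.symm_apply_apply]
        simp only [this]
      rw [uavg_comp_equiv E (fun σ => f σ ^ 2), uavg_comp_equiv E f] at h1
      simp only [h2, Fintype.card_option, hcard] at h1
      have h3 : ∑ b, swapEnergy f (e none) (e b) = ∑ b, swapEnergy f c b := by
        rw [Equiv.sum_comp e fun b => swapEnergy f (e none) b]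
        simp [e]
      have h4 : ∑ a, ∑ b, (if a = c ∨ b = c then 0 else swapEnergy f a b)
          = ∑ a : {x // x ≠ c}, ∑ b : {x // x ≠ c}, swapEnergy f (e (some a)) (e (some b)) := by
        rw [← Equiv.sum_comp e, Fintype.sum_option]
        simp only [← Equiv.sum_comp e fun b => if _ ∨ b = c then (0 : ℝ) else _, Fintype.sum_option]
        simp only [e, Equiv.optionSubtypeNe_none, Equiv.optionSubtypeNe_some, true_or, or_true,
          if_true, Finset.sum_const_zero, zero_add]
        exact Finset.sum_congr rfl fun x _ => Finset.sum_congr rfl fun y _ =>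
          if_neg (by simp [x.2, y.2])
      rw [h3] at h1
      rw [h4]
      push_cast at h1
      exact h1
    have hself : ∀ a, swapEnergy f a a = 0 := by
      intro a
      unfold swapEnergy
      have : ∀ σ : Equiv.Perm α, σ * Equiv.swap a a = σ := fun σ => by rw [Equiv.swap_self]; rfl
      simp only [this, sub_self]
      simp [uavg]
    set D := ∑ a, ∑ b, swapEnergy f a b with hD
    have hD0 : 0 ≤ D := Finset.sum_nonneg fun a _ => Finset.sum_nonneg fun b _ =>
      swapEnergy_nonneg f a b
    have hsum := Finset.sum_le_sum fun c (_ : c ∈ Finset.univ) => hc c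
    rw [Finset.sum_const, Finset.card_univ, hα, nsmul_eq_mul, Finset.sum_add_distrib,
      ← Finset.mul_sum, ← Finset.mul_sum] at hsum
    -- A pair `a ≠ b` avoids `c` for `N - 1` of the `N + 1` choices of `c`; pairs `a = b` have
    -- energy zero.
    have h5 : ∑ c : α, ∑ a, ∑ b, (if a = c ∨ b = c then 0 else swapEnergy f a b)
        ≤ ((N : ℝ) - 1) * D := by
      rw [Finset.sum_comm, hD, Finset.mul_sum]
      refine Finset.sum_le_sum fun a _ => ?_
      rw [Finset.sum_comm, Finset.mul_sum]
      refine Finset.sum_le_sum fun b _ => ?_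
      by_cases hab : a = b
      · simp [hab, hself]
      · have : ∑ c, (if a = c ∨ b = c then 0 else swapEnergy f a b)
            = ∑ c ∈ Finset.univ \ {a, b}, swapEnergy f a b := by
          have h7 : Finset.univ \ {a, b} = Finset.univ.filter fun c => ¬(a = c ∨ b = c) := by
            ext c; simp [eq_comm]
          rw [h7, Finset.sum_filter]
          exact Finset.sum_congr rfl fun c _ => by by_cases hcc : a = c ∨ b = c <;> simp [hcc]
        rw [this, Finset.sum_const, Finset.card_sdiff_of_subset (Finset.subset_univ _),
          Finset.card_pair hab, Finset.card_univ, hα, nsmul_eq_mul]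
        have hN : 2 ≤ N + 1 := by
          rw [← hα, ← Finset.card_pair hab]; exact Finset.card_le_univ _
        rw [Nat.cast_sub hN]
        push_cast
        apply le_of_eq; ring
    push_cast at hsum ⊢
    set X := uavg (fun x => f x ^ 2) - uavg f ^ 2
    have h6 : ((N : ℝ) + 1) * X ≤ 1 / 2 * D := by
      refine hsum.trans ?_
      -- For `N = 0` the coefficient `1 / (2 * N)` is `0` by convention.
      rcases Nat.eq_zero_or_pos N with rfl | hN
      · simp
        linarith
      have hN' : (0 : ℝ) < N := by exact_mod_cast hN
      calc _ ≤ 1 / (2 * (N : ℝ)) * (((N : ℝ) - 1) * D) + 1 / (2 * ((N : ℝ) + 1)) * D := by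
            gcongr
        _ = ((N : ℝ) ^ 2 + N - 1) / (2 * N * (N + 1)) * D := by field_simp; ring
        _ ≤ 1 / 2 * D := by
            apply mul_le_mul_of_nonneg_right _ hD0
            rw [div_le_div_iff₀ (by positivity) (by norm_num)]
            nlinarith
    rw [← le_div_iff₀' (by positivity)] at h6
    refine h6.trans (le_of_eq ?_)
    field_simp

theorem poincare_perm (n : ℕ) : Poincare (fun _ : Fin n × Fin n => (1 / (2 * n) : ℝ))
    fun p => Equiv.mulRight (Equiv.swap p.1 p.2) := by
  intro f
  rw [← Finset.mul_sum, Fintype.sum_prod_type]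
  exact variance_perm_le n (Fintype.card_fin n) f

/-! ### Averages over signed permutations -/

/-- The pairs of permutations and signs that act on the rows and columns of a matrix. -/
abbrev SignedPair (n : ℕ) : Type :=
  (Equiv.Perm (Fin n) × Equiv.Perm (Fin n)) × (Fin n → ℤˣ)

/-- The rows of `H` are permuted and signed, the columns are permuted. -/
def signedConj {n : ℕ} (H : Matrix (Fin n) (Fin n) ℝ) (θ : SignedPair n) :
    Matrix (Fin n) (Fin n) ℝ :=
  fun a c => ((θ.2 a : ℤ) : ℝ) * H (θ.1.1 a) (θ.1.2 c)

section meanWeight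

variable {L R F : Type u} [Fintype F] {n : ℕ}

theorem bipWeight_signedConj (H : Matrix (Fin n) (Fin n) ℝ) (θ : SignedPair n) (l : F → L)
    (r : F → R) (i : L → Fin n) (k : R → Fin n) :
    bipWeight (signedConj H θ) l r i k = (((∏ f, θ.2 (i (l f)) : ℤˣ) : ℤ) : ℝ) *
      bipWeight H l r (fun x => θ.1.1 (i x)) fun y => θ.1.2 (k y) := by
  simp only [bipWeight, signedConj, Finset.prod_mul_distrib]
  push_cast
  rfl

/-- The expected weight of a pair of maps under a random signed permutation. -/
def meanWeight (H : Matrix (Fin n) (Fin n) ℝ) (l : F → L) (r : F → R) (i : L → Fin n)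
    (k : R → Fin n) : ℝ :=
  uavg fun θ : SignedPair n => bipWeight (signedConj H θ) l r i k

/-- Relabelling the indices is a translation of the uniform permutations together with a permutation
of the signs, which preserves the average. -/
theorem meanWeight_perm (H : Matrix (Fin n) (Fin n) ℝ) (l : F → L) (r : F → R)
    (τ ρ : Equiv.Perm (Fin n)) (i : L → Fin n) (k : R → Fin n) :
    meanWeight H l r (fun x => τ (i x)) (fun y => ρ (k y)) = meanWeight H l r i k := by
  let e : SignedPair n ≃ SignedPair n :=
    ((Equiv.mulRight τ).prodCongr (Equiv.mulRight ρ)).prodCongr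
      (Equiv.arrowCongr τ.symm (Equiv.refl ℤˣ))
  unfold meanWeight
  symm
  rw [← uavg_comp_equiv e]
  rfl

theorem meanWeight_eq_of_ker (H : Matrix (Fin n) (Fin n) ℝ) (l : F → L) (r : F → R)
    {i i' : L → Fin n} {k k' : R → Fin n} (hi : Setoid.ker i = Setoid.ker i')
    (hk : Setoid.ker k = Setoid.ker k') : meanWeight H l r i k = meanWeight H l r i' k' := by
  obtain ⟨τ, hτ⟩ := exists_perm_of_ker_eq hi
  obtain ⟨ρ, hρ⟩ := exists_perm_of_ker_eq hk
  rw [← meanWeight_perm H l r τ ρ i k]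
  simp only [hτ, hρ]

/-- If some sign assignment `ε` on the classes has product `-1` along the edges, then multiplying
the row signs by `ε` preserves the average and changes the sign of the weight. -/
theorem meanWeight_eq_zero (H : Matrix (Fin n) (Fin n) ℝ) (l : F → L) (r : F → R)
    (i : L → Fin n) (k : R → Fin n)
    (h : ¬ EvenDegrees fun f => (Quotient.mk'' (l f) : Quotient (Setoid.ker i))) :
    meanWeight H l r i k = 0 := by
  simp only [EvenDegrees, not_forall] at h
  obtain ⟨ε, hε⟩ := h
  have hε' : ∏ f, ε (Quotient.mk'' (l f)) = -1 := (Int.units_eq_one_or _).resolve_left hε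
  -- The assignment `ε` transported to row indices along `i`; off the range of `i` the value `1` is
  -- arbitrary.
  let ζ : Fin n → ℤˣ := fun a => if h : ∃ x, i x = a then ε (Quotient.mk'' h.choose) else 1
  have hζ : ∀ x, ζ (i x) = ε (Quotient.mk'' x) := by
    intro x
    have hex : ∃ y, i y = i x := ⟨x, rfl⟩
    have h2 : ζ (i x) = ε (Quotient.mk'' hex.choose) := dif_pos hex
    rw [h2]
    congr 1
    exact Quotient.sound' (show Setoid.ker i _ _ from hex.choose_spec)
  let e : SignedPair n ≃ SignedPair n := (Equiv.refl _).prodCongr (Equiv.mulRight ζ)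
  have h3 : meanWeight H l r i k = - meanWeight H l r i k := by
    conv_lhs => unfold meanWeight
    rw [← uavg_comp_equiv e]
    have h4 : ∀ θ, bipWeight (signedConj H (e θ)) l r i k
        = (-1) * bipWeight (signedConj H θ) l r i k := by
      intro θ
      rw [bipWeight_signedConj, bipWeight_signedConj]
      have h5 : ∏ f, (e θ).2 (i (l f)) = -∏ f, θ.2 (i (l f)) := by
        calc ∏ f, (e θ).2 (i (l f)) = ∏ f, θ.2 (i (l f)) * ζ (i (l f)) := rfl
          _ = -∏ f, θ.2 (i (l f)) := by
            rw [Finset.prod_mul_distrib]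
            simp only [hζ, hε', mul_neg, mul_one]
      rw [h5]
      push_cast
      have h6 : (e θ).1 = θ.1 := rfl
      rw [h6]
      ring
    simp only [h4]
    rw [uavg_const_mul]
    unfold meanWeight
    ring
  linarith

theorem sum_perm_ker_eq {V α M : Type*} [Fintype V] [Fintype α] [AddCommMonoid M] (s : Setoid V)
    (τ : Equiv.Perm α) (φ : (V → α) → M) :
    ∑ i with Setoid.ker i = s, φ (fun v => τ (i v)) = ∑ i with Setoid.ker i = s, φ i := by
  rw [Finset.sum_filter, Finset.sum_filter]
  symm
  rw [← Equiv.sum_comp (Equiv.arrowCongr (Equiv.refl V) τ)]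
  refine Finset.sum_congr rfl fun i _ => ?_
  have : (Equiv.arrowCongr (Equiv.refl V) τ) i = fun v => τ (i v) := rfl
  rw [this, ker_perm_comp]

variable [Fintype L] [Fintype R]

/-- The permutations only rearrange the labellings with given kernels, and the signs cancel by
evenness. The sum is therefore the same for every signed permutation, in particular equal to its
average. -/
theorem sum_ker_meanWeight (H : Matrix (Fin n) (Fin n) ℝ) (l : F → L) (r : F → R)
    (s : Setoid L) (t : Setoid R)
    (h : EvenDegrees fun f => (Quotient.mk'' (l f) : Quotient s)) :
    ∑ i with Setoid.ker i = s, ∑ k with Setoid.ker k = t, meanWeight H l r i k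
      = ∑ i with Setoid.ker i = s, ∑ k with Setoid.ker k = t, bipWeight H l r i k := by
  unfold meanWeight
  simp only [← uavg_sum]
  have : ∀ θ : SignedPair n, ∑ i with Setoid.ker i = s, ∑ k with Setoid.ker k = t,
      bipWeight (signedConj H θ) l r i k
      = ∑ i with Setoid.ker i = s, ∑ k with Setoid.ker k = t, bipWeight H l r i k := by
    intro θ
    rw [← sum_perm_ker_eq s θ.1.1 fun i => ∑ k with Setoid.ker k = t, bipWeight H l r i k]
    refine Finset.sum_congr rfl fun i hi => ?_
    rw [← sum_perm_ker_eq t θ.1.2 fun k => bipWeight H l r (fun x => θ.1.1 (i x)) k]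
    refine Finset.sum_congr rfl fun k _ => ?_
    rw [bipWeight_signedConj]
    have hs : Setoid.ker i = s := (Finset.mem_filter.1 hi).2
    have h2 := h fun q => Quotient.liftOn' q (fun x => θ.2 (i x)) fun a b hab => by
      have : (Setoid.ker i) a b := by rw [hs]; exact hab
      simp only [Setoid.ker_def.1 this]
    have h3 : ∏ f, θ.2 (i (l f)) = 1 := h2
    rw [h3]
    simp
  simp only [this]
  exact uavg_const _

/-- All terms are equal, so absolute values can be taken term by term without loss. This carries the
cancellation in sums over `H` over to absolute sums. -/
theorem sum_ker_abs_meanWeight (H : Matrix (Fin n) (Fin n) ℝ) (l : F → L) (r : F → R)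
    (s : Setoid L) (t : Setoid R) :
    ∑ i with Setoid.ker i = s, ∑ k with Setoid.ker k = t, |meanWeight H l r i k|
      = |∑ i with Setoid.ker i = s, ∑ k with Setoid.ker k = t, meanWeight H l r i k| := by
  by_cases hne : ∃ i₀ : L → Fin n, ∃ k₀ : R → Fin n, Setoid.ker i₀ = s ∧ Setoid.ker k₀ = t
  · obtain ⟨i₀, k₀, hi, hk⟩ := hne
    have h1 : ∀ i ∈ Finset.univ.filter (fun i : L → Fin n => Setoid.ker i = s),
        ∀ k ∈ Finset.univ.filter (fun k : R → Fin n => Setoid.ker k = t),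
          meanWeight H l r i k = meanWeight H l r i₀ k₀ := fun i hi' k hk' =>
      meanWeight_eq_of_ker H l r ((Finset.mem_filter.1 hi').2.trans hi.symm)
        ((Finset.mem_filter.1 hk').2.trans hk.symm)
    rw [Finset.sum_congr rfl fun i hi' => Finset.sum_congr rfl fun k hk' =>
        congrArg abs (h1 i hi' k hk'),
      Finset.sum_congr rfl fun i hi' => Finset.sum_congr rfl fun k hk' => h1 i hi' k hk']
    simp only [Finset.sum_const, nsmul_eq_mul, abs_mul, Nat.abs_cast]
  · have h1 : ∀ φ : (L → Fin n) → (R → Fin n) → ℝ,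
        ∑ i with Setoid.ker i = s, ∑ k with Setoid.ker k = t, φ i k = 0 := by
      intro φ
      refine Finset.sum_eq_zero fun i hi => Finset.sum_eq_zero fun k hk => ?_
      exact absurd ⟨i, k, (Finset.mem_filter.1 hi).2, (Finset.mem_filter.1 hk).2⟩ hne
    rw [h1, h1, abs_zero]

theorem exists_sum_ker_abs_meanWeight_le (l : F → L) (r : F → R) (hr : EvenDegrees r)
    (p : Setoid L × Setoid R)
    (hc : BipConnected (fun f => (Quotient.mk'' (l f) : Quotient p.1))
      (fun f => (Quotient.mk'' (r f) : Quotient p.2))) :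
    ∃ C : ℝ, 0 ≤ C ∧ ∀ {n : ℕ} {H : Matrix (Fin n) (Fin n) ℝ} {g : ℝ} {m : ℕ},
      Delocalized H g m → Fintype.card F ≤ 2 * m →
      ∑ i with Setoid.ker i = p.1, ∑ k with Setoid.ker k = p.2, |meanWeight H l r i k|
        ≤ C * n := by
  by_cases hl : EvenDegrees (fun f => (Quotient.mk'' (l f) : Quotient p.1))
  · obtain ⟨C, hC0, hC⟩ := exists_abs_sum_ker_bipWeight_le l r hr p hc hl
    refine ⟨C, hC0, fun h hF => ?_⟩
    rw [sum_ker_abs_meanWeight, sum_ker_meanWeight _ _ _ _ _ hl]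
    exact hC h hF
  · refine ⟨0, le_rfl, fun h hF => ?_⟩
    rw [Finset.sum_eq_zero, zero_mul]
    intro i hi
    refine Finset.sum_eq_zero fun k _ => ?_
    rw [meanWeight_eq_zero, abs_zero]
    rwa [(Finset.mem_filter.1 hi).2]

theorem sum_prod_abs_mul_prod_abs_le (q : L → Fin n → ℝ) (d : R → Fin n → ℝ)
    (K : (L → Fin n) → (R → Fin n) → ℝ) (hK0 : ∀ i k, 0 ≤ K i k)
    (hK : ∀ (τ ρ : Equiv.Perm (Fin n)) (i : L → Fin n) (k : R → Fin n),
      K (fun v => τ (i v)) (fun v => ρ (k v)) = K i k) :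
    ∑ i, ∑ k, ((∏ v, |q v (i v)|) * ∏ e, |d e (k e)|) * K i k
      ≤ (momentSum q (Fintype.card L) * momentSum d (Fintype.card R)) * ∑ i, ∑ k, K i k := by
  have hK1 : ∀ (τ : Equiv.Perm (Fin n)) (i : L → Fin n) (k : R → Fin n),
      K (fun v => τ (i v)) k = K i k := fun τ i k => hK τ 1 i k
  have hK2 : ∀ (ρ : Equiv.Perm (Fin n)) (i : L → Fin n) (k : R → Fin n),
      K i (fun v => ρ (k v)) = K i k := fun ρ i k => hK 1 ρ i k
  have hM := one_le_momentSum d (Fintype.card R)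
  calc ∑ i, ∑ k, ((∏ v, |q v (i v)|) * ∏ e, |d e (k e)|) * K i k
      = ∑ i, (∏ v, |q v (i v)|) * ∑ k, (∏ e, |d e (k e)|) * K i k := by
        simp only [Finset.mul_sum, mul_assoc]
    _ ≤ ∑ i, (∏ v, |q v (i v)|) * (momentSum d (Fintype.card R) * ∑ k, K i k) := by
        gcongr with i
        exact sum_prod_abs_mul_le d (K i) (hK0 i) fun ρ k => hK2 ρ i k
    _ = momentSum d (Fintype.card R) * ∑ i, (∏ v, |q v (i v)|) * ∑ k, K i k := by
        rw [Finset.mul_sum]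
        exact Finset.sum_congr rfl fun i _ => by ring
    _ ≤ momentSum d (Fintype.card R) *
        (momentSum q (Fintype.card L) * ∑ i, ∑ k, K i k) := by
        gcongr
        exact sum_prod_abs_mul_le q (fun i => ∑ k, K i k)
          (fun i => Finset.sum_nonneg fun k _ => hK0 i k) fun τ i => by simp only [hK1]
    _ = _ := by ring

end meanWeight

/-! ### Concentration over random signed permutations -/

/-- Four disjoint copies of a type. -/
structure Four (X : Type*) where
  copy : Fin 4
  pt : X

/-- Four disjoint copies of a type as a product. -/
def Four.equivProd (X : Type*) : Fin 4 × X ≃ Four X where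
  toFun a := ⟨a.1, a.2⟩
  invFun a := (a.copy, a.pt)
  left_inv _ := rfl
  right_inv _ := rfl

instance instFintypeFour {X : Type*} [Fintype X] : Fintype (Four X) :=
  Fintype.ofEquiv _ (Four.equivProd X)

theorem Four.card {X : Type*} [Fintype X] : Fintype.card (Four X) = 4 * Fintype.card X := by
  rw [← Fintype.card_congr (Four.equivProd X)]
  simp

theorem Four.prod_eq {X M : Type*} [Fintype X] [CommMonoid M] (f : Four X → M) :
    ∏ a, f a = ∏ c : Fin 4, ∏ x : X, f ⟨c, x⟩ := by
  rw [← Equiv.prod_comp (Four.equivProd X), Fintype.prod_prod_type]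
  rfl

theorem sum_sum_eq_sum_ker {V W α M : Type*} [Fintype V] [Fintype W] [Fintype α] [AddCommMonoid M]
    (φ : (V → α) → (W → α) → M) : ∑ i, ∑ k, φ i k = ∑ p : Setoid V × Setoid W,
      ∑ i with Setoid.ker i = p.1, ∑ k with Setoid.ker k = p.2, φ i k := by
  rw [Fintype.sum_prod_type, sum_eq_sum_ker]
  refine Finset.sum_congr rfl fun s _ => ?_
  dsimp only
  rw [Finset.sum_comm' (t' := Finset.univ.filter fun i : V → α => Setoid.ker i = s)
    (s' := fun _ => Finset.univ) (by simp)]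
  exact Finset.sum_congr rfl fun i _ => sum_eq_sum_ker _

/-! ### Fourth moments by four copies of a bipartite network -/

section concentration

variable {L R F : Type u} [Fintype L] [Fintype R] [Fintype F] {n : ℕ}

/-- The part of the value of a bipartite network that comes from the maps satisfying `P`. -/
def partVal (P : (L → Fin n) → (R → Fin n) → Prop) (q : L → Fin n → ℝ) (d : R → Fin n → ℝ)
    (l : F → L) (r : F → R) (O : Matrix (Fin n) (Fin n) ℝ) : ℝ :=
  (1 / (n : ℝ)) * ∑ i, ∑ k, if P i k then
    ((∏ v, q v (i v)) * ∏ e, d e (k e)) * bipWeight O l r i k else 0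

/-- The value of a bipartite network. -/
def bipVal (q : L → Fin n → ℝ) (d : R → Fin n → ℝ)
    (l : F → L) (r : F → R) (O : Matrix (Fin n) (Fin n) ℝ) : ℝ :=
  (1 / (n : ℝ)) * ∑ i, ∑ k, ((∏ v, q v (i v)) * ∏ e, d e (k e)) * bipWeight O l r i k

/-- Four disjoint copies of a map. -/
def fourfold {X Y : Type*} (p : X → Y) : Four X → Four Y := fun a => ⟨a.copy, p a.pt⟩

theorem pow_four_sum {α : Type*} [Fintype α] (G : (L → α) → (R → α) → ℝ) :
    (∑ i, ∑ k, G i k) ^ 4 = ∑ i : Four L → α, ∑ k : Four R → α,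
      ∏ c, G (fun x => i ⟨c, x⟩) fun y => k ⟨c, y⟩ := by
  have h1 : (∑ i, ∑ k, G i k) ^ 4
      = ∑ p : Fin 4 → (L → α) × (R → α), ∏ c, G (p c).1 (p c).2 := by
    rw [← Fintype.sum_prod_type' G]
    have h2 := Finset.prod_univ_sum (fun _ : Fin 4 => (Finset.univ : Finset ((L → α) × (R → α))))
      fun _ p => G p.1 p.2
    rw [Fintype.piFinset_univ] at h2
    rw [← h2, Finset.prod_const, Finset.card_univ, Fintype.card_fin]
  rw [h1]
  let e : (Fin 4 → (L → α) × (R → α)) ≃ (Four L → α) × (Four R → α) :=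
    (Equiv.arrowProdEquivProdArrow _ _ _).trans
      (((Equiv.curry (Fin 4) L α).symm.trans (Equiv.arrowCongr (Four.equivProd L) (Equiv.refl α))).prodCongr
        ((Equiv.curry (Fin 4) R α).symm.trans (Equiv.arrowCongr (Four.equivProd R) (Equiv.refl α))))
  rw [← Fintype.sum_prod_type' fun (i : Four L → α) (k : Four R → α) =>
    ∏ c, G (fun x => i ⟨c, x⟩) fun y => k ⟨c, y⟩, ← Equiv.sum_comp e]
  rfl

omit [Fintype L] [Fintype R] in
theorem bipWeight_fourfold (O : Matrix (Fin n) (Fin n) ℝ) (l : F → L) (r : F → R)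
    (i : Four L → Fin n) (k : Four R → Fin n) :
    bipWeight O (fourfold l) (fourfold r) i k
      = ∏ c, bipWeight O l r (fun x => i ⟨c, x⟩) fun y => k ⟨c, y⟩ := by
  unfold bipWeight fourfold
  rw [Four.prod_eq]

/-- The weighted sum of the pairs of maps all of whose copies satisfy `P`. -/
def touchSum (P : (L → Fin n) → (R → Fin n) → Prop) (q : L → Fin n → ℝ)
    (d : R → Fin n → ℝ) (l : F → L) (r : F → R) (H : Matrix (Fin n) (Fin n) ℝ) : ℝ :=
  ∑ i : Four L → Fin n, ∑ k : Four R → Fin n,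
    ((∏ v, |q v.pt (i v)|) * ∏ e, |d e.pt (k e)|) *
      if ∀ c, P (fun x => i ⟨c, x⟩) fun y => k ⟨c, y⟩ then
        |meanWeight H (fourfold l) (fourfold r) i k| else 0

/-- The fourth power is a sum over four copies of the graph. Absolute values are taken only after
averaging the weights, so that the cancellation contained in `meanWeight` is kept. -/
theorem uavg_partVal_pow_four_le (P : (L → Fin n) → (R → Fin n) → Prop) (q : L → Fin n → ℝ)
    (d : R → Fin n → ℝ) (l : F → L) (r : F → R) (H : Matrix (Fin n) (Fin n) ℝ) :
    (uavg fun θ => partVal P q d l r (signedConj H θ) ^ 4)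
      ≤ (1 / (n : ℝ)) ^ 4 * touchSum P q d l r H := by
  have h1 : ∀ θ : SignedPair n, partVal P q d l r (signedConj H θ) ^ 4
      = (1 / (n : ℝ)) ^ 4 * ∑ i : Four L → Fin n, ∑ k : Four R → Fin n,
        (if ∀ c, P (fun x => i ⟨c, x⟩) fun y => k ⟨c, y⟩ then
          (∏ v, q v.pt (i v)) * ∏ e, d e.pt (k e) else 0) *
            bipWeight (signedConj H θ) (fourfold l) (fourfold r) i k := by
    intro θ
    rw [partVal, mul_pow, pow_four_sum]
    congr 1
    refine Finset.sum_congr rfl fun i _ => Finset.sum_congr rfl fun k _ => ?_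
    rw [bipWeight_fourfold]
    split_ifs with hP
    · rw [Finset.prod_congr rfl fun c _ => if_pos (hP c), Finset.prod_mul_distrib,
        Finset.prod_mul_distrib, Four.prod_eq, Four.prod_eq]
    · obtain ⟨c, hc⟩ := not_forall.1 hP
      rw [Finset.prod_eq_zero (Finset.mem_univ c) (if_neg hc), zero_mul]
  simp only [h1]
  unfold touchSum
  rw [uavg_const_mul, uavg_sum]
  refine mul_le_mul_of_nonneg_left ?_ (by positivity)
  refine Finset.sum_le_sum fun i _ => ?_
  rw [uavg_sum]
  refine Finset.sum_le_sum fun k _ => ?_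
  rw [uavg_const_mul]
  change _ * meanWeight H (fourfold l) (fourfold r) i k ≤ _
  split_ifs
  · refine (le_abs_self _).trans (le_of_eq ?_)
    rw [abs_mul, abs_mul, Finset.abs_prod, Finset.abs_prod]
  · simp

omit [Fintype L] [Fintype R] [Fintype F] in
/-- Four copies of a connected graph become connected when they are glued at a common vertex. -/
theorem BipConnected.fourfold_quotient {l : F → L} {r : F → R} (h : BipConnected l r)
    (s : Setoid (Four L)) (t : Setoid (Four R))
    (hst : (∃ b : Quotient s, ∀ c, ∃ x, Quotient.mk'' ⟨c, x⟩ = b) ∨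
      ∃ b : Quotient t, ∀ c, ∃ y, Quotient.mk'' ⟨c, y⟩ = b) :
    BipConnected (fun f => (Quotient.mk'' (fourfold l f) : Quotient s))
      (fun f => (Quotient.mk'' (fourfold r f) : Quotient t)) := by
  intro φ ψ hf he
  have hcopy : ∀ c, ((∃ x, φ (Quotient.mk'' ⟨c, x⟩)) ∨ ∃ y, ψ (Quotient.mk'' ⟨c, y⟩)) →
      (∀ x, φ (Quotient.mk'' ⟨c, x⟩)) ∧ ∀ y, ψ (Quotient.mk'' ⟨c, y⟩) := fun c =>
    h (fun x => φ (Quotient.mk'' ⟨c, x⟩)) (fun y => ψ (Quotient.mk'' ⟨c, y⟩)) fun f => hf ⟨c, f⟩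
  have h1 : ∃ c, (∃ x, φ (Quotient.mk'' ⟨c, x⟩)) ∨ ∃ y, ψ (Quotient.mk'' ⟨c, y⟩) := by
    rcases he with ⟨q, hq⟩ | ⟨q, hq⟩
    · induction q using Quotient.inductionOn' with
      | h a => exact ⟨a.copy, Or.inl ⟨a.pt, hq⟩⟩
    · induction q using Quotient.inductionOn' with
      | h a => exact ⟨a.copy, Or.inr ⟨a.pt, hq⟩⟩
  obtain ⟨c₀, h0⟩ := h1
  have h2 := hcopy c₀ h0
  have h3 : ∀ c, (∃ x, φ (Quotient.mk'' ⟨c, x⟩)) ∨ ∃ y, ψ (Quotient.mk'' ⟨c, y⟩) := by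
    intro c
    rcases hst with ⟨b, hb⟩ | ⟨b, hb⟩
    · obtain ⟨x₀, hx₀⟩ := hb c₀
      obtain ⟨x, hx⟩ := hb c
      refine Or.inl ⟨x, ?_⟩
      rw [hx, ← hx₀]
      exact h2.1 x₀
    · obtain ⟨x₀, hx₀⟩ := hb c₀
      obtain ⟨x, hx⟩ := hb c
      refine Or.inr ⟨x, ?_⟩
      rw [hx, ← hx₀]
      exact h2.2 x₀
  refine ⟨fun q => ?_, fun q => ?_⟩
  · induction q using Quotient.inductionOn' with
    | h a => exact (hcopy a.copy (h3 a.copy)).1 a.pt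
  · induction q using Quotient.inductionOn' with
    | h a => exact (hcopy a.copy (h3 a.copy)).2 a.pt

omit [Fintype R] in
theorem EvenDegrees.fourfold {r : F → R} (h : EvenDegrees r) : EvenDegrees (fourfold r) := by
  intro ε
  rw [Four.prod_eq]
  exact Finset.prod_eq_one fun c _ => h fun y => ε ⟨c, y⟩

/-- The four copies of the map `i` have a common value. -/
def CommonValue (i : Four L → Fin n) : Prop := ∃ b, ∀ c, ∃ x, i ⟨c, x⟩ = b

omit [Fintype L] in
theorem CommonValue.quotient {i : Four L → Fin n} (h : CommonValue i) :
    ∃ b : Quotient (Setoid.ker i), ∀ c, ∃ x, Quotient.mk'' ⟨c, x⟩ = b := by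
  obtain ⟨b, hb⟩ := h
  obtain ⟨x₀, hx₀⟩ := hb 0
  refine ⟨Quotient.mk'' ⟨0, x₀⟩, fun c => ?_⟩
  obtain ⟨x, hx⟩ := hb c
  exact ⟨x, Quotient.sound' (show Setoid.ker i _ _ from hx.trans hx₀.symm)⟩

omit [Fintype L] in
theorem commonValue_perm (τ : Equiv.Perm (Fin n)) (i : Four L → Fin n) :
    CommonValue (fun v => τ (i v)) ↔ CommonValue i := by
  constructor
  · rintro ⟨b, hb⟩
    exact ⟨τ.symm b, fun c => (hb c).imp fun x hx => by rw [← hx, Equiv.symm_apply_apply]⟩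
  · rintro ⟨b, hb⟩
    exact ⟨τ b, fun c => (hb c).imp fun x hx => congrArg τ hx⟩

/-- The expected weight of four copies, restricted to the maps for which the copies touch. -/
def touchWeight (H : Matrix (Fin n) (Fin n) ℝ) (l : F → L) (r : F → R) (i : Four L → Fin n)
    (k : Four R → Fin n) : ℝ :=
  if CommonValue i ∨ CommonValue k then |meanWeight H (fourfold l) (fourfold r) i k| else 0

/-- A common value glues the four copies into one connected graph, and a connected graph costs only
one factor `n`. -/
theorem exists_sum_touchWeight_le {l : F → L} {r : F → R} (hc : BipConnected l r)
    (hr : EvenDegrees r) : ∃ C : ℝ, 0 ≤ C ∧ ∀ {n : ℕ} {H : Matrix (Fin n) (Fin n) ℝ} {g : ℝ} {m : ℕ},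
      Delocalized H g m → Fintype.card (Four F) ≤ 2 * m →
      ∑ i, ∑ k, touchWeight H l r i k ≤ C * n := by
  have hp : ∀ p : Setoid (Four L) × Setoid (Four R), ∃ C : ℝ, 0 ≤ C ∧
      ∀ {n : ℕ} {H : Matrix (Fin n) (Fin n) ℝ} {g : ℝ} {m : ℕ},
      Delocalized H g m → Fintype.card (Four F) ≤ 2 * m →
      ∑ i with Setoid.ker i = p.1, ∑ k with Setoid.ker k = p.2, touchWeight H l r i k ≤ C * n := by
    intro p
    by_cases hconn : BipConnected (fun f => (Quotient.mk'' (fourfold l f) : Quotient p.1))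
      (fun f => (Quotient.mk'' (fourfold r f) : Quotient p.2))
    · obtain ⟨C, hC0, hC⟩ := exists_sum_ker_abs_meanWeight_le _ _ hr.fourfold p hconn
      refine ⟨C, hC0, fun h hF => le_trans ?_ (hC h hF)⟩
      refine Finset.sum_le_sum fun i _ => Finset.sum_le_sum fun k _ => ?_
      unfold touchWeight
      split_ifs
      · rfl
      · positivity
    -- For kernels with a disconnected quotient the copies have no common value and the weight is
    -- zero.
    · refine ⟨0, le_rfl, fun h hF => ?_⟩
      rw [zero_mul]
      refine Finset.sum_nonpos fun i hi => Finset.sum_nonpos fun k hk => ?_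
      unfold touchWeight
      rw [if_neg]
      rintro hcv
      apply hconn
      obtain ⟨s, t⟩ := p
      obtain rfl : Setoid.ker i = s := (Finset.mem_filter.1 hi).2
      obtain rfl : Setoid.ker k = t := (Finset.mem_filter.1 hk).2
      exact hc.fourfold_quotient _ _ (hcv.imp CommonValue.quotient CommonValue.quotient)
  choose C hC0 hC using hp
  refine ⟨∑ p, C p, Finset.sum_nonneg fun p _ => hC0 p, fun {n H g m} h hF => ?_⟩
  calc ∑ i, ∑ k, touchWeight H l r i k
      = ∑ p : Setoid (Four L) × Setoid (Four R), ∑ i : Four L → Fin n with Setoid.ker i = p.1,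
          ∑ k : Four R → Fin n with Setoid.ker k = p.2, touchWeight H l r i k := by
        exact sum_sum_eq_sum_ker _
    _ ≤ ∑ p, C p * n := Finset.sum_le_sum fun p _ => hC p h hF
    _ = _ := by rw [Finset.sum_mul]

theorem touchSum_mono {P P' : (L → Fin n) → (R → Fin n) → Prop} (hP : ∀ i k, P i k → P' i k)
    (q : L → Fin n → ℝ) (d : R → Fin n → ℝ) (l : F → L) (r : F → R)
    (H : Matrix (Fin n) (Fin n) ℝ) : touchSum P q d l r H ≤ touchSum P' q d l r H := by
  unfold touchSum
  gcongr with i _ k _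
  split_ifs with h1 h2
  · rfl
  · exact absurd (fun c => hP _ _ (h1 c)) h2
  · positivity
  · rfl

/-- `|V|`-dependent bound for the number of values. -/
theorem card_value_le (i : Four L → Fin n) :
    (Finset.card {b : Fin n | ∀ c, ∃ x, i ⟨c, x⟩ = b} : ℝ) ≤ Fintype.card L := by
  have : (Finset.univ.filter fun b : Fin n => ∀ c, ∃ x, i ⟨c, x⟩ = b)
      ⊆ Finset.univ.image fun x => i ⟨0, x⟩ := by
    intro b hb
    obtain ⟨x, hx⟩ := (Finset.mem_filter.1 hb).2 0
    exact Finset.mem_image.2 ⟨x, Finset.mem_univ _, hx⟩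
  exact_mod_cast (Finset.card_le_card this).trans (Finset.card_image_le.trans (by simp))

theorem sum_ite_card_le {c : ℝ} (hc : 0 ≤ c) (i : Four L → Fin n) {Q : Prop} (p : Fin n → Prop)
    (hp : ∀ b, p b ↔ ∀ c, ∃ x, i ⟨c, x⟩ = b) [DecidablePred p] [Decidable Q]
    (hQ : CommonValue i → Q) :
    ∑ b : Fin n, (if p b then c else 0) ≤ Fintype.card L * if Q then c else 0 := by
  rw [← Finset.sum_filter, Finset.sum_const, nsmul_eq_mul]
  split_ifs with h
  · refine mul_le_mul_of_nonneg_right (le_trans (le_of_eq ?_) (card_value_le i)) hc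
    congr 2
    ext b
    simp [hp]
  · have : Finset.univ.filter p = ∅ := by
      rw [Finset.filter_eq_empty_iff]
      exact fun b _ hb => h (hQ ⟨b, (hp b).1 hb⟩)
    rw [this]; simp

/-- The maps `i` that take the value `b`. -/
def hitsLeft (b : Fin n) : (L → Fin n) → (R → Fin n) → Prop := fun i _ => ∃ x, i x = b

/-- The maps `k` that take the value `b`. -/
def hitsRight (b : Fin n) : (L → Fin n) → (R → Fin n) → Prop := fun _ k => ∃ y, k y = b

/-- The bound for all pairs of maps whose copies touch. -/
def touchTotal (q : L → Fin n → ℝ) (d : R → Fin n → ℝ) (l : F → L) (r : F → R)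
    (H : Matrix (Fin n) (Fin n) ℝ) : ℝ :=
  ∑ i : Four L → Fin n, ∑ k : Four R → Fin n,
    ((∏ v, |q v.pt (i v)|) * ∏ e, |d e.pt (k e)|) * touchWeight H l r i k

/-- A labelling is counted once for every common value of its four copies, and there are at most
`|L|` of these. Hence the sum over all `n` values `b` costs a constant only. -/
theorem sum_touchSum_hitsLeft_le (q : L → Fin n → ℝ) (d : R → Fin n → ℝ) (l : F → L) (r : F → R)
    (H : Matrix (Fin n) (Fin n) ℝ) :
    ∑ b, touchSum (hitsLeft b) q d l r H ≤ Fintype.card L * touchTotal q d l r H := by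
  unfold touchSum touchTotal
  rw [Finset.sum_comm, Finset.mul_sum]
  refine Finset.sum_le_sum fun i _ => ?_
  rw [Finset.sum_comm, Finset.mul_sum]
  refine Finset.sum_le_sum fun k _ => ?_
  rw [← Finset.mul_sum, mul_left_comm]
  refine mul_le_mul_of_nonneg_left ?_ (by positivity)
  unfold touchWeight
  exact sum_ite_card_le (abs_nonneg _) i
    (fun b => ∀ c, hitsLeft b (fun x => i ⟨c, x⟩) fun y => k ⟨c, y⟩) (fun b => Iff.rfl) Or.inl

theorem sum_touchSum_hitsRight_le (q : L → Fin n → ℝ) (d : R → Fin n → ℝ) (l : F → L) (r : F → R)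
    (H : Matrix (Fin n) (Fin n) ℝ) :
    ∑ b, touchSum (hitsRight b) q d l r H ≤ Fintype.card R * touchTotal q d l r H := by
  unfold touchSum touchTotal
  rw [Finset.sum_comm, Finset.mul_sum]
  refine Finset.sum_le_sum fun i _ => ?_
  rw [Finset.sum_comm, Finset.mul_sum]
  refine Finset.sum_le_sum fun k _ => ?_
  rw [← Finset.mul_sum, mul_left_comm]
  refine mul_le_mul_of_nonneg_left ?_ (by positivity)
  unfold touchWeight
  exact sum_ite_card_le (abs_nonneg _) k
    (fun b => ∀ c, hitsRight b (fun x => i ⟨c, x⟩) fun y => k ⟨c, y⟩) (fun b => Iff.rfl) Or.inr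

theorem touchTotal_le {l : F → L} {r : F → R} (q : L → Fin n → ℝ) (d : R → Fin n → ℝ)
    (H : Matrix (Fin n) (Fin n) ℝ) : touchTotal q d l r H
      ≤ (momentSum (fun v : Four L => q v.pt) (Fintype.card (Four L)) *
        momentSum (fun e : Four R => d e.pt) (Fintype.card (Four R))) *
        ∑ i, ∑ k, touchWeight H l r i k := by
  refine sum_prod_abs_mul_prod_abs_le (fun v : Four L => q v.pt) (fun e : Four R => d e.pt)
    (touchWeight H l r) (fun i k => ?_) fun τ ρ i k => ?_
  · unfold touchWeight; positivity
  · unfold touchWeight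
    rw [meanWeight_perm, commonValue_perm, commonValue_perm]

theorem add_pow_four_le (a b : ℝ) : (a + b) ^ 4 ≤ 8 * (a ^ 4 + b ^ 4) := by
  nlinarith [sq_nonneg (a - b), sq_nonneg (a + b), sq_nonneg (a ^ 2 - b ^ 2), sq_nonneg (a * b),
    mul_nonneg (sq_nonneg (a - b)) (sq_nonneg (a + b)), sq_nonneg ((a - b) ^ 2)]

/-- If the weights that do not satisfy `P` do not change under `T`, then the change of the value is
controlled by the part of the value with the condition `P`. -/
theorem uavg_sub_pow_four_le (T : Equiv.Perm (SignedPair n)) (P : (L → Fin n) → (R → Fin n) → Prop)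
    (q : L → Fin n → ℝ) (d : R → Fin n → ℝ) (l : F → L) (r : F → R) (H : Matrix (Fin n) (Fin n) ℝ)
    (hT : ∀ i k, ¬ P i k → ∀ θ,
      bipWeight (signedConj H (T θ)) l r i k = bipWeight (signedConj H θ) l r i k) :
    (uavg fun θ => (bipVal q d l r (signedConj H θ) - bipVal q d l r (signedConj H (T θ))) ^ 4)
      ≤ 16 * uavg fun θ => partVal P q d l r (signedConj H θ) ^ 4 := by
  have h1 : ∀ θ, bipVal q d l r (signedConj H θ) - bipVal q d l r (signedConj H (T θ))
      = partVal P q d l r (signedConj H θ) + -partVal P q d l r (signedConj H (T θ)) := by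
    intro θ
    unfold bipVal partVal
    rw [← sub_eq_add_neg, ← mul_sub, ← mul_sub, ← Finset.sum_sub_distrib, ← Finset.sum_sub_distrib]
    congr 1
    refine Finset.sum_congr rfl fun i _ => ?_
    rw [← Finset.sum_sub_distrib, ← Finset.sum_sub_distrib]
    refine Finset.sum_congr rfl fun k _ => ?_
    split_ifs with hP
    · rfl
    · rw [hT i k hP, sub_self, sub_self]
  have h2 : (uavg fun θ => partVal P q d l r (signedConj H (T θ)) ^ 4)
      = uavg fun θ => partVal P q d l r (signedConj H θ) ^ 4 :=
    uavg_comp_equiv T fun θ => partVal P q d l r (signedConj H θ) ^ 4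
  calc _ ≤ uavg fun θ => 8 * (partVal P q d l r (signedConj H θ) ^ 4
        + partVal P q d l r (signedConj H (T θ)) ^ 4) := by
        apply uavg_mono
        intro θ
        rw [h1]
        refine (add_pow_four_le _ _).trans (le_of_eq ?_)
        ring
    _ = _ := by rw [uavg_const_mul, uavg_add, h2]; ring

/-- The labellings satisfying `P ∨ P'` are split disjointly into `P` and `P' ∧ ¬ P`, so that the
partial values add up. -/
theorem uavg_partVal_or_le (P P' : (L → Fin n) → (R → Fin n) → Prop)
    (q : L → Fin n → ℝ) (d : R → Fin n → ℝ) (l : F → L) (r : F → R)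
    (H : Matrix (Fin n) (Fin n) ℝ) :
    (uavg fun θ => partVal (fun i k => P i k ∨ P' i k) q d l r (signedConj H θ) ^ 4)
      ≤ 8 * ((1 / (n : ℝ)) ^ 4 * (touchSum P q d l r H + touchSum P' q d l r H)) := by
  have h1 : ∀ θ, partVal (fun i k => P i k ∨ P' i k) q d l r (signedConj H θ)
      = partVal P q d l r (signedConj H θ)
        + partVal (fun i k => P' i k ∧ ¬ P i k) q d l r (signedConj H θ) := by
    intro θ
    unfold partVal
    rw [← mul_add, ← Finset.sum_add_distrib]
    congr 1
    refine Finset.sum_congr rfl fun i _ => ?_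
    rw [← Finset.sum_add_distrib]
    refine Finset.sum_congr rfl fun k _ => ?_
    by_cases hp : P i k <;> by_cases hp' : P' i k <;> simp [hp, hp']
  calc _ ≤ uavg fun θ => 8 * (partVal P q d l r (signedConj H θ) ^ 4
        + partVal (fun i k => P' i k ∧ ¬ P i k) q d l r (signedConj H θ) ^ 4) := by
        apply uavg_mono
        intro θ
        rw [h1]
        exact add_pow_four_le _ _
    _ ≤ _ := by
        rw [uavg_const_mul, uavg_add, mul_add ((1 / (n : ℝ)) ^ 4)]
        gcongr
        · exact uavg_partVal_pow_four_le _ _ _ _ _ _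
        · refine (uavg_partVal_pow_four_le _ _ _ _ _ _).trans ?_
          gcongr
          exact touchSum_mono (fun i k h => h.1) _ _ _ _ _

end concentration

/-! ### The Dirichlet form of a bipartite network -/

section

variable {L R F : Type u} [Fintype L] [Fintype R] [Fintype F] {n : ℕ}

/-- Only the rows `a` and `b` of the matrix change, so labellings that avoid both values do not
contribute. The constant is `16 * 8`. -/
theorem uavg_sub_swap_left_le (a b : Fin n) (q : L → Fin n → ℝ) (d : R → Fin n → ℝ) (l : F → L)
    (r : F → R) (H : Matrix (Fin n) (Fin n) ℝ) :
    (uavg fun θ : SignedPair n => (bipVal q d l r (signedConj H θ) - bipVal q d l r (signedConj H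
      ((((Equiv.mulRight (Equiv.swap a b)).prodCongr (Equiv.refl _)).prodCongr
        (Equiv.refl _) : Equiv.Perm (SignedPair n)) θ))) ^ 4)
      ≤ 128 * (1 / (n : ℝ)) ^ 4 *
        (touchSum (hitsLeft a) q d l r H + touchSum (hitsLeft b) q d l r H) := by
  refine (uavg_sub_pow_four_le _ (fun i k => hitsLeft a i k ∨ hitsLeft b i k) q d l r H ?_).trans ?_
  · intro i k hP θ
    simp only [hitsLeft, not_or, not_exists] at hP
    unfold bipWeight signedConj
    refine Finset.prod_congr rfl fun f _ => ?_
    simp [Equiv.swap_apply_of_ne_of_ne (hP.1 (l f)) (hP.2 (l f))]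
  · have := uavg_partVal_or_le (hitsLeft a) (hitsLeft b) q d l r H
    linarith

theorem uavg_sub_swap_right_le (a b : Fin n) (q : L → Fin n → ℝ) (d : R → Fin n → ℝ) (l : F → L)
    (r : F → R) (H : Matrix (Fin n) (Fin n) ℝ) :
    (uavg fun θ : SignedPair n => (bipVal q d l r (signedConj H θ) - bipVal q d l r (signedConj H
      ((((Equiv.refl _).prodCongr (Equiv.mulRight (Equiv.swap a b))).prodCongr
        (Equiv.refl _) : Equiv.Perm (SignedPair n)) θ))) ^ 4)
      ≤ 128 * (1 / (n : ℝ)) ^ 4 *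
        (touchSum (hitsRight a) q d l r H + touchSum (hitsRight b) q d l r H) := by
  refine (uavg_sub_pow_four_le _ (fun i k => hitsRight a i k ∨ hitsRight b i k) q d l r H ?_).trans ?_
  · intro i k hP θ
    simp only [hitsRight, not_or, not_exists] at hP
    unfold bipWeight signedConj
    refine Finset.prod_congr rfl fun f _ => ?_
    simp [Equiv.swap_apply_of_ne_of_ne (hP.1 (r f)) (hP.2 (r f))]
  · have := uavg_partVal_or_le (hitsRight a) (hitsRight b) q d l r H
    linarith

theorem uavg_sub_flip_le (a : Fin n) (q : L → Fin n → ℝ) (d : R → Fin n → ℝ) (l : F → L)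
    (r : F → R) (H : Matrix (Fin n) (Fin n) ℝ) :
    (uavg fun θ : SignedPair n => (bipVal q d l r (signedConj H θ) - bipVal q d l r (signedConj H
      (((Equiv.refl _).prodCongr (signFlip a) : Equiv.Perm (SignedPair n)) θ))) ^ 4)
      ≤ 16 * (1 / (n : ℝ)) ^ 4 * touchSum (hitsLeft a) q d l r H := by
  refine (uavg_sub_pow_four_le _ (hitsLeft a) q d l r H ?_).trans ?_
  · intro i k hP θ
    simp only [hitsLeft, not_exists] at hP
    unfold bipWeight signedConj
    refine Finset.prod_congr rfl fun f _ => ?_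
    simp [signFlip, hP (l f)]
  · have := uavg_partVal_pow_four_le (hitsLeft a) q d l r H
    linarith

theorem poincare_signedPair (n : ℕ) :
    Poincare (X := SignedPair n)
      (Sum.elim (Sum.elim (fun _ : Fin n × Fin n => (1 / (2 * n) : ℝ)) fun _ : Fin n × Fin n =>
        (1 / (2 * n) : ℝ)) fun _ : Fin n => (1 / 4 : ℝ))
      (Sum.elim (fun j => (Sum.elim
          (fun p : Fin n × Fin n => (Equiv.mulRight (Equiv.swap p.1 p.2)).prodCongr (Equiv.refl _))
          (fun p : Fin n × Fin n => (Equiv.refl _).prodCongr (Equiv.mulRight (Equiv.swap p.1 p.2)))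
          j).prodCongr (Equiv.refl _))
        fun a => (Equiv.refl _).prodCongr (signFlip a)) := by
  refine Poincare.prod ?_ (Poincare.prod ?_ (poincare_perm n) (poincare_perm n)) (poincare_signs n)
  · rintro (j | j) <;> simp
  · intro j; positivity

theorem sum_pair_add (a : Fin n → ℝ) : ∑ p : Fin n × Fin n, (a p.1 + a p.2) = 2 * n * ∑ b, a b := by
  rw [Finset.sum_add_distrib, Fintype.sum_prod_type, Fintype.sum_prod_type_right]
  simp only [Finset.sum_const, Finset.card_univ, Fintype.card_fin, nsmul_eq_mul,
    ← Finset.mul_sum]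
  ring

/-- The total weight in the Poincaré inequality is of order `n`, the normalization of the fourth
power is `n⁻⁴`, and the touching copies, summed over all generators, contribute order `n`; together
`n⁻²`. -/
theorem exists_uavg_bipVal_sub_pow_four_le {l : F → L} {r : F → R} (hc : BipConnected l r)
    (hr : EvenDegrees r) : ∃ C : ℝ, 0 ≤ C ∧ ∀ {n : ℕ} {H : Matrix (Fin n) (Fin n) ℝ} {g : ℝ} {m : ℕ},
      Delocalized H g m → Fintype.card (Four F) ≤ 2 * m → ∀ (q : L → Fin n → ℝ) (d : R → Fin n → ℝ),
      (uavg fun θ => (bipVal q d l r (signedConj H θ)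
        - uavg fun θ => bipVal q d l r (signedConj H θ)) ^ 4)
        ≤ C * (momentSum (fun v : Four L => q v.pt) (Fintype.card (Four L)) *
          momentSum (fun e : Four R => d e.pt) (Fintype.card (Four R))) / (n : ℝ) ^ 2 := by
  obtain ⟨C, hC0, hC⟩ := exists_sum_touchWeight_le hc hr
  -- Here `5 / 4 * n` is the total weight of the generators, `132 = 128 + 4` collects row
  -- transpositions and sign flips, and `128` the column transpositions.
  refine ⟨23 * (5 / 4) * (132 * Fintype.card L + 128 * Fintype.card R) * C, by positivity, ?_⟩
  intro n H g m h hF q d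
  have hn := h.n_pos
  have hn0 : (0 : ℝ) < n := by linarith
  set M := momentSum (fun v : Four L => q v.pt) (Fintype.card (Four L)) *
          momentSum (fun e : Four R => d e.pt) (Fintype.card (Four R)) with hM
  have hM0 : 0 ≤ M := mul_nonneg (zero_le_one.trans (one_le_momentSum _ _))
    (zero_le_one.trans (one_le_momentSum _ _))
  have htot : touchTotal q d l r H ≤ M * (C * n) :=
    (touchTotal_le q d H).trans (mul_le_mul_of_nonneg_left (hC h hF) hM0)
  have hP := poincare_signedPair n
  have h1 := hP.fourth_moment ?_ ?_ fun θ => bipVal q d l r (signedConj H θ)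
  rotate_left
  · rintro ((j | j) | j) <;> simp
  · simp only [Fintype.sum_sum_type, Sum.elim_inl, Sum.elim_inr, Finset.sum_const, Finset.card_univ,
      Fintype.card_prod, Fintype.card_fin, nsmul_eq_mul]
    push_cast
    positivity
  refine h1.trans ?_
  simp only [Fintype.sum_sum_type, Sum.elim_inl, Sum.elim_inr]
  set ν := (1 / (n : ℝ)) ^ 4 with hν
  set A := ∑ b, touchSum (hitsLeft b) q d l r H with hA
  set B := ∑ b, touchSum (hitsRight b) q d l r H with hB
  have hA1 : A ≤ Fintype.card L * touchTotal q d l r H := sum_touchSum_hitsLeft_le _ _ _ _ _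
  have hB1 : B ≤ Fintype.card R * touchTotal q d l r H := sum_touchSum_hitsRight_le _ _ _ _ _
  have b1 := Finset.sum_le_sum fun (p : Fin n × Fin n) (_ : p ∈ Finset.univ) =>
    mul_le_mul_of_nonneg_left (uavg_sub_swap_left_le p.1 p.2 q d l r H)
      (by positivity : (0 : ℝ) ≤ 1 / (2 * n))
  have b2 := Finset.sum_le_sum fun (p : Fin n × Fin n) (_ : p ∈ Finset.univ) =>
    mul_le_mul_of_nonneg_left (uavg_sub_swap_right_le p.1 p.2 q d l r H)
      (by positivity : (0 : ℝ) ≤ 1 / (2 * n))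
  have b3 := Finset.sum_le_sum fun (a : Fin n) (_ : a ∈ Finset.univ) =>
    mul_le_mul_of_nonneg_left (uavg_sub_flip_le a q d l r H)
      (by positivity : (0 : ℝ) ≤ 1 / 4)
  rw [← Finset.mul_sum Finset.univ _ (1 / (2 * (n : ℝ))),
    ← Finset.mul_sum Finset.univ _ (1 / (2 * (n : ℝ))), ← Finset.mul_sum, sum_pair_add
      (fun b => touchSum (hitsLeft b) q d l r H), ← hν, ← hA] at b1
  rw [← Finset.mul_sum Finset.univ _ (1 / (2 * (n : ℝ))),
    ← Finset.mul_sum Finset.univ _ (1 / (2 * (n : ℝ))), ← Finset.mul_sum, sum_pair_add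
      (fun b => touchSum (hitsRight b) q d l r H), ← hν, ← hB] at b2
  rw [← Finset.mul_sum, ← Finset.mul_sum, ← Finset.mul_sum, ← hν, ← hA] at b3
  rw [← Finset.mul_sum, ← Finset.mul_sum, ← Finset.mul_sum]
  have hw : (∑ _p : Fin n × Fin n, 1 / (2 * (n : ℝ)) + ∑ _p : Fin n × Fin n, 1 / (2 * (n : ℝ))
      + ∑ _a : Fin n, (1 / 4 : ℝ)) = 5 / 4 * n := by
    simp only [Finset.sum_const, Finset.card_univ, Fintype.card_prod, Fintype.card_fin,
      nsmul_eq_mul]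
    push_cast
    field_simp
    ring
  rw [hw]
  calc _ ≤ 23 * (5 / 4 * (n : ℝ)) * (1 / (2 * n) * (128 * ν * (2 * n * A))
        + 1 / (2 * n) * (128 * ν * (2 * n * B)) + 1 / 4 * (16 * ν * A)) := by
        gcongr
    _ = 23 * (5 / 4 * (n : ℝ)) * ν * (132 * A + 128 * B) := by
        field_simp
        ring
    _ ≤ 23 * (5 / 4 * (n : ℝ)) * ν * (132 * (Fintype.card L * (M * (C * n)))
        + 128 * (Fintype.card R * (M * (C * n)))) := by
        gcongr
        · exact hA1.trans (by gcongr)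
        · exact hB1.trans (by gcongr)
    _ = _ := by
        rw [hν]
        field_simp

end

/-! ### Limits of sums with prescribed kernels -/

section

variable {V : Type*} [Fintype V] {n : ℕ}

/-- The product of the functions `q v` over the vertices of a class. -/
def blockProd (q : V → Fin n → ℝ) (s : Setoid V) (b : Quotient s) (a : Fin n) : ℝ :=
  ∏ v with Quotient.mk'' v = b, q v a

theorem prod_eq_prod_blockProd (q : V → Fin n → ℝ) (s : Setoid V) (j : Quotient s → Fin n) :
    ∏ v, q v (j (Quotient.mk'' v)) = ∏ b, blockProd q s b (j b) := by
  rw [← Finset.prod_fiberwise Finset.univ (fun v : V => (Quotient.mk'' v : Quotient s))]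
  refine Finset.prod_congr rfl fun b _ => ?_
  exact Finset.prod_congr rfl fun v hv => by rw [(Finset.mem_filter.1 hv).2]

theorem sum_prod_eq_prod_sum {B α : Type*} [Fintype B] [Fintype α] (f : B → α → ℝ) :
    ∑ j : B → α, ∏ b, f b (j b) = ∏ b, ∑ a, f b a := by
  rw [Finset.prod_univ_sum, Fintype.piFinset_univ]

theorem sum_le_ker_prod (q : V → Fin n → ℝ) (s : Setoid V) :
    ∑ i with s ≤ Setoid.ker i, ∏ v, q v (i v)
      = (n : ℝ) ^ numClasses s * ∏ b, empAvg (blockProd q s b) := by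
  rw [sum_le_ker]
  simp only [prod_eq_prod_blockProd]
  have := sum_prod_eq_prod_sum (blockProd q s)
  simp only [sum_eq_mul_empAvg, Finset.prod_mul_distrib, Finset.prod_const,
    Finset.card_univ] at this
  rw [numClasses, Nat.card_eq_fintype_card]
  convert this

/-- Enlarging each factor to at least `1` allows the product to be extended from `A` to all
vertices. -/
theorem abs_prod_subset_le (y : V → ℝ) (A : Finset V) :
    |∏ v ∈ A, y v| ≤ (1 + Fintype.card V) + ∑ v, |y v| ^ Fintype.card V := by
  rw [Finset.abs_prod]
  calc ∏ v ∈ A, |y v| ≤ ∏ v ∈ A, max 1 |y v| :=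
        Finset.prod_le_prod (fun v _ => abs_nonneg _) fun v _ => le_max_right _ _
    _ ≤ ∏ v, max 1 |y v| := by
        rw [← Finset.univ_inter A, ← Finset.prod_ite_mem]
        refine Finset.prod_le_prod (fun v _ => by positivity) fun v _ => ?_
        split_ifs
        · rfl
        · exact le_max_left _ _
    _ = ∏ v, |max 1 (|y v|)| :=
        Finset.prod_congr rfl fun v _ => (abs_of_nonneg (by positivity)).symm
    _ ≤ 1 + ∑ v, |max 1 (|y v|)| ^ Fintype.card V := prod_abs_le_one_add_sum _
    _ ≤ 1 + ∑ v, (1 + |y v| ^ Fintype.card V) := by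
        gcongr with v
        rw [abs_of_nonneg (by positivity)]
        rcases le_total 1 (|y v|) with h | h
        · rw [max_eq_right h]; linarith
        · rw [max_eq_left h, one_pow]
          have : 0 ≤ |y v| ^ Fintype.card V := by positivity
          linarith
    _ = _ := by rw [Finset.sum_add_distrib]; simp; ring

theorem empAvg_abs_blockProd_le (q : V → Fin n → ℝ) (s : Setoid V) (b : Quotient s) :
    (empAvg fun a => |blockProd q s b a|)
      ≤ (1 + Fintype.card V) * momentSum q (Fintype.card V) := by
  have h1 : (empAvg fun a => |blockProd q s b a|)
      ≤ empAvg fun a => (1 + Fintype.card V : ℝ) + ∑ v, |q v a| ^ Fintype.card V :=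
    empAvg_mono fun a => abs_prod_subset_le (fun v => q v a) _
  refine h1.trans ?_
  have h2 : (empAvg fun a => (1 + Fintype.card V : ℝ) + ∑ v, |q v a| ^ Fintype.card V)
      ≤ (1 + Fintype.card V : ℝ) + ∑ v, empAvg fun a => |q v a| ^ Fintype.card V := by
    unfold empAvg
    rw [Finset.sum_add_distrib, mul_add, Finset.sum_comm]
    refine add_le_add ?_ (le_of_eq (Finset.mul_sum _ _ _))
    exact empAvg_le_of_le (n := n) (y := fun _ => (1 + Fintype.card V : ℝ)) (by positivity)
      fun _ => le_rfl
  refine h2.trans ?_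
  unfold momentSum
  have h3 : 0 ≤ ∑ v, empAvg fun a => |q v a| ^ Fintype.card V :=
    Finset.sum_nonneg fun v _ => empAvg_nonneg fun a => by positivity
  nlinarith [(Nat.cast_nonneg (Fintype.card V) : (0 : ℝ) ≤ Fintype.card V)]

theorem blockProd_of_singleton (q : V → Fin n → ℝ) (s : Setoid V) (v : V)
    (hv : ∀ w, s v w → w = v) : blockProd q s (Quotient.mk'' v) = q v := by
  funext a
  unfold blockProd
  have : (Finset.univ.filter fun w : V => (Quotient.mk'' w : Quotient s) = Quotient.mk'' v) = {v} := by
    ext w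
    simp only [Finset.mem_filter, Finset.mem_univ, true_and, Finset.mem_singleton]
    refine ⟨fun h => hv w (s.symm' (Quotient.exact' h)), fun h => by rw [h]⟩
  rw [this, Finset.prod_singleton]

theorem abs_prod_le_mul_pow {B : Type*} [Fintype B] (y : B → ℝ) {c : ℝ} (hc : 1 ≤ c)
    (hy : ∀ b, |y b| ≤ c) (b₀ : B) : |∏ b, y b| ≤ |y b₀| * c ^ Fintype.card B := by
  rw [Finset.abs_prod, ← Finset.mul_prod_erase _ _ (Finset.mem_univ b₀)]
  gcongr
  calc ∏ b ∈ Finset.univ.erase b₀, |y b| ≤ ∏ _b ∈ Finset.univ.erase b₀, c :=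
        Finset.prod_le_prod (fun b _ => abs_nonneg _) fun b _ => hy b
    _ = c ^ (Finset.univ.erase b₀).card := by rw [Finset.prod_const]
    _ ≤ _ := pow_le_pow_right₀ hc (Finset.card_le_univ _)

/-- Up to an error `O(1/n)` the normalized sum is the product over the classes of the averages of
their block products. The class of `v` contributes `empAvg (q n v)`, and the other factors stay
bounded. -/
theorem tendsto_sum_ker_prod_div (s : Setoid V) (v : V) (hv : ∀ w, s v w → w = v)
    (q : ∀ n : ℕ, V → Fin n → ℝ) {M : ℝ}
    (hM : ∀ᶠ n in atTop, momentSum (q n) (Fintype.card V) ≤ M)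
    (hq : Tendsto (fun n => empAvg (q n v)) atTop (𝓝 0)) :
    Tendsto (fun n : ℕ => |∑ i : V → Fin n with Setoid.ker i = s, ∏ v, q n v (i v)| / (n : ℝ) ^ numClasses s)
      atTop (𝓝 0) := by
  set c : ℝ := (1 + Fintype.card V) * max 1 M with hc
  have hc1 : 1 ≤ c := by
    have h1 : (1 : ℝ) ≤ max 1 M := le_max_left _ _
    have h2 : (0 : ℝ) ≤ Fintype.card V := Nat.cast_nonneg _
    nlinarith
  have hlim : Tendsto (fun n : ℕ => |empAvg (q n v)| * c ^ Fintype.card (Quotient s)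
      + (Fintype.card (Setoid V) * max 1 M) * (1 / (n : ℝ))) atTop (𝓝 0) := by
    have h1 := (hq.abs.mul_const (c ^ Fintype.card (Quotient s))).add
      ((tendsto_one_div_atTop_nhds_zero_nat (𝕜 := ℝ)).const_mul (Fintype.card (Setoid V) * max 1 M))
    simpa using h1
  refine squeeze_zero' (Eventually.of_forall fun n => by positivity) ?_ hlim
  filter_upwards [hM, eventually_gt_atTop 0] with n hn hn0
  have hn0' : (0 : ℝ) < n := by exact_mod_cast hn0
  have hmom : momentSum (q n) (Fintype.card V) ≤ max 1 M := hn.trans (le_max_right _ _)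
  have h1 := abs_sum_ker_sub_sum_le_ker_le (q n) s (fun i => ∏ v, q n v (i v)) zero_le_one
    fun i _ => by rw [Finset.abs_prod, one_mul]
  rw [sum_le_ker_prod, one_mul] at h1
  set Q := ∑ i : V → Fin n with Setoid.ker i = s, ∏ v, q n v (i v)
  set P := ∏ b, empAvg (blockProd (q n) s b) with hP
  have h2 : |P| ≤ |empAvg (q n v)| * c ^ Fintype.card (Quotient s) := by
    have h3 := abs_prod_le_mul_pow (fun b => empAvg (blockProd (q n) s b)) hc1 (fun b =>
      (abs_empAvg_le _).trans ((empAvg_abs_blockProd_le (q n) s b).trans (by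
        rw [hc]; gcongr))) (Quotient.mk'' v)
    simp only [blockProd_of_singleton _ s v hv] at h3
    exact h3
  rw [div_le_iff₀ (by positivity)]
  have h4 : |Q - (n : ℝ) ^ numClasses s * P|
      ≤ (Fintype.card (Setoid V) * max 1 M) * (1 / (n : ℝ)) * (n : ℝ) ^ numClasses s := by
    rw [← mul_le_mul_iff_right₀ hn0']
    refine h1.trans ?_
    have h5 : (n : ℝ) * ((Fintype.card (Setoid V) * max 1 M) * (1 / (n : ℝ)) * (n : ℝ) ^ numClasses s)
        = (Fintype.card (Setoid V) * max 1 M) * (n : ℝ) ^ numClasses s := by field_simp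
    rw [h5]
    gcongr
  calc |Q| = |(Q - (n : ℝ) ^ numClasses s * P) + (n : ℝ) ^ numClasses s * P| := by ring_nf
    _ ≤ |Q - (n : ℝ) ^ numClasses s * P| + (n : ℝ) ^ numClasses s * |P| := by
        refine (abs_add_le _ _).trans (le_of_eq ?_)
        rw [abs_mul, abs_of_nonneg (by positivity : (0 : ℝ) ≤ (n : ℝ) ^ numClasses s)]
    _ ≤ (Fintype.card (Setoid V) * max 1 M) * (1 / (n : ℝ)) * (n : ℝ) ^ numClasses s
        + (n : ℝ) ^ numClasses s * (|empAvg (q n v)| * c ^ Fintype.card (Quotient s)) := by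
        gcongr
    _ = _ := by ring

/-- Almost all maps on the quotient are injective. The lower bound serves to recover one constant
weight from its sum over a kernel. -/
theorem eventually_half_pow_le_card_ker (s : Setoid V) : ∀ᶠ n : ℕ in atTop,
    (n : ℝ) ^ numClasses s / 2 ≤ Finset.card {i : V → Fin n | Setoid.ker i = s} := by
  have hev : ∀ᶠ n : ℕ in atTop, 2 * (Fintype.card (Setoid V) * (1 + Fintype.card V : ℝ)) ≤ n :=
    tendsto_natCast_atTop_atTop.eventually_ge_atTop _
  filter_upwards [hev, eventually_gt_atTop 0] with n hn hn0
  have hn0' : (0 : ℝ) < n := by exact_mod_cast hn0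
  have h1 := abs_sum_ker_sub_sum_le_ker_le (V := V) (fun _ (_ : Fin n) => (1 : ℝ)) s
    (fun _ => 1) zero_le_one (by simp)
  have h2 : momentSum (fun (_ : V) (_ : Fin n) => (1 : ℝ)) (Fintype.card V) = 1 + Fintype.card V := by
    unfold momentSum empAvg
    simp [hn0'.ne']
  have h3 : ∑ i : V → Fin n with s ≤ Setoid.ker i, (1 : ℝ) = (n : ℝ) ^ numClasses s := by
    rw [Finset.sum_const, card_ker_le]; simp
  have h4 : ∑ i : V → Fin n with Setoid.ker i = s, (1 : ℝ)
      = Finset.card {i : V → Fin n | Setoid.ker i = s} := by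
    rw [Finset.sum_const]; simp
  rw [h2, h3, h4, one_mul] at h1
  set N : ℝ := ((Finset.card {i : V → Fin n | Setoid.ker i = s} : ℕ) : ℝ)
  set p := (n : ℝ) ^ numClasses s
  have hp : 0 ≤ p := by positivity
  have h5 : n * |N - p| ≤ n * (p / 2) := by nlinarith
  have h6 := le_of_mul_le_mul_left h5 hn0'
  have h7 := neg_abs_le (N - p)
  linarith

end

/-! ### The expectation over random signed permutations -/

section

variable {L R F : Type u} [Fintype L] [Fintype R] [Fintype F]

/-- The mean weight is constant on a pair of kernels, so the sum factorizes. That constant is its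
sum divided by the two cardinalities, and the factor `4` comes from the halves in their lower
bounds. -/
theorem abs_sum_ker_mul_meanWeight_le {n : ℕ} (H : Matrix (Fin n) (Fin n) ℝ) (l : F → L)
    (r : F → R) (s : Setoid L) (t : Setoid R) (A : (L → Fin n) → ℝ) (B : (R → Fin n) → ℝ)
    {ps pt : ℝ} (hps : 0 < ps) (hpt : 0 < pt)
    (hs : ps / 2 ≤ Finset.card {i : L → Fin n | Setoid.ker i = s})
    (ht : pt / 2 ≤ Finset.card {k : R → Fin n | Setoid.ker k = t}) :
    |∑ i with Setoid.ker i = s, ∑ k with Setoid.ker k = t, A i * B k * meanWeight H l r i k|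
      ≤ 4 * |∑ i with Setoid.ker i = s, ∑ k with Setoid.ker k = t, meanWeight H l r i k| *
        (|∑ i with Setoid.ker i = s, A i| / ps) * (|∑ k with Setoid.ker k = t, B k| / pt) := by
  have hs0 : 0 < Finset.card {i : L → Fin n | Setoid.ker i = s} := by
    have : (0 : ℝ) < Finset.card {i : L → Fin n | Setoid.ker i = s} := by linarith
    exact_mod_cast this
  have ht0 : 0 < Finset.card {k : R → Fin n | Setoid.ker k = t} := by
    have : (0 : ℝ) < Finset.card {k : R → Fin n | Setoid.ker k = t} := by linarith
    exact_mod_cast this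
  obtain ⟨i₀, hi₀⟩ := Finset.card_pos.1 hs0
  obtain ⟨k₀, hk₀⟩ := Finset.card_pos.1 ht0
  have h1 : ∀ i ∈ Finset.univ.filter (fun i : L → Fin n => Setoid.ker i = s),
      ∀ k ∈ Finset.univ.filter (fun k : R → Fin n => Setoid.ker k = t),
        meanWeight H l r i k = meanWeight H l r i₀ k₀ := fun i hi k hk =>
    meanWeight_eq_of_ker H l r
      ((Finset.mem_filter.1 hi).2.trans (Finset.mem_filter.1 hi₀).2.symm)
      ((Finset.mem_filter.1 hk).2.trans (Finset.mem_filter.1 hk₀).2.symm)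
  rw [Finset.sum_congr rfl fun i hi => Finset.sum_congr rfl fun k hk => by rw [h1 i hi k hk],
    Finset.sum_congr rfl fun i hi => Finset.sum_congr rfl fun k hk => h1 i hi k hk]
  set w := meanWeight H l r i₀ k₀
  set Ns := Finset.card {i : L → Fin n | Setoid.ker i = s}
  set Nt := Finset.card {k : R → Fin n | Setoid.ker k = t}
  have h2 : ∑ i with Setoid.ker i = s, ∑ k with Setoid.ker k = t, A i * B k * w
      = (∑ i with Setoid.ker i = s, A i) * (∑ k with Setoid.ker k = t, B k) * w := by
    rw [Finset.sum_mul_sum, Finset.sum_mul]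
    exact Finset.sum_congr rfl fun i _ => by rw [Finset.sum_mul]
  rw [h2]
  simp only [Finset.sum_const, nsmul_eq_mul, abs_mul, Nat.abs_cast]
  set a := |∑ i with Setoid.ker i = s, A i|
  set b := |∑ k with Setoid.ker k = t, B k|
  calc a * b * |w| = 4 * ((ps / 2) * ((pt / 2) * |w|)) * (a / ps) * (b / pt) := by
        field_simp; ring
    _ ≤ _ := by
        gcongr

theorem tendsto_mul_zero_of_bounded {a b : ℕ → ℝ} {M : ℝ} (ha : ∀ᶠ n in atTop, |a n| ≤ M)
    (hb : Tendsto b atTop (𝓝 0)) : Tendsto (fun n => a n * b n) atTop (𝓝 0) := by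
  have h1 : Tendsto (fun n => M * |b n|) atTop (𝓝 0) := by simpa using hb.abs.const_mul M
  refine squeeze_zero_norm' ?_ h1
  filter_upwards [ha] with n hn
  rw [Real.norm_eq_abs, abs_mul]
  gcongr

/-- For each pair of kernels the contribution is at most `4 * h * Q * D` with three bounded factors:
the normalized weight, the normalized sum of the vertex functions and that of the spectrum. Some
factor always tends to zero: a singleton class acts on `Q` or `D`, and without singletons the number
of classes is so small that `h` vanishes. -/
theorem tendsto_uavg_bipVal {l : F → L} {r : F → R} (hc : BipConnected l r)
    (hr : EvenDegrees r) (hFR : Fintype.card F = 2 * Fintype.card R)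
    (hLR : Fintype.card L = Fintype.card R + 1)
    (H : ∀ n : ℕ, Matrix (Fin n) (Fin n) ℝ) (g : ℕ → ℝ) {m : ℕ} (hm : 2 * Fintype.card R ≤ m)
    (hH : ∀ᶠ n in atTop, Delocalized (H n) (g n) m)
    (q : ∀ n : ℕ, L → Fin n → ℝ) (d : ∀ n : ℕ, R → Fin n → ℝ) {M : ℝ}
    (hMq : ∀ᶠ n in atTop, momentSum (q n) (Fintype.card L) ≤ M)
    (hMd : ∀ᶠ n in atTop, momentSum (d n) (Fintype.card R) ≤ M)
    (hq : ∀ v, Tendsto (fun n => empAvg (q n v)) atTop (𝓝 0))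
    (hd : ∀ e, Tendsto (fun n => empAvg (d n e)) atTop (𝓝 0)) :
    Tendsto (fun n : ℕ => uavg fun θ : SignedPair n => bipVal (q n) (d n) l r (signedConj (H n) θ))
      atTop (𝓝 0) := by
  have hval : ∀ n : ℕ, (uavg fun θ : SignedPair n => bipVal (q n) (d n) l r (signedConj (H n) θ))
      = ∑ p : Setoid L × Setoid R, (1 / (n : ℝ)) *
        ∑ i with Setoid.ker i = p.1, ∑ k with Setoid.ker k = p.2,
          (∏ v, q n v (i v)) * (∏ e, d n e (k e)) * meanWeight (H n) l r i k := by
    intro n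
    unfold bipVal
    rw [uavg_const_mul, uavg_sum, ← Finset.mul_sum, ← sum_sum_eq_sum_ker
      fun i k => (∏ v, q n v (i v)) * (∏ e, d n e (k e)) * meanWeight (H n) l r i k]
    congr 1
    refine Finset.sum_congr rfl fun i _ => ?_
    rw [uavg_sum]
    exact Finset.sum_congr rfl fun k _ => uavg_const_mul _ _
  simp only [hval]
  rw [← Finset.sum_const_zero (ι := Setoid L × Setoid R) (s := Finset.univ)]
  refine tendsto_finsetSum _ fun p _ => ?_
  obtain ⟨s, t⟩ := p
  dsimp only
  by_cases hl : EvenDegrees (fun f => (Quotient.mk'' (l f) : Quotient s))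
  swap
  · refine tendsto_const_nhds.congr fun n => ?_
    rw [Finset.sum_eq_zero, mul_zero]
    intro i hi
    refine Finset.sum_eq_zero fun k _ => ?_
    rw [meanWeight_eq_zero, mul_zero]
    rwa [(Finset.mem_filter.1 hi).2]
  have hconn : BipConnected (fun f => (Quotient.mk'' (l f) : Quotient s))
      (fun f => (Quotient.mk'' (r f) : Quotient t)) :=
    hc.map Quotient.mk''_surjective Quotient.mk''_surjective
  obtain ⟨C, hC0, hC⟩ := exists_abs_sum_ker_bipWeight_le l r hr (s, t) hconn hl
  set h : ℕ → ℝ := fun n => |∑ i : L → Fin n with Setoid.ker i = s,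
    ∑ k : R → Fin n with Setoid.ker k = t, meanWeight (H n) l r i k| / n with hh
  set Q : ℕ → ℝ := fun n => |∑ i : L → Fin n with Setoid.ker i = s, ∏ v, q n v (i v)|
    / (n : ℝ) ^ numClasses s with hQ
  set D : ℕ → ℝ := fun n => |∑ k : R → Fin n with Setoid.ker k = t, ∏ e, d n e (k e)|
    / (n : ℝ) ^ numClasses t with hD
  have hhb : ∀ᶠ n in atTop, |h n| ≤ C := by
    filter_upwards [hH] with n hn
    have hn1 := hn.n_pos
    have hn0 : (0 : ℝ) < n := by linarith
    rw [hh, abs_of_nonneg (by positivity)]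
    dsimp only
    rw [div_le_iff₀ hn0, sum_ker_meanWeight _ _ _ _ _ hl]
    exact hC hn (by omega)
  have hQb : ∀ᶠ n in atTop, |Q n| ≤ M := by
    filter_upwards [hMq, eventually_gt_atTop 0] with n hn hn0
    have hn0' : (0 : ℝ) < n := by exact_mod_cast hn0
    rw [hQ, abs_of_nonneg (by positivity)]
    dsimp only
    rw [div_le_iff₀ (by positivity)]
    refine (Finset.abs_sum_le_sum_abs _ _).trans ?_
    simp only [Finset.abs_prod]
    exact (sum_ker_prod_abs_le (q n) s).trans (by gcongr)
  have hDb : ∀ᶠ n in atTop, |D n| ≤ M := by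
    filter_upwards [hMd, eventually_gt_atTop 0] with n hn hn0
    have hn0' : (0 : ℝ) < n := by exact_mod_cast hn0
    rw [hD, abs_of_nonneg (by positivity)]
    dsimp only
    rw [div_le_iff₀ (by positivity)]
    refine (Finset.abs_sum_le_sum_abs _ _).trans ?_
    simp only [Finset.abs_prod]
    exact (sum_ker_prod_abs_le (d n) t).trans (by gcongr)
  have hprod : Tendsto (fun n => 4 * (h n * Q n * D n)) atTop (𝓝 0) := by
    rw [← mul_zero (4 : ℝ)]
    refine Tendsto.const_mul 4 ?_
    by_cases hsing : ∃ v, ∀ w, s v w → w = v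
    · obtain ⟨v, hv⟩ := hsing
      have h1 : Tendsto Q atTop (𝓝 0) := tendsto_sum_ker_prod_div s v hv q hMq (hq v)
      have h2 := tendsto_mul_zero_of_bounded hDb (tendsto_mul_zero_of_bounded hhb h1)
      exact h2.congr fun n => by ring
    by_cases hsing' : ∃ v, ∀ w, t v w → w = v
    · obtain ⟨v, hv⟩ := hsing'
      have h1 : Tendsto D atTop (𝓝 0) := tendsto_sum_ker_prod_div t v hv d hMd (hd v)
      have h2 := tendsto_mul_zero_of_bounded hQb (tendsto_mul_zero_of_bounded hhb h1)
      exact h2.congr fun n => by ring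
    push Not at hsing hsing'
    have c1 := two_mul_numClasses_le s fun v => (hsing v).imp fun w hw => ⟨hw.2, hw.1⟩
    have c2 := two_mul_numClasses_le t fun v => (hsing' v).imp fun w hw => ⟨hw.2, hw.1⟩
    -- Classes of size at least two number at most half of `|L| + |R| = 2 * |R| + 1`, hence at most
    -- `|R|` by integrality.
    have hcount : numClasses s + numClasses t ≤ Fintype.card R := by omega
    have h1 : Tendsto h atTop (𝓝 0) := by
      have hlim : Tendsto (fun n : ℕ => (1 : ℝ) / Real.sqrt n) atTop (𝓝 0) := by
        have := (Real.tendsto_sqrt_atTop.comp (tendsto_natCast_atTop_atTop (R := ℝ))).inv_tendsto_atTop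
        simp only [one_div]
        exact this
      refine squeeze_zero' (Eventually.of_forall fun n => by positivity) ?_ hlim
      filter_upwards [hH] with n hn
      have hn1 := hn.n_pos
      have hn0 : (0 : ℝ) < n := by linarith
      have hg := hn.one_le
      rw [hh]
      dsimp only
      rw [sum_ker_meanWeight _ _ _ _ _ hl]
      have e1 : |∑ i : L → Fin n with Setoid.ker i = s,
          ∑ k : R → Fin n with Setoid.ker k = t, bipWeight (H n) l r i k| ≤ g n ^ Fintype.card R := by
        calc _ ≤ ∑ i : L → Fin n with Setoid.ker i = s, ∑ k : R → Fin n with Setoid.ker k = t,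
              (g n / n) ^ Fintype.card R := by
              refine (Finset.abs_sum_le_sum_abs _ _).trans (Finset.sum_le_sum fun i _ => ?_)
              refine (Finset.abs_sum_le_sum_abs _ _).trans (Finset.sum_le_sum fun k _ => ?_)
              exact hn.abs_prod_le hFR _ _
          _ = (Finset.card {i : L → Fin n | Setoid.ker i = s} : ℝ) *
              ((Finset.card {k : R → Fin n | Setoid.ker k = t} : ℝ) * (g n / n) ^ Fintype.card R) := by
              simp only [Finset.sum_const, nsmul_eq_mul]
          _ ≤ (n : ℝ) ^ numClasses s * ((n : ℝ) ^ numClasses t * (g n / n) ^ Fintype.card R) := by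
              gcongr
              · exact_mod_cast card_ker_eq_le s n
              · exact_mod_cast card_ker_eq_le t n
          _ = (n : ℝ) ^ (numClasses s + numClasses t) * (g n / n) ^ Fintype.card R := by ring
          _ ≤ (n : ℝ) ^ Fintype.card R * (g n / n) ^ Fintype.card R := by gcongr
          _ = _ := by rw [← mul_pow]; field_simp
      -- This is where `2 * |R| ≤ m` is used: the loss from delocalization stays below `√n`, so that
      -- `h ≤ 1 / √n`.
      have e2 : g n ^ Fintype.card R ≤ Real.sqrt n := by
        apply Real.le_sqrt_of_sq_le
        rw [← pow_mul]
        exact (pow_le_pow_right₀ hg (by omega)).trans hn.pow_le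
      rw [div_le_div_iff₀ hn0 (by positivity), one_mul]
      calc _ ≤ Real.sqrt n * Real.sqrt n := by gcongr; exact e1.trans e2
        _ = n := Real.mul_self_sqrt hn0.le
    have h2 := tendsto_mul_zero_of_bounded hQb (tendsto_mul_zero_of_bounded hDb h1)
    exact h2.congr fun n => by ring
  refine squeeze_zero_norm' ?_ hprod
  filter_upwards [eventually_half_pow_le_card_ker s, eventually_half_pow_le_card_ker t,
    eventually_gt_atTop 0] with n h1 h2 hn0
  have hn0' : (0 : ℝ) < n := by exact_mod_cast hn0
  have h3 := abs_sum_ker_mul_meanWeight_le (H n) l r s t (fun i => ∏ v, q n v (i v))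
    (fun k => ∏ e, d n e (k e)) (by positivity) (by positivity) h1 h2
  rw [Real.norm_eq_abs, abs_mul, abs_of_nonneg (by positivity : (0 : ℝ) ≤ 1 / n)]
  calc _ ≤ (1 / (n : ℝ)) * _ := mul_le_mul_of_nonneg_left h3 (by positivity)
    _ = _ := by rw [hh, hQ, hD]; ring

end

/-! ### Joint moments of independent centred variables -/

theorem card_image_eq_numClasses {E ι : Type*} [Fintype E] [DecidableEq ι] (c : E → ι) :
    (Finset.univ.image c).card = numClasses (Setoid.ker c) := by
  rw [numClasses, Nat.card_congr (Setoid.quotientKerEquivRange _),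
    Nat.card_eq_fintype_card, ← Set.toFinset_card, Set.toFinset_range]

theorem numClasses_le_card {E : Type*} [Fintype E] (s : Setoid E) :
    numClasses s ≤ Fintype.card E := by
  rw [numClasses, ← Nat.card_eq_fintype_card]
  exact Nat.card_le_card_of_surjective _ Quotient.mk_surjective

/-- Independent centred random variables whose absolute moments of the orders `2, …, N` are at most
`κ ≤ 1`. -/
structure CenteredMoments {Ω ι : Type*} [MeasurableSpace Ω] (μ : Measure Ω) (X : ι → Ω → ℝ) (κ : ℝ)
    (N : ℕ) : Prop where
  measurable : ∀ p, Measurable (X p)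
  indep : iIndepFun X μ
  integrable : ∀ p, ∀ k ≤ N, Integrable (fun ω => |X p ω| ^ k) μ
  mean : ∀ p, ∫ ω, X p ω ∂μ = 0
  nonneg : 0 ≤ κ
  le_one : κ ≤ 1
  moment : ∀ p k, 2 ≤ k → k ≤ N → ∫ ω, |X p ω| ^ k ∂μ ≤ κ

/-- The bound on the `k`-th moment in `CenteredMoments`. -/
def momentCap (κ : ℝ) (k : ℕ) : ℝ := if k = 0 then 1 else if k = 1 then 0 else κ

theorem momentCap_nonneg {κ : ℝ} (h : 0 ≤ κ) (k : ℕ) : 0 ≤ momentCap κ k := by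
  unfold momentCap; split_ifs <;> simp [h]

theorem momentCap_le_one {κ : ℝ} (h : κ ≤ 1) (k : ℕ) : momentCap κ k ≤ 1 := by
  unfold momentCap; split_ifs <;> simp [h]

/-- Distributing the powers of a variable over several expectations can only lower the bound: an
isolated first power gives `0`, and `κ * κ ≤ κ`. -/
theorem momentCap_mul_le {κ : ℝ} (h : 0 ≤ κ) (h1 : κ ≤ 1) (a b : ℕ) :
    momentCap κ a * momentCap κ b ≤ momentCap κ (a + b) := by
  rcases Nat.eq_zero_or_pos a with rfl | ha
  · simp [momentCap]
  rcases Nat.eq_zero_or_pos b with rfl | hb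
  · simp [momentCap]
  have e : momentCap κ (a + b) = κ := by
    unfold momentCap; rw [if_neg (by omega), if_neg (by omega)]
  rw [e]
  have hb' : momentCap κ a ≤ κ := by
    unfold momentCap; rw [if_neg (by omega)]; split_ifs <;> simp [h]
  calc momentCap κ a * momentCap κ b ≤ κ * 1 := by
        gcongr
        · exact momentCap_nonneg h b
        · exact momentCap_le_one h1 b
    _ = κ := mul_one _

theorem momentCap_prod_le {J : Type*} {κ : ℝ} (h : 0 ≤ κ) (h1 : κ ≤ 1) (s : Finset J) (a : J → ℕ) :
    ∏ j ∈ s, momentCap κ (a j) ≤ momentCap κ (∑ j ∈ s, a j) := by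
  induction s using Finset.induction_on with
  | empty => simp [momentCap]
  | insert j s hj ih =>
    rw [Finset.prod_insert hj, Finset.sum_insert hj]
    exact (mul_le_mul_of_nonneg_left ih (momentCap_nonneg h _)).trans (momentCap_mul_le h h1 _ _)

namespace CenteredMoments

variable {Ω ι : Type*} [MeasurableSpace Ω] {μ : Measure Ω} [IsProbabilityMeasure μ] [Fintype ι]
  {X : ι → Ω → ℝ} {κ : ℝ} {N : ℕ} {E : Type*}

omit [Fintype ι] in
theorem integrable_prod (h : CenteredMoments μ X κ N) (c : E → ι) (S : Finset E)
    (hS : S.card ≤ N) : Integrable (fun ω => ∏ e ∈ S, X (c e) ω) μ := by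
  refine Integrable.mono' (g := fun ω => 1 + ∑ e : S, |X (c e) ω| ^ Fintype.card S) ?_ ?_ ?_
  · refine (integrable_const _).add (integrable_finsetSum _ fun e _ => h.integrable _ _ ?_)
    simpa using hS
  · exact (Finset.measurable_prod _ fun e _ => h.measurable _).aestronglyMeasurable
  · refine Eventually.of_forall fun ω => ?_
    rw [Real.norm_eq_abs, Finset.abs_prod, ← Finset.prod_coe_sort]
    exact prod_abs_le_one_add_sum _

omit [IsProbabilityMeasure μ] in
theorem integral_prod (h : CenteredMoments μ X κ N) (c : E → ι) (S : Finset E) :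
    ∫ ω, ∏ e ∈ S, X (c e) ω ∂μ = ∏ p, ∫ ω, X p ω ^ (S.filter fun e => c e = p).card ∂μ := by
  rw [← h.indep.integral_fun_prod_comp (f := fun p y => y ^ (S.filter fun e => c e = p).card)
    (fun p => (h.measurable p).aemeasurable)
    (fun p => (measurable_id.pow_const _).aestronglyMeasurable)]
  congr 1 with ω
  rw [Finset.prod_comp (fun p => X p ω) c]
  refine Finset.prod_subset (Finset.subset_univ _) fun p _ hp => ?_
  rw [Finset.card_eq_zero.2, pow_zero]
  rw [Finset.filter_eq_empty_iff]
  intro e he hep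
  exact hp (Finset.mem_image.2 ⟨e, he, hep⟩)

omit [Fintype ι] in
theorem abs_moment_le (h : CenteredMoments μ X κ N) (p : ι) {k : ℕ} (hk : k ≤ N) :
    |∫ ω, X p ω ^ k ∂μ| ≤ momentCap κ k := by
  unfold momentCap
  split_ifs with h0 h1
  · simp [h0]
  · simp [h1, h.mean p]
  · refine (abs_integral_le_integral_abs).trans ?_
    simp_rw [abs_pow]
    exact h.moment p k (by omega) hk

theorem abs_integral_prod_le (h : CenteredMoments μ X κ N) (c : E → ι) (S : Finset E)
    (hS : S.card ≤ N) : |∫ ω, ∏ e ∈ S, X (c e) ω ∂μ| ≤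
      ∏ p, momentCap κ (S.filter fun e => c e = p).card := by
  rw [h.integral_prod, Finset.abs_prod]
  exact Finset.prod_le_prod (fun _ _ => abs_nonneg _) fun p _ =>
    h.abs_moment_le p ((Finset.card_filter_le _ _).trans hS)

omit [IsProbabilityMeasure μ] in
-- Each variable that occurs contributes at most `κ`, and the variables that occur correspond to the
-- classes of the kernel of `c`.
theorem prod_momentCap_le [Fintype E] (h : CenteredMoments μ X κ N) (c : E → ι) :
    ∏ p, momentCap κ (Finset.univ.filter fun e => c e = p).card ≤
      κ ^ numClasses (Setoid.ker c) := by
  have h0 := h.nonneg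
  rw [← card_image_eq_numClasses, ← Finset.prod_subset (Finset.subset_univ (Finset.univ.image c)), ← Finset.prod_const]
  · refine Finset.prod_le_prod (fun _ _ => momentCap_nonneg h0 _) fun p hp => ?_
    obtain ⟨e, _, he⟩ := Finset.mem_image.1 hp
    have : (Finset.univ.filter fun e => c e = p).card ≠ 0 :=
      Finset.card_ne_zero_of_mem (a := e) (by simp [he])
    unfold momentCap
    rw [if_neg this]
    split_ifs <;> simp [h0]
  · intro p _ hp
    rw [Finset.card_eq_zero.2, momentCap, if_pos rfl]
    rw [Finset.filter_eq_empty_iff]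
    intro e he hep
    exact hp (Finset.mem_image.2 ⟨e, he, hep⟩)

/-- The joint central moment of four monomials. -/
def centralMoment {Ω ι : Type*} [MeasurableSpace Ω] (μ : Measure Ω) (X : ι → Ω → ℝ) {E : Type*}
    [Fintype E] (c : Four E → ι) : ℝ :=
  ∫ ω, ∏ a : Fin 4, (∏ e : E, X (c ⟨a, e⟩) ω - ∫ ω', ∏ e : E, X (c ⟨a, e⟩) ω' ∂μ) ∂μ

theorem prod_copies [Fintype E] (Y : Four E → ℝ) (t : Finset (Fin 4)) :
    ∏ a ∈ t, ∏ e : E, Y ⟨a, e⟩ = ∏ x ∈ Finset.univ.filter (fun x : Four E => x.copy ∈ t), Y x := by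
  rw [← Finset.prod_product']
  refine Finset.prod_nbij' (fun x => ⟨x.1, x.2⟩) (fun x => (x.copy, x.pt)) ?_ ?_ ?_ ?_ ?_ <;> simp

theorem card_filter_copies [Fintype E] (P : Four E → Prop) (t : Finset (Fin 4)) :
    (Finset.univ.filter fun x => P x).card =
      ((Finset.univ.filter fun x : Four E => x.copy ∈ t).filter P).card +
      ∑ a ∈ tᶜ, ((Finset.univ.filter fun x : Four E => x.copy = a).filter P).card := by
  have h2 : ∑ a ∈ tᶜ, ((Finset.univ.filter fun x : Four E => x.copy = a).filter P).card =
      ((Finset.univ.filter fun x : Four E => x.copy ∉ t).filter P).card := by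
    rw [Finset.card_eq_sum_card_fiberwise (f := fun x : Four E => x.copy) (t := tᶜ)]
    · refine Finset.sum_congr rfl fun a ha => ?_
      congr 1
      ext x
      simp only [Finset.mem_filter, Finset.mem_univ, true_and, Finset.mem_compl] at ha ⊢
      constructor
      · rintro ⟨rfl, h⟩; exact ⟨⟨ha, h⟩, rfl⟩
      · rintro ⟨⟨-, h⟩, h'⟩; exact ⟨h', h⟩
    · intro x hx
      simp at hx ⊢
      exact hx.1
  rw [h2, Finset.filter_filter, Finset.filter_filter, ← Finset.card_union_of_disjoint]
  · congr 1
    ext x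
    simp only [Finset.mem_filter, Finset.mem_union, Finset.mem_univ, true_and]
    tauto
  · rw [Finset.disjoint_left]
    intro x
    simp only [Finset.mem_filter, Finset.mem_univ, true_and]
    tauto

/-- Expanding the four differences gives `16` terms, each a product of mixed moments in which the
powers of a variable are distributed over several expectations. By submultiplicativity of the bounds
none exceeds the bound for the undivided product. -/
theorem abs_centralMoment_le [Fintype E] (h : CenteredMoments μ X κ N)
    (hN : Fintype.card (Four E) ≤ N) (c : Four E → ι) :
    |centralMoment μ X c| ≤ 16 * κ ^ numClasses (Setoid.ker c) := by
  have h0 := h.nonneg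
  set A : Finset (Fin 4) → Finset (Four E) := fun t => Finset.univ.filter fun x => x.copy ∈ t
  have hA : ∀ t, (A t).card ≤ N := fun t => (Finset.card_le_univ _).trans hN
  have hc1 : ∀ (a : Fin 4) (ω : Ω), ∏ e : E, X (c ⟨a, e⟩) ω = ∏ x ∈ A {a}, X (c x) ω := by
    intro a ω
    rw [← prod_copies (fun x => X (c x) ω), Finset.prod_singleton]
  have hexp : centralMoment μ X c = ∑ t : Finset (Fin 4), (∫ ω, ∏ x ∈ A t, X (c x) ω ∂μ) *
      ∏ a ∈ tᶜ, -∫ ω, ∏ x ∈ A {a}, X (c x) ω ∂μ := by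
    unfold centralMoment
    simp_rw [sub_eq_add_neg, Fintype.prod_add, hc1]
    rw [integral_finsetSum]
    · refine Finset.sum_congr rfl fun t _ => ?_
      rw [integral_mul_const]
      congr 2 with ω
      simp_rw [← hc1]
      exact prod_copies (fun x => X (c x) ω) t
    · intro t _
      refine Integrable.mul_const ?_ _
      refine (h.integrable_prod c (A t) (hA t)).congr (Eventually.of_forall fun ω => ?_)
      simp_rw [← hc1]
      exact (prod_copies (fun x => X (c x) ω) t).symm
  rw [hexp]
  refine (Finset.abs_sum_le_sum_abs _ _).trans ?_
  have hterm : ∀ t : Finset (Fin 4), |(∫ ω, ∏ x ∈ A t, X (c x) ω ∂μ) *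
      ∏ a ∈ tᶜ, -∫ ω, ∏ x ∈ A {a}, X (c x) ω ∂μ| ≤ κ ^ numClasses (Setoid.ker c) := by
    intro t
    refine le_trans ?_ (h.prod_momentCap_le c)
    rw [abs_mul, Finset.abs_prod]
    calc _ ≤ (∏ p, momentCap κ ((A t).filter fun x => c x = p).card) *
          ∏ a ∈ tᶜ, ∏ p, momentCap κ ((A {a}).filter fun x => c x = p).card := by
          refine mul_le_mul (h.abs_integral_prod_le c _ (hA t)) ?_
            (Finset.prod_nonneg fun _ _ => abs_nonneg _)
            (Finset.prod_nonneg fun _ _ => momentCap_nonneg h0 _)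
          refine Finset.prod_le_prod (fun _ _ => abs_nonneg _) fun a _ => ?_
          rw [abs_neg]
          exact h.abs_integral_prod_le c _ (hA {a})
      _ ≤ _ := by
          rw [Finset.prod_comm, ← Finset.prod_mul_distrib]
          refine Finset.prod_le_prod (fun p _ => mul_nonneg (momentCap_nonneg h0 _)
            (Finset.prod_nonneg fun _ _ => momentCap_nonneg h0 _)) fun p _ => ?_
          rw [card_filter_copies (fun x => c x = p) t]
          refine le_trans ?_ (momentCap_mul_le h0 h.le_one _ _)
          refine mul_le_mul_of_nonneg_left ?_ (momentCap_nonneg h0 _)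
          refine le_trans (le_of_eq ?_) (momentCap_prod_le h0 h.le_one _ _)
          simp [A]
  refine (Finset.sum_le_sum fun t _ => hterm t).trans (le_of_eq ?_)
  simp

/-- A copy that shares no variable with the other three is independent of them, and its factor is
centred. -/
theorem centralMoment_eq_zero [Fintype E] (h : CenteredMoments μ X κ N)
    (hN : Fintype.card E ≤ N) (c : Four E → ι) (a : Fin 4)
    (ha : ∀ e b f, b ≠ a → c ⟨a, e⟩ ≠ c ⟨b, f⟩) : centralMoment μ X c = 0 := by
  set S : Finset ι := Finset.univ.image fun e : E => c ⟨a, e⟩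
  set m : Fin 4 → ℝ := fun b => ∫ ω', ∏ e : E, X (c ⟨b, e⟩) ω' ∂μ
  have hS : ∀ e, c ⟨a, e⟩ ∈ S := fun e => Finset.mem_image_of_mem _ (Finset.mem_univ e)
  have hT : ∀ b, b ≠ a → ∀ e, c ⟨b, e⟩ ∈ Sᶜ := by
    intro b hb e
    rw [Finset.mem_compl]
    intro h'
    obtain ⟨f, _, hf⟩ := Finset.mem_image.1 h'
    exact ha f b e hb hf
  have hi := h.indep.indepFun_finset S Sᶜ disjoint_compl_right h.measurable
  have hi' : IndepFun (fun ω => ∏ e : E, X (c ⟨a, e⟩) ω - m a)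
      (fun ω => ∏ b : {b : Fin 4 // b ≠ a}, (∏ e : E, X (c ⟨b, e⟩) ω - m b)) μ := by
    refine hi.comp (φ := fun y : S → ℝ => ∏ e : E, y ⟨c ⟨a, e⟩, hS e⟩ - m a)
      (ψ := fun y : ↥Sᶜ → ℝ => ∏ b : {b : Fin 4 // b ≠ a},
        (∏ e : E, y ⟨c ⟨b, e⟩, hT b b.2 e⟩ - m b)) ?_ ?_
    · fun_prop
    · fun_prop
  have hmeas : ∀ b : Fin 4, Measurable fun ω => ∏ e : E, X (c ⟨b, e⟩) ω - m b := fun b =>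
    (Finset.measurable_prod _ fun e _ => h.measurable _).sub_const _
  have hsplit : centralMoment μ X c = ∫ ω, (∏ e : E, X (c ⟨a, e⟩) ω - m a) *
      ∏ b : {b : Fin 4 // b ≠ a}, (∏ e : E, X (c ⟨b, e⟩) ω - m b) ∂μ := by
    unfold centralMoment
    congr 1 with ω
    exact Fintype.prod_eq_mul_prod_subtype_ne _ a
  rw [hsplit, hi'.integral_fun_mul_eq_mul_integral (hmeas a).aestronglyMeasurable
    (Finset.measurable_prod _ fun b _ => hmeas b.1).aestronglyMeasurable]
  rw [integral_sub (h.integrable_prod (fun e => c ⟨a, e⟩) Finset.univ (by simpa using hN))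
    (integrable_const _)]
  simp [m]

end CenteredMoments

/-! ### Connected multigraphs -/

/-- Connectedness of the multigraph on `B` with the edges `{a e, b e}`. -/
def MConn {J B : Type*} (a b : J → B) : Prop :=
  ∀ φ : B → Prop, (∀ e, φ (a e) ↔ φ (b e)) → ∀ x y, φ x → φ y

/-- The map `f ↦ f ∘ a - f ∘ b` has only constants in its kernel when the graph is connected;
rank–nullity does the count. -/
theorem MConn.card_le {J B : Type*} [Fintype J] [Fintype B] {a b : J → B} (h : MConn a b) :
    Fintype.card B ≤ Fintype.card J + 1 := by
  rcases isEmpty_or_nonempty B with hB | ⟨⟨x0⟩⟩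
  · simp
  let D : (B → ℝ) →ₗ[ℝ] (J → ℝ) := LinearMap.funLeft ℝ ℝ a - LinearMap.funLeft ℝ ℝ b
  have hker : Module.finrank ℝ (LinearMap.ker D) ≤ 1 := by
    refine finrank_le_one (⟨fun _ => 1, ?_⟩ : LinearMap.ker D) fun f => ⟨f.1 x0, ?_⟩
    · ext e; simp [D, LinearMap.funLeft]
    · ext y
      have hf : ∀ e, f.1 (a e) = f.1 (b e) := by
        intro e
        have := congrFun f.2 e
        simpa [D, LinearMap.funLeft, sub_eq_zero] using this
      have := h (fun x => f.1 x = f.1 x0) (fun e => by rw [hf e]) x0 y rfl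
      simpa using this.symm
  have h1 := LinearMap.finrank_range_add_finrank_ker D
  have h2 : Module.finrank ℝ (LinearMap.range D) ≤ Module.finrank ℝ (J → ℝ) :=
    Submodule.finrank_le _
  rw [Module.finrank_fintype_fun_eq_card] at h1 h2
  omega

/-- Two edges are equivalent if they have the same end points. -/
def parallel {J B : Type*} (a b : J → B) : Setoid J := Setoid.ker fun e => s(a e, b e)

theorem parallel_out {J B : Type*} (a b : J → B) (φ : B → Prop)
    (h : ∀ x : Quotient (parallel a b), φ (a x.out) ↔ φ (b x.out)) (e : J) :
    φ (a e) ↔ φ (b e) := by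
  have h1 : s(a (Quotient.mk (parallel a b) e).out, b (Quotient.mk (parallel a b) e).out)
      = s(a e, b e) := Quotient.mk_out (s := parallel a b) e
  have h2 := h (Quotient.mk _ e)
  rcases Sym2.eq_iff.1 h1 with ⟨h3, h4⟩ | ⟨h3, h4⟩ <;> rw [h3, h4] at h2
  · exact h2
  · exact h2.symm

theorem MConn.out {J B : Type*} {a b : J → B} (h : MConn a b) :
    MConn (fun x : Quotient (parallel a b) => a x.out) fun x => b x.out :=
  fun φ hφ => h φ (parallel_out a b φ hφ)

theorem MConn.quotient {J B : Type*} {a b : J → B} (h : MConn a b) (s : Setoid B) :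
    MConn (fun e => Quotient.mk s (a e)) fun e => Quotient.mk s (b e) := by
  intro φ hφ x y
  induction x using Quotient.inductionOn with | h x =>
  induction y using Quotient.inductionOn with | h y =>
  exact h (fun z => φ (Quotient.mk s z)) hφ x y

theorem MConn.numClasses_le {J B : Type*} [Finite J] [Finite B] {a b : J → B} (h : MConn a b)
    (s : Setoid B) : numClasses s ≤
      numClasses (parallel (fun e => Quotient.mk s (a e)) fun e => Quotient.mk s (b e)) + 1 := by
  have := Fintype.ofFinite B
  have := Fintype.ofFinite J
  unfold numClasses
  rw [Nat.card_eq_fintype_card, Nat.card_eq_fintype_card]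
  exact (h.quotient s).out.card_le

/-- Names the four copies: copy `0`, a partner `b` of it, and the remaining two. -/
theorem exists_fin_four_cover : ∀ b : Fin 4, b ≠ 0 → ∃ c d : Fin 4, ∀ x, x = 0 ∨ x = b ∨ x = c ∨ x = d := by
  decide

/-- When every copy meets another one, the four connected copies form at most two components. One
extra edge makes the graph connected, which accounts for `+ 2` in place of `+ 1`. -/
theorem MConn.numClasses_four_le {J B : Type*} [Finite J] [Finite B] [Nonempty B] {a b : J → B}
    (h : MConn a b) (s : Setoid (Four B))
    (hs : ∀ x, ∃ y, y ≠ x ∧ ∃ e f,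
      parallel (fun e => Quotient.mk s (fourfold a e)) (fun e => Quotient.mk s (fourfold b e))
        ⟨x, e⟩ ⟨y, f⟩) :
    numClasses s ≤ numClasses (parallel (fun e => Quotient.mk s (fourfold a e))
      fun e => Quotient.mk s (fourfold b e)) + 2 := by
  have := Fintype.ofFinite B
  have := Fintype.ofFinite J
  set A : Four J → Quotient s := fun e => Quotient.mk s (fourfold a e)
  set A' : Four J → Quotient s := fun e => Quotient.mk s (fourfold b e)
  choose N hN e f hef using hs
  obtain ⟨c, d, hcd⟩ := exists_fin_four_cover (N 0) (hN 0)
  obtain ⟨x0⟩ := ‹Nonempty B›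
  -- The value `none` indexes the extra edge, from copy `0` to copy `c`.
  have hconn : MConn
      (fun o : Option (Quotient (parallel A A')) =>
        o.elim (Quotient.mk s ⟨0, x0⟩) fun x => A x.out)
      (fun o => o.elim (Quotient.mk s ⟨c, x0⟩) fun x => A' x.out) := by
    intro φ hφ
    have hedge := parallel_out A A' φ fun x => hφ (some x)
    have hcopy : ∀ (g : Fin 4) (z z' : B), φ (Quotient.mk s ⟨g, z⟩) → φ (Quotient.mk s ⟨g, z'⟩) :=
      fun g => h (fun z => φ (Quotient.mk s ⟨g, z⟩)) fun e => hedge ⟨g, e⟩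
    have hcopy' : ∀ (g : Fin 4) (z : B),
        φ (Quotient.mk s ⟨g, z⟩) ↔ φ (Quotient.mk s ⟨g, x0⟩) :=
      fun g z => ⟨hcopy g z x0, hcopy g x0 z⟩
    have hshare : ∀ g, φ (Quotient.mk s ⟨g, x0⟩) ↔ φ (Quotient.mk s ⟨N g, x0⟩) := by
      intro g
      have h1 : s(A ⟨g, e g⟩, A' ⟨g, e g⟩) = s(A ⟨N g, f g⟩, A' ⟨N g, f g⟩) := hef g
      rcases Sym2.eq_iff.1 h1 with ⟨h2, -⟩ | ⟨h2, -⟩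
      · have h3 := hcopy' g (a (e g))
        have h4 := hcopy' (N g) (a (f g))
        have h5 : φ (A ⟨g, e g⟩) ↔ φ (A ⟨N g, f g⟩) := by rw [h2]
        exact h3.symm.trans (h5.trans h4)
      · have h3 := hcopy' g (a (e g))
        have h4 := hcopy' (N g) (b (f g))
        have h5 : φ (A ⟨g, e g⟩) ↔ φ (A' ⟨N g, f g⟩) := by rw [h2]
        exact h3.symm.trans (h5.trans h4)
    have hc : φ (Quotient.mk s ⟨0, x0⟩) ↔ φ (Quotient.mk s ⟨c, x0⟩) := hφ none
    have hall : ∀ g, φ (Quotient.mk s ⟨g, x0⟩) ↔ φ (Quotient.mk s ⟨0, x0⟩) := by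
      have h3 : ∀ g, g = 0 ∨ g = N 0 ∨ g = c →
          (φ (Quotient.mk s ⟨g, x0⟩) ↔ φ (Quotient.mk s ⟨0, x0⟩)) := by
        rintro g (rfl | rfl | rfl)
        · exact Iff.rfl
        · exact (hshare 0).symm
        · exact hc.symm
      intro g
      rcases hcd g with hg | hg | hg | hg
      · exact h3 g (Or.inl hg)
      · exact h3 g (Or.inr (Or.inl hg))
      · exact h3 g (Or.inr (Or.inr hg))
      -- The copy `d` has a partner different from itself, hence among the three copies already
      -- connected.
      · have hNg := hN g
        rcases hcd (N g) with hg' | hg' | hg' | hg'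
        · exact (hshare g).trans (h3 _ (Or.inl hg'))
        · exact (hshare g).trans (h3 _ (Or.inr (Or.inl hg')))
        · exact (hshare g).trans (h3 _ (Or.inr (Or.inr hg')))
        · exact absurd (hg'.trans hg.symm) hNg
    intro x y
    induction x using Quotient.inductionOn with | h x =>
    induction y using Quotient.inductionOn with | h y =>
    intro hx
    exact (hcopy' y.copy y.pt).2 ((hall _).2 ((hall _).1 ((hcopy' x.copy x.pt).1 hx)))
  have := hconn.card_le
  rw [Fintype.card_option] at this
  unfold numClasses
  rw [Nat.card_eq_fintype_card, Nat.card_eq_fintype_card]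
  exact this

/-! ### Networks of symmetric matrices -/

/-- The index `{a, b}` of an entry of a symmetric matrix. -/
def pairIdx {n : ℕ} (a b : Fin n) : {p : Fin n × Fin n // p.1 ≤ p.2} :=
  ⟨(min a b, max a b), min_le_max⟩

theorem pairIdx_eq_iff {n : ℕ} {a b c d : Fin n} :
    pairIdx a b = pairIdx c d ↔ s(a, b) = s(c, d) := by
  rw [Sym2.eq_iff]
  simp only [pairIdx, Subtype.mk.injEq, Prod.mk.injEq]
  constructor
  · rintro ⟨h1, h2⟩
    rcases le_total a b with h | h <;> rcases le_total c d with h' | h' <;>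
      simp [h, h'] at h1 h2 <;> simp [h1, h2]
  · rintro (⟨rfl, rfl⟩ | ⟨rfl, rfl⟩)
    · simp
    · simp [min_comm, max_comm]

section network

variable {V E : Type u} [Fintype V] [Fintype E] {n : ℕ}

/-- The index of the matrix entry attached to the edge `e`. -/
def edgeIdx (u w : E → V) (i : V → Fin n) (e : E) : {p : Fin n × Fin n // p.1 ≤ p.2} :=
  pairIdx (i (u e)) (i (w e))

/-- The parallelism of edges after the identification of vertices. -/
def edgeSetoid (u w : E → V) (s : Setoid V) : Setoid E :=
  parallel (fun e => Quotient.mk s (u e)) fun e => Quotient.mk s (w e)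

omit [Fintype V] [Fintype E] in
-- Two edges read the same matrix entry exactly when they become parallel after vertices with equal
-- labels are identified. Counting independent entries thus becomes counting edges of a quotient
-- graph.
theorem edgeSetoid_ker (u w : E → V) (i : V → Fin n) :
    edgeSetoid u w (Setoid.ker i) = Setoid.ker (edgeIdx u w i) := by
  have hmk : ∀ x y, (Quotient.mk (Setoid.ker i) x = Quotient.mk (Setoid.ker i) y) ↔ i x = i y :=
    fun x y => Quotient.eq
  ext e f
  change s(_, _) = s(_, _) ↔ pairIdx _ _ = pairIdx _ _
  rw [pairIdx_eq_iff, Sym2.eq_iff, Sym2.eq_iff]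
  simp only [hmk]

/-- The value of a network whose edges carry the entries `Y` of a symmetric matrix. -/
def netVal (q : V → Fin n → ℝ) (u w : E → V) (Y : {p : Fin n × Fin n // p.1 ≤ p.2} → ℝ) : ℝ :=
  (1 / (n : ℝ)) * ∑ i, (∏ v, q v (i v)) * ∏ e, Y (edgeIdx u w i e)

variable {Ω : Type*} [MeasurableSpace Ω] {μ : Measure Ω} [IsProbabilityMeasure μ]
  {X : {p : Fin n × Fin n // p.1 ≤ p.2} → Ω → ℝ} {κ : ℝ} {N : ℕ}

omit [Fintype E] in
theorem pow_four_sum_single {α : Type*} [Fintype α] (G : (V → α) → ℝ) :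
    (∑ i, G i) ^ 4 = ∑ i : Four V → α, ∏ c, G fun x => i ⟨c, x⟩ := by
  have h := pow_four_sum (R := PEmpty.{u + 1}) fun (i : V → α) _ => G i
  have : IsEmpty (Four PEmpty.{u + 1}) := ⟨fun x => x.pt.elim⟩
  simpa using h

theorem CenteredMoments.integral_netVal (h : CenteredMoments μ X κ N) (hN : Fintype.card E ≤ N)
    (q : V → Fin n → ℝ) (u w : E → V) : ∫ ω, netVal q u w (fun p => X p ω) ∂μ =
      (1 / (n : ℝ)) * ∑ i, (∏ v, q v (i v)) * ∫ ω, ∏ e, X (edgeIdx u w i e) ω ∂μ := by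
  unfold netVal
  rw [integral_const_mul, integral_finsetSum]
  · simp_rw [integral_const_mul]
  · exact fun i _ => (h.integrable_prod _ Finset.univ (by simpa using hN)).const_mul _

theorem CenteredMoments.integrable_prod_sub {ι : Type*} [Fintype ι] {X : ι → Ω → ℝ}
    (h : CenteredMoments μ X κ N) (hN : Fintype.card (Four E) ≤ N) (c : Four E → ι) :
    Integrable (fun ω => ∏ a : Fin 4,
      (∏ e : E, X (c ⟨a, e⟩) ω - ∫ ω', ∏ e : E, X (c ⟨a, e⟩) ω' ∂μ)) μ := by
  simp_rw [sub_eq_add_neg, Fintype.prod_add]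
  refine integrable_finsetSum _ fun t _ => Integrable.mul_const ?_ _
  refine (h.integrable_prod c (Finset.univ.filter fun x : Four E => x.copy ∈ t)
    ((Finset.card_le_univ _).trans hN)).congr (Eventually.of_forall fun ω => ?_)
  exact (CenteredMoments.prod_copies (fun x => X (c x) ω) t).symm

/-- Each labelling of the four copies with `c` vertex classes has a central moment of order `n ^ (2
- c)`: it is zero unless every copy shares an entry with another, and then at least `c - 2` distinct
entries occur, each costing `C / n`. There are at most `n ^ c` labellings for each kernel, and `n⁻⁴
* n ^ 2 = n⁻²`. -/
theorem CenteredMoments.netVal_concentration [Nonempty V] {u w : E → V} (hc : MConn u w)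
    (h : CenteredMoments μ X κ N) (hN : Fintype.card (Four E) ≤ N) (hn : 0 < n) {C : ℝ}
    (hC : 1 ≤ C) (hκ : κ = C / n) (q : V → Fin n → ℝ) :
    Integrable (fun ω => (netVal q u w (fun p => X p ω)
      - ∫ ω', netVal q u w (fun p => X p ω') ∂μ) ^ 4) μ ∧
    ∫ ω, (netVal q u w (fun p => X p ω) - ∫ ω', netVal q u w (fun p => X p ω') ∂μ) ^ 4 ∂μ ≤
      16 * C ^ Fintype.card (Four E) * Fintype.card (Setoid (Four V)) *
        momentSum (fun v : Four V => q v.pt) (Fintype.card (Four V)) / n ^ 2 := by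
  have hn' : (0 : ℝ) < n := by exact_mod_cast hn
  have hN1 : Fintype.card E ≤ N := by rw [Four.card] at hN; omega
  set c : (Four V → Fin n) → Four E → {p : Fin n × Fin n // p.1 ≤ p.2} :=
    fun i => edgeIdx (fourfold u) (fourfold w) i
  have hexp : ∀ ω, (netVal q u w (fun p => X p ω)
      - ∫ ω', netVal q u w (fun p => X p ω') ∂μ) ^ 4 = (1 / (n : ℝ)) ^ 4 *
      ∑ i : Four V → Fin n, (∏ v, q v.pt (i v)) * ∏ a : Fin 4,
        (∏ e : E, X (c i ⟨a, e⟩) ω - ∫ ω', ∏ e : E, X (c i ⟨a, e⟩) ω' ∂μ) := by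
    intro ω
    rw [h.integral_netVal hN1, netVal, ← mul_sub, ← Finset.sum_sub_distrib, mul_pow]
    simp_rw [← mul_sub]
    rw [pow_four_sum_single]
    congr 1
    refine Finset.sum_congr rfl fun i _ => ?_
    rw [Finset.prod_mul_distrib, Four.prod_eq]
    rfl
  simp_rw [hexp]
  have hint := fun i => h.integrable_prod_sub hN (c i)
  refine ⟨(integrable_finsetSum _ fun i _ => (hint i).const_mul _).const_mul _, ?_⟩
  rw [integral_const_mul, integral_finsetSum _ fun i _ => (hint i).const_mul _]
  simp_rw [integral_const_mul]
  -- The bound depends on the labelling only through its kernel, which permits decoupling it from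
  -- `q`.
  set K : (Four V → Fin n) → ℝ := fun i =>
    16 * C ^ Fintype.card (Four E) * (n ^ 2 * ((n : ℝ) ^ numClasses (Setoid.ker i))⁻¹)
  have hK : ∀ i, |CenteredMoments.centralMoment μ X (c i)| ≤ K i := by
    intro i
    by_cases hz : ∀ a, ∃ b, b ≠ a ∧ ∃ e f, c i ⟨a, e⟩ = c i ⟨b, f⟩
    · refine (h.abs_centralMoment_le hN (c i)).trans ?_
      rw [← edgeSetoid_ker]
      set m := numClasses (edgeSetoid (fourfold u) (fourfold w) (Setoid.ker i)) with hm
      have h1 : numClasses (Setoid.ker i) ≤ m + 2 := by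
        refine hc.numClasses_four_le (Setoid.ker i) fun a => ?_
        obtain ⟨b, hb, e, f, hef⟩ := hz a
        refine ⟨b, hb, e, f, ?_⟩
        change edgeSetoid (fourfold u) (fourfold w) (Setoid.ker i) _ _
        rw [edgeSetoid_ker]
        exact hef
      have h2 : m ≤ Fintype.card (Four E) := numClasses_le_card _
      change _ ≤ 16 * C ^ Fintype.card (Four E) * (n ^ 2 * ((n : ℝ) ^ numClasses (Setoid.ker i))⁻¹)
      rw [mul_assoc, hκ, div_pow, div_eq_mul_inv]
      gcongr ?_ * ?_
      refine mul_le_mul (pow_le_pow_right₀ hC h2) ?_ (by positivity) (by positivity)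
      rw [← div_eq_mul_inv, le_div_iff₀ (by positivity), inv_mul_le_iff₀ (by positivity), ← pow_add]
      exact pow_le_pow_right₀ (by exact_mod_cast hn) h1
    · push Not at hz
      obtain ⟨a, ha⟩ := hz
      rw [h.centralMoment_eq_zero hN1 (c i) a fun e b f hb => ha b hb e f]
      simp only [K, abs_zero]
      positivity
  have hKperm : ∀ (τ : Equiv.Perm (Fin n)) (i : Four V → Fin n), K (fun v => τ (i v)) = K i := by
    intro τ i
    simp only [K, ker_perm_comp τ i]
  have hbound : ∑ i : Four V → Fin n, (∏ v, q v.pt (i v)) * CenteredMoments.centralMoment μ X (c i) ≤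
      momentSum (fun v : Four V => q v.pt) (Fintype.card (Four V)) *
        (16 * C ^ Fintype.card (Four E) * (n ^ 2 * Fintype.card (Setoid (Four V)))) := by
    calc _ ≤ ∑ i : Four V → Fin n, (∏ v : Four V, |q v.pt (i v)|) * K i := by
          refine Finset.sum_le_sum fun i _ => (le_abs_self _).trans ?_
          rw [abs_mul, Finset.abs_prod]
          exact mul_le_mul_of_nonneg_left (hK i) (Finset.prod_nonneg fun _ _ => abs_nonneg _)
      _ ≤ _ := sum_prod_abs_mul_le (fun v : Four V => q v.pt) K
          (fun i => by simp only [K]; positivity) hKperm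
      _ ≤ _ := by
          refine mul_le_mul_of_nonneg_left ?_ (zero_le_one.trans (one_le_momentSum _ _))
          simp only [K]
          rw [← Finset.mul_sum, ← Finset.mul_sum]
          gcongr
          exact sum_inv_pow_numClasses_le n
  refine (mul_le_mul_of_nonneg_left hbound (by positivity)).trans (le_of_eq ?_)
  field_simp

end network

/-! ### Averages over trees -/

/-- The degrees add up to `2 * |J| < 2 * |B|`, so some vertex has degree below two, and by
connectedness exactly one. A loop would count twice, whence `x ≠ y`. -/
theorem MConn.exists_leaf {J B : Type*} [Fintype J] [Fintype B] {a b : J → B} (h : MConn a b)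
    (hcard : Fintype.card B = Fintype.card J + 1) (hJ : 0 < Fintype.card J) :
    ∃ y x e, x ≠ y ∧ s(a e, b e) = s(x, y) ∧ ∀ f, f ≠ e → a f ≠ y ∧ b f ≠ y := by
  have h1 : Fintype.card J = ∑ y, (Finset.univ.filter fun e => a e = y).card :=
    Finset.card_eq_sum_card_fiberwise fun _ _ => Finset.mem_coe.2 (Finset.mem_univ _)
  have h2 : Fintype.card J = ∑ y, (Finset.univ.filter fun e => b e = y).card :=
    Finset.card_eq_sum_card_fiberwise fun _ _ => Finset.mem_coe.2 (Finset.mem_univ _)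
  obtain ⟨y, hy⟩ : ∃ y, (Finset.univ.filter fun e => a e = y).card +
      (Finset.univ.filter fun e => b e = y).card < 2 := by
    by_contra! hcon
    have h3 := Finset.sum_le_sum fun y (_ : y ∈ Finset.univ) => hcon y
    rw [Finset.sum_add_distrib, ← h1, ← h2, Finset.sum_const, Finset.card_univ, smul_eq_mul] at h3
    omega
  have hinc : ∃ e, a e = y ∨ b e = y := by
    by_contra! hcon
    have h4 : ∀ z, z = y := fun z => h (fun x => x = y)
      (fun e => by simp [(hcon e).1, (hcon e).2]) y z rfl
    have : Fintype.card B ≤ 1 := Fintype.card_le_one_iff.2 fun p q => (h4 p).trans (h4 q).symm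
    omega
  obtain ⟨e, he⟩ := hinc
  have ha : ∀ f, a f = y → f ∈ Finset.univ.filter fun e => a e = y := fun f hf => by simp [hf]
  have hb : ∀ f, b f = y → f ∈ Finset.univ.filter fun e => b e = y := fun f hf => by simp [hf]
  have hab : ∀ f g, a f = y → b g = y → False := by
    intro f g hf hg
    have := Finset.card_pos.2 ⟨f, ha f hf⟩
    have := Finset.card_pos.2 ⟨g, hb g hg⟩
    omega
  have haa : ∀ f g, a f = y → a g = y → f = g := fun f g hf hg =>
    Finset.card_le_one.1 (by omega) f (ha f hf) g (ha g hg)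
  have hbb : ∀ f g, b f = y → b g = y → f = g := fun f g hf hg =>
    Finset.card_le_one.1 (by omega) f (hb f hf) g (hb g hg)
  rcases he with he | he
  · exact ⟨y, b e, e, fun h' => hab e e he h', by rw [he, Sym2.eq_swap], fun f hf =>
      ⟨fun h' => hf (haa f e h' he), fun h' => hab e f he h'⟩⟩
  · exact ⟨y, a e, e, fun h' => hab e e h' he, by rw [he], fun f hf =>
      ⟨fun h' => hab f e h' he, fun h' => hf (hbb f e h' he)⟩⟩

theorem MConn.erase_leaf {J B : Type*} {a b : J → B} (h : MConn a b) {y x : B} {e : J}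
    (hx : x ≠ y) (he : s(a e, b e) = s(x, y)) (hne : ∀ f, f ≠ e → a f ≠ y ∧ b f ≠ y) :
    MConn (fun f : {f // f ≠ e} => (⟨a f, (hne f f.2).1⟩ : {z // z ≠ y}))
      fun f => ⟨b f, (hne f f.2).2⟩ := by
  intro φ hφ p q hp
  -- A property of the remaining vertices is extended to the leaf by its value at the neighbour.
  let ψ : B → Prop := fun z => if hz : z ≠ y then φ ⟨z, hz⟩ else φ ⟨x, hx⟩
  have hψ : ∀ z (hz : z ≠ y), ψ z ↔ φ ⟨z, hz⟩ := fun z hz => by simp [ψ, hz]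
  have hψy : ψ y ↔ φ ⟨x, hx⟩ := by simp [ψ]
  refine (hψ q q.2).1 (h ψ (fun f => ?_) p q ((hψ p p.2).2 hp))
  by_cases hf : f = e
  · subst hf
    rcases Sym2.eq_iff.1 he with ⟨h1, h2⟩ | ⟨h1, h2⟩ <;> rw [h1, h2, hψy, hψ x hx]
  · rw [hψ _ (hne f hf).1, hψ _ (hne f hf).2]
    exact hφ ⟨f, hf⟩

/-- The normalized sum over all labellings of the vertices of a multigraph. -/
def graphAvg {J B : Type*} [Fintype J] [Fintype B] {n : ℕ} (Q : B → Fin n → ℝ)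
    (S : Fin n → Fin n → ℝ) (a b : J → B) : ℝ :=
  ((n : ℝ) ^ Fintype.card B)⁻¹ * ∑ j : B → Fin n, (∏ x, Q x (j x)) * ∏ e, S (j (a e)) (j (b e))

/-- The normalized sum with an additional factor. -/
def graphAvgMul {J B : Type*} [Fintype J] [Fintype B] {n : ℕ} (Q : B → Fin n → ℝ)
    (S : Fin n → Fin n → ℝ) (a b : J → B) (h : (B → Fin n) → ℝ) : ℝ :=
  ((n : ℝ) ^ Fintype.card B)⁻¹ * ∑ j : B → Fin n,
    (∏ x, Q x (j x)) * (∏ e, S (j (a e)) (j (b e))) * h j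

/-- The label of the leaf occurs only in its own vertex function and in one edge factor, so it is
averaged out first and leaves a function of the neighbour's label. -/
theorem graphAvg_leaf {J B : Type*} [Fintype J] [Fintype B] {n : ℕ} (Q : B → Fin n → ℝ)
    {S : Fin n → Fin n → ℝ} (hS : ∀ i j, S i j = S j i) (a b : J → B) {y x : B} {e : J}
    (hx : x ≠ y) (he : s(a e, b e) = s(x, y)) (hne : ∀ f, f ≠ e → a f ≠ y ∧ b f ≠ y) :
    graphAvg Q S a b = graphAvgMul (fun z : {z // z ≠ y} => Q z) S
      (fun f : {f // f ≠ e} => (⟨a f, (hne f f.2).1⟩ : {z // z ≠ y})) (fun f => ⟨b f, (hne f f.2).2⟩)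
        fun j => empAvg fun i => Q y i * S (j ⟨x, hx⟩) i := by
  have hcard : Fintype.card B = Fintype.card {z // z ≠ y} + 1 := by
    have := Fintype.card_subtype_compl (fun z => z = y)
    have h1 : 0 < Fintype.card B := Fintype.card_pos_iff.2 ⟨y⟩
    simp only [Fintype.card_subtype_eq] at this
    simp only [ne_eq]
    omega
  unfold graphAvg graphAvgMul
  rw [hcard, pow_succ, mul_inv, mul_assoc, ← (Equiv.funSplitAt y (Fin n)).symm.sum_comp,
    Fintype.sum_prod_type_right, Finset.mul_sum]
  congr 1
  refine Finset.sum_congr (by ext; simp) fun j _ => ?_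
  beta_reduce
  simp_rw [empAvg, one_div, Finset.mul_sum]
  refine Finset.sum_congr rfl fun i _ => ?_
  have hy : (Equiv.funSplitAt y (Fin n)).symm (i, j) y = i := by simp [Equiv.funSplitAt]
  have hz : ∀ z (h : z ≠ y), (Equiv.funSplitAt y (Fin n)).symm (i, j) z = j ⟨z, h⟩ :=
    fun z h => by simp [Equiv.funSplitAt, h]
  set g := (Equiv.funSplitAt y (Fin n)).symm (i, j)
  rw [Fintype.prod_eq_mul_prod_subtype_ne (fun z => Q z (g z)) y,
    Fintype.prod_eq_mul_prod_subtype_ne (fun f => S (g (a f)) (g (b f))) e, hy]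
  have h1 : ∏ z : {z // z ≠ y}, Q z (g z) = ∏ z : {z // z ≠ y}, Q z (j z) :=
    Finset.prod_congr rfl fun z _ => by rw [hz z z.2]
  have h2 : ∏ f : {f // f ≠ e}, S (g (a f)) (g (b f)) =
      ∏ f : {f // f ≠ e}, S (j ⟨a f, (hne f f.2).1⟩) (j ⟨b f, (hne f f.2).2⟩) :=
    Finset.prod_congr rfl fun f _ => by rw [hz _ (hne f f.2).1, hz _ (hne f f.2).2]
  have h3 : S (g (a e)) (g (b e)) = S (j ⟨x, hx⟩) i := by
    rcases Sym2.eq_iff.1 he with ⟨h4, h5⟩ | ⟨h4, h5⟩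
    · rw [h4, h5, hy, hz x hx]
    · rw [h4, h5, hy, hz x hx, hS]
  rw [h1, h2, h3]
  ring

theorem sum_prod_abs_le_pow {B : Type*} [Fintype B] {n : ℕ} (Q : B → Fin n → ℝ) {M : ℝ}
    (hM : ∀ x, empAvg (fun i => |Q x i|) ≤ M) :
    ((n : ℝ) ^ Fintype.card B)⁻¹ * ∑ j : B → Fin n, ∏ x, |Q x (j x)| ≤ M ^ Fintype.card B := by
  rw [sum_prod_eq_prod_sum (fun x i => |Q x i|)]
  have : ((n : ℝ) ^ Fintype.card B)⁻¹ * ∏ x, ∑ i, |Q x i| = ∏ x, empAvg (fun i => |Q x i|) := by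
    simp_rw [empAvg]
    rw [Finset.prod_mul_distrib, Finset.prod_const, Finset.card_univ, one_div, inv_pow]
  rw [this]
  exact (Finset.prod_le_prod (fun _ _ => empAvg_nonneg fun _ => abs_nonneg _)
    fun x _ => hM x).trans (by simp)

theorem abs_graphAvgMul_sub_le {J B : Type*} [Fintype J] [Fintype B] {n : ℕ} (Q : B → Fin n → ℝ)
    {S : Fin n → Fin n → ℝ} (a b : J → B) {C M ε c : ℝ} (hSC : ∀ i j, |S i j| ≤ C) (hC : 0 ≤ C)
    (hM : ∀ x, empAvg (fun i => |Q x i|) ≤ M) (hε : 0 ≤ ε) {h : (B → Fin n) → ℝ}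
    (hh : ∀ j, |h j - c| ≤ ε) : |graphAvgMul Q S a b h - c * graphAvg Q S a b| ≤
      C ^ Fintype.card J * ε * M ^ Fintype.card B := by
  rw [graphAvg, graphAvgMul, mul_left_comm, ← mul_sub, Finset.mul_sum, ← Finset.sum_sub_distrib,
    abs_mul, abs_of_nonneg (by positivity)]
  calc _ ≤ ((n : ℝ) ^ Fintype.card B)⁻¹ * ∑ j : B → Fin n,
        C ^ Fintype.card J * ε * ∏ z, |Q z (j z)| := by
        refine mul_le_mul_of_nonneg_left ((Finset.abs_sum_le_sum_abs _ _).trans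
          (Finset.sum_le_sum fun j _ => ?_)) (by positivity)
        rw [mul_comm c, ← mul_sub, abs_mul, abs_mul, Finset.abs_prod,
          Finset.abs_prod, mul_assoc, mul_comm]
        refine mul_le_mul_of_nonneg_right ?_ (Finset.prod_nonneg fun _ _ => abs_nonneg _)
        refine mul_le_mul ?_ (hh _) (abs_nonneg _) (by positivity)
        refine (Finset.prod_le_prod (fun _ _ => abs_nonneg _) fun f _ => hSC _ _).trans ?_
        rw [Finset.prod_const, Finset.card_univ]
    _ ≤ _ := by
        rw [← Finset.mul_sum, mul_left_comm]
        exact mul_le_mul_of_nonneg_left (sum_prod_abs_le_pow Q hM) (by positivity)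

/-- Induction by removing leaves: the average over a leaf is within `ε` of the mean of its vertex
function, uniformly in the label of the neighbour, so the edge factor disappears. Each of the `m`
removals costs at most `ε * (C * M) ^ m`. -/
theorem abs_graphAvg_sub_le (m : ℕ) : ∀ {J B : Type u} [Fintype J] [Fintype B] {n : ℕ}
    (Q : B → Fin n → ℝ) {S : Fin n → Fin n → ℝ} {a b : J → B} {C M ε : ℝ}, Fintype.card J = m →
    Fintype.card B = m + 1 → MConn a b → (∀ i j, S i j = S j i) → (∀ i j, |S i j| ≤ C) → 1 ≤ C →
    (∀ x, empAvg (fun i => |Q x i|) ≤ M) → 0 ≤ M → 0 ≤ ε →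
    (∀ x i, |empAvg (fun j => Q x j * S i j) - empAvg (Q x)| ≤ ε) →
    |graphAvg Q S a b - ∏ x, empAvg (Q x)| ≤ m * ε * (C * M) ^ m := by
  induction m with
  | zero =>
    intro J B _ _ n Q S a b C M ε hJ hB _ _ _ _ _ _ _ _
    have := Fintype.card_eq_zero_iff.1 hJ
    have h0 : graphAvg Q S a b = ∏ x, empAvg (Q x) := by
      unfold graphAvg
      simp_rw [Finset.univ_eq_empty, Finset.prod_empty, mul_one]
      rw [sum_prod_eq_prod_sum]
      simp_rw [empAvg]
      rw [Finset.prod_mul_distrib, Finset.prod_const, Finset.card_univ, one_div, inv_pow]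
    rw [h0]
    simp
  | succ m ih =>
    intro J B _ _ n Q S a b C M ε hJ hB hc hS hSC hC hM hM0 hε hQ
    obtain ⟨y, x, e, hx, he, hne⟩ := hc.exists_leaf (by omega) (by omega)
    have hB' : Fintype.card {z // z ≠ y} = m + 1 := by
      have := Fintype.card_subtype_compl (fun z => z = y)
      simp only [Fintype.card_subtype_eq] at this
      simp only [ne_eq]
      omega
    have hJ' : Fintype.card {f // f ≠ e} = m := by
      have := Fintype.card_subtype_compl (fun z => z = e)
      simp only [Fintype.card_subtype_eq] at this
      simp only [ne_eq]
      omega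
    have hih := ih (fun z : {z // z ≠ y} => Q z) hJ' hB' (hc.erase_leaf hx he hne) hS hSC hC
      (fun z => hM z) hM0 hε fun z => hQ z
    rw [graphAvg_leaf Q hS a b hx he hne, Fintype.prod_eq_mul_prod_subtype_ne _ y]
    set T := graphAvg (fun z : {z // z ≠ y} => Q z) S
      (fun f : {f // f ≠ e} => (⟨a f, (hne f f.2).1⟩ : {z // z ≠ y})) fun f => ⟨b f, (hne f f.2).2⟩
    set P := ∏ z : {z // z ≠ y}, empAvg (Q z)
    have hfirst := abs_graphAvgMul_sub_le (fun z : {z // z ≠ y} => Q z)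
      (fun f : {f // f ≠ e} => (⟨a f, (hne f f.2).1⟩ : {z // z ≠ y})) (fun f => ⟨b f, (hne f f.2).2⟩)
      hSC (zero_le_one.trans hC) (fun z => hM z) hε fun j => hQ y (j ⟨x, hx⟩)
    rw [hB', hJ'] at hfirst
    have hsecond : |empAvg (Q y) * T - empAvg (Q y) * P| ≤ M * (m * ε * (C * M) ^ m) := by
      rw [← mul_sub, abs_mul]
      exact mul_le_mul ((abs_empAvg_le _).trans (hM y)) hih (abs_nonneg _) hM0
    refine (abs_sub_le _ _ _).trans ((add_le_add hfirst hsecond).trans ?_)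
    have h1 : C ^ m ≤ C ^ (m + 1) := pow_le_pow_right₀ hC (Nat.le_succ m)
    have h2 : C ^ m * ε * M ^ (m + 1) ≤ C ^ (m + 1) * ε * M ^ (m + 1) := by gcongr
    have h3 : M * (m * ε * (C * M) ^ m) ≤ m * ε * (C ^ (m + 1) * M ^ (m + 1)) := by
      rw [mul_pow]
      calc M * (m * ε * (C ^ m * M ^ m)) = m * ε * (C ^ m * M ^ (m + 1)) := by ring
        _ ≤ _ := by gcongr
    push_cast
    rw [mul_pow C M (m + 1)]
    calc _ ≤ C ^ (m + 1) * ε * M ^ (m + 1) + m * ε * (C ^ (m + 1) * M ^ (m + 1)) := add_le_add h2 h3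
      _ = _ := by ring

/-! ### Expected values of networks of Wigner matrices -/

namespace CenteredMoments

variable {Ω ι : Type*} [MeasurableSpace Ω] {μ : Measure Ω} [IsProbabilityMeasure μ] [Fintype ι]
  {X : ι → Ω → ℝ} {κ : ℝ} {N : ℕ} {E : Type*} [Fintype E]

omit [IsProbabilityMeasure μ] [Fintype ι] in
theorem integral_prod_eq_prod_classes (h : CenteredMoments μ X κ N) (c : E → ι) {t : Setoid E}
    (ht : t = Setoid.ker c) : ∫ ω, ∏ e, X (c e) ω ∂μ =
      ∏ x : Quotient t, ∫ ω, X (c x.out) ω ^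
        (Finset.univ.filter fun e => Quotient.mk t e = x).card ∂μ := by
  subst ht
  have hinj : Function.Injective fun x : Quotient (Setoid.ker c) => c x.out := by
    intro x y hxy
    rw [← Quotient.out_eq x, ← Quotient.out_eq y]
    exact Quotient.sound hxy
  rw [← (h.indep.precomp hinj).integral_fun_prod_comp
    (f := fun x y => y ^ (Finset.univ.filter fun e => Quotient.mk (Setoid.ker c) e = x).card)
    (fun x => (h.measurable _).aemeasurable)
    (fun x => (measurable_id.pow_const _).aestronglyMeasurable)]
  congr 1 with ω
  rw [← Finset.prod_fiberwise Finset.univ (fun e : E => Quotient.mk (Setoid.ker c) e)]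
  refine Finset.prod_congr rfl fun x _ => ?_
  rw [← Finset.prod_const]
  refine Finset.prod_congr rfl fun e he => ?_
  have h1 : Quotient.mk (Setoid.ker c) e = x := (Finset.mem_filter.1 he).2
  have h2 : c x.out = c e := by
    rw [← h1]
    exact Quotient.mk_out (s := Setoid.ker c) e
  rw [h2]

theorem abs_integral_prod_le_pow (h : CenteredMoments μ X κ N) (hN : Fintype.card E ≤ N)
    (c : E → ι) {t : Setoid E} (ht : t = Setoid.ker c) :
    |∫ ω, ∏ e, X (c e) ω ∂μ| ≤ κ ^ numClasses t := by
  subst ht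
  exact (h.abs_integral_prod_le c Finset.univ (by simpa using hN)).trans (h.prod_momentCap_le c)

omit [IsProbabilityMeasure μ] [Fintype ι] in
theorem integral_prod_eq_zero (h : CenteredMoments μ X κ N)
    (c : E → ι) {t : Setoid E} (ht : t = Setoid.ker c) (x : Quotient t)
    (hx : (Finset.univ.filter fun e => Quotient.mk t e = x).card = 1) :
    ∫ ω, ∏ e, X (c e) ω ∂μ = 0 := by
  rw [h.integral_prod_eq_prod_classes c ht]
  refine Finset.prod_eq_zero (Finset.mem_univ x) ?_
  rw [hx]
  simpa using h.mean _

theorem card_class_pos {t : Setoid E} (x : Quotient t) :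
    0 < (Finset.univ.filter fun e => Quotient.mk t e = x).card :=
  Finset.card_pos.2 ⟨x.out, by simp⟩

omit [Fintype ι] in
-- The factor of the class `x` is bounded by `δ` in place of `κ`, the others by `κ`.
theorem abs_integral_prod_le_of_three (h : CenteredMoments μ X κ N) (hN : Fintype.card E ≤ N)
    (c : E → ι) {t : Setoid E} (ht : t = Setoid.ker c) {δ : ℝ}
    (hδ : ∀ p k, 3 ≤ k → k ≤ N → ∫ ω, |X p ω| ^ k ∂μ ≤ δ) (x : Quotient t)
    (hx : 3 ≤ (Finset.univ.filter fun e => Quotient.mk t e = x).card) :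
    |∫ ω, ∏ e, X (c e) ω ∂μ| ≤ δ * κ ^ (numClasses t - 1) := by
  have hk : ∀ y : Quotient t, (Finset.univ.filter fun e => Quotient.mk t e = y).card ≤ N :=
    fun y => (Finset.card_le_univ _).trans hN
  have h0 := h.nonneg
  rw [h.integral_prod_eq_prod_classes c ht, Finset.abs_prod,
    ← Finset.mul_prod_erase _ _ (Finset.mem_univ x)]
  have h1 : |∫ ω, X (c x.out) ω ^ (Finset.univ.filter fun e => Quotient.mk t e = x).card ∂μ| ≤ δ := by
    refine (abs_integral_le_integral_abs).trans ?_
    simp_rw [abs_pow]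
    exact hδ _ _ hx (hk x)
  refine mul_le_mul h1 ?_ (Finset.prod_nonneg fun _ _ => abs_nonneg _) ((abs_nonneg _).trans h1)
  refine (Finset.prod_le_prod (fun _ _ => abs_nonneg _) fun y _ =>
    (h.abs_moment_le _ (hk y)).trans (?_ : _ ≤ κ)).trans ?_
  · have := card_class_pos y
    unfold momentCap
    rw [if_neg (by omega)]
    split_ifs <;> simp [h0]
  · rw [Finset.prod_const, Finset.card_erase_of_mem (Finset.mem_univ _), Finset.card_univ,
      numClasses, Nat.card_eq_fintype_card]

end CenteredMoments

section expectation

variable {V E : Type u} [Fintype V] [Fintype E]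

theorem abs_sum_ker_mul_le {n : ℕ} (hn : 0 < n) (q : V → Fin n → ℝ) (s : Setoid V)
    {W : (V → Fin n) → ℝ} {B M : ℝ} (hW : ∀ i, Setoid.ker i = s → |W i| ≤ B)
    (hB : 0 ≤ B) (hM : momentSum q (Fintype.card V) ≤ M) :
    |(1 / (n : ℝ)) * ∑ i with Setoid.ker i = s, (∏ v, q v (i v)) * W i| ≤
      M * B * ((n : ℝ) ^ numClasses s / n) := by
  have hn' : (0 : ℝ) < n := by exact_mod_cast hn
  rw [abs_mul, abs_of_nonneg (by positivity : (0 : ℝ) ≤ 1 / n)]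
  calc _ ≤ (1 / (n : ℝ)) * ∑ i with Setoid.ker i = s, (∏ v, |q v (i v)|) * B := by
        refine mul_le_mul_of_nonneg_left ((Finset.abs_sum_le_sum_abs _ _).trans
          (Finset.sum_le_sum fun i hi => ?_)) (by positivity)
        rw [abs_mul, Finset.abs_prod]
        exact mul_le_mul_of_nonneg_left (hW i (Finset.mem_filter.1 hi).2)
          (Finset.prod_nonneg fun _ _ => abs_nonneg _)
    _ ≤ (1 / (n : ℝ)) * ((M * (n : ℝ) ^ numClasses s) * B) := by
        rw [← Finset.sum_mul]
        gcongr
        exact (sum_ker_prod_abs_le q s).trans (by gcongr)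
    _ = _ := by ring

/-- With one vertex class more than edge classes, the quotient graph without repeated edges is a
tree. Up to `O(1/n)` the sum is the tree average with edge weights `S n`, which factorizes
approximately into averages of block products; the singleton class supplies the vanishing one. -/
theorem tendsto_sum_ker_mul_prod_profile {u w : E → V} (hc : MConn u w) (s : Setoid V)
    {t : Setoid E} (ht : t = edgeSetoid u w s) (hst : numClasses s = numClasses t + 1)
    (q : ∀ n : ℕ, V → Fin n → ℝ) {M C : ℝ}
    (hM : ∀ᶠ n in atTop, momentSum (q n) (Fintype.card V) ≤ M)
    (S : ∀ n : ℕ, Fin n → Fin n → ℝ) (hsymm : ∀ᶠ n in atTop, ∀ i j, S n i j = S n j i)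
    (hSC : ∀ᶠ n in atTop, ∀ i j, |S n i j| ≤ C) (hC : 1 ≤ C) {ε : Quotient s → ℕ → ℝ}
    (hε : ∀ b, Tendsto (ε b) atTop (𝓝 0))
    (hQ : ∀ b, ∀ᶠ n in atTop, ∀ i, |empAvg (fun j => blockProd (q n) s b j * S n i j)
      - empAvg (blockProd (q n) s b)| ≤ ε b n)
    (v : V) (hv : ∀ x, s v x → x = v) (hqv : Tendsto (fun n => empAvg (q n v)) atTop (𝓝 0)) :
    Tendsto (fun n : ℕ => (1 / (n : ℝ)) * ∑ i : V → Fin n with Setoid.ker i = s,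
      (∏ v, q n v (i v)) * ∏ x : Quotient t, (S n (i (u x.out)) (i (w x.out)) / n)) atTop (𝓝 0) := by
  subst ht
  set r := numClasses (edgeSetoid u w s) with hr
  have hr' : Fintype.card (Quotient (edgeSetoid u w s)) = r := by
    rw [hr, numClasses, Nat.card_eq_fintype_card]
  have hs' : Fintype.card (Quotient s) = r + 1 := by
    rw [← hst, numClasses, Nat.card_eq_fintype_card]
  set M' : ℝ := (1 + Fintype.card V) * max 1 M with hM'
  have hM1 : 1 ≤ M' := by
    have h1 : (1 : ℝ) ≤ max 1 M := le_max_left _ _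
    have h2 : (0 : ℝ) ≤ Fintype.card V := Nat.cast_nonneg _
    nlinarith
  set η : ℕ → ℝ := fun n => ∑ b, |ε b n|
  have hη : Tendsto η atTop (𝓝 0) := by
    have := tendsto_finsetSum (Finset.univ : Finset (Quotient s)) fun b _ => (hε b).abs
    simpa using this
  have hlim : Tendsto (fun n : ℕ => (Fintype.card (Setoid V) * (C ^ r * max 1 M)) * (1 / (n : ℝ)) +
      (r * η n * (C * M') ^ r + |empAvg (q n v)| * M' ^ Fintype.card (Quotient s)))
      atTop (𝓝 0) := by
    have h1 := ((tendsto_one_div_atTop_nhds_zero_nat (𝕜 := ℝ)).const_mul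
      (Fintype.card (Setoid V) * (C ^ r * max 1 M))).add
      (((hη.const_mul (r : ℝ)).mul_const ((C * M') ^ r)).add
        (hqv.abs.mul_const (M' ^ Fintype.card (Quotient s))))
    simpa using h1
  refine squeeze_zero_norm' ?_ hlim
  filter_upwards [hM, hsymm, hSC, eventually_all.2 hQ, eventually_gt_atTop 0] with n hn hS hSn hQn hn0
  have hn0' : (0 : ℝ) < n := by exact_mod_cast hn0
  have hmom : momentSum (q n) (Fintype.card V) ≤ max 1 M := hn.trans (le_max_right _ _)
  set φ : (V → Fin n) → ℝ := fun i => (∏ v, q n v (i v)) *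
    ∏ x : Quotient (edgeSetoid u w s), S n (i (u x.out)) (i (w x.out)) with hφ
  -- The prefactor `1 / n` and one `1 / n` for each of the `r` edge classes form exactly the
  -- normalization for `r + 1` vertices.
  have hrew : (1 / (n : ℝ)) * ∑ i : V → Fin n with Setoid.ker i = s, (∏ v, q n v (i v)) *
      ∏ x : Quotient (edgeSetoid u w s), (S n (i (u x.out)) (i (w x.out)) / n) =
      ((n : ℝ) ^ (r + 1))⁻¹ * ∑ i with Setoid.ker i = s, φ i := by
    simp_rw [Finset.prod_div_distrib, Finset.prod_const, Finset.card_univ, hr', hφ, ← mul_div_assoc]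
    rw [← Finset.sum_div]
    field_simp
    ring
  have hφle : ∀ i, s ≤ Setoid.ker i → |φ i| ≤ C ^ r * ∏ v, |q n v (i v)| := by
    intro i _
    rw [hφ]
    dsimp only
    rw [abs_mul, Finset.abs_prod, Finset.abs_prod, mul_comm]
    refine mul_le_mul_of_nonneg_right ?_ (Finset.prod_nonneg fun _ _ => abs_nonneg _)
    refine (Finset.prod_le_prod (fun _ _ => abs_nonneg _) fun f _ => hSn _ _).trans ?_
    rw [Finset.prod_const, Finset.card_univ, hr']
  have hdiff := abs_sum_ker_sub_sum_le_ker_le (q n) s φ (by positivity : (0 : ℝ) ≤ C ^ r) hφle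
  have hgraph : ((n : ℝ) ^ (r + 1))⁻¹ * ∑ i with s ≤ Setoid.ker i, φ i =
      graphAvg (blockProd (q n) s) (S n)
        (fun x : Quotient (edgeSetoid u w s) => Quotient.mk s (u x.out))
        fun x => Quotient.mk s (w x.out) := by
    rw [graphAvg, hs', sum_le_ker, hφ]
    congr 1
    refine Finset.sum_congr (by ext; simp) fun j _ => ?_
    beta_reduce
    rw [prod_eq_prod_blockProd]
  have hM'0 : 0 ≤ M' := zero_le_one.trans hM1
  have hblock : ∀ b, (empAvg fun a => |blockProd (q n) s b a|) ≤ M' := fun b =>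
    (empAvg_abs_blockProd_le (q n) s b).trans (by rw [hM']; gcongr)
  have hη0 : 0 ≤ η n := Finset.sum_nonneg fun _ _ => abs_nonneg _
  have htree := abs_graphAvg_sub_le r (blockProd (q n) s) (S := S n) (ε := η n) hr' hs'
    (hc.quotient s).out hS hSn hC hblock hM'0 hη0 fun b i =>
      (hQn b i).trans ((le_abs_self _).trans
        (Finset.single_le_sum (f := fun b => |ε b n|) (fun _ _ => abs_nonneg _) (Finset.mem_univ b)))
  have hprod := abs_prod_le_mul_pow (fun b => empAvg (blockProd (q n) s b)) hM1 (fun b =>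
    (abs_empAvg_le _).trans (hblock b)) (Quotient.mk'' v)
  simp only [blockProd_of_singleton _ s v hv] at hprod
  rw [Real.norm_eq_abs, hrew]
  have h1 : |((n : ℝ) ^ (r + 1))⁻¹ * ∑ i with Setoid.ker i = s, φ i
      - ((n : ℝ) ^ (r + 1))⁻¹ * ∑ i with s ≤ Setoid.ker i, φ i| ≤
      (Fintype.card (Setoid V) * (C ^ r * max 1 M)) * (1 / (n : ℝ)) := by
    rw [← mul_sub, abs_mul, abs_of_nonneg (by positivity : (0 : ℝ) ≤ ((n : ℝ) ^ (r + 1))⁻¹),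
      inv_mul_le_iff₀ (by positivity), ← mul_le_mul_iff_right₀ hn0']
    refine hdiff.trans ?_
    rw [hst]
    calc _ ≤ Fintype.card (Setoid V) * (C ^ r * max 1 M) * (n : ℝ) ^ (r + 1) := by gcongr
      _ = _ := by field_simp
  rw [hgraph] at h1
  set A := ((n : ℝ) ^ (r + 1))⁻¹ * ∑ i with Setoid.ker i = s, φ i
  set P := ∏ b, empAvg (blockProd (q n) s b)
  set G := graphAvg (blockProd (q n) s) (S n)
        (fun x : Quotient (edgeSetoid u w s) => Quotient.mk s (u x.out))
        fun x => Quotient.mk s (w x.out)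
  calc |A| = |(A - G) + ((G - P) + P)| := by ring_nf
    _ ≤ |A - G| + (|G - P| + |P|) := (abs_add_le _ _).trans (by gcongr; exact abs_add_le _ _)
    _ ≤ _ := add_le_add h1 (add_le_add htree hprod)

variable {Ω : Type*} [MeasurableSpace Ω] {μ : Measure Ω} [IsProbabilityMeasure μ]

/-- For each kernel the multiplicities of the matrix entries decide: multiplicity one gives zero by
centring, too few vertex classes lose a factor `n`, multiplicity three or more gains `δ n`. Only
trees with every edge doubled remain, and these contain a vertex in a class of its own. -/
theorem tendsto_integral_netVal {u w : E → V} (hc : MConn u w)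
    (hcard : Fintype.card V = Fintype.card E + 1)
    (X : ∀ n : ℕ, {p : Fin n × Fin n // p.1 ≤ p.2} → Ω → ℝ) {C : ℝ} {N : ℕ} (hC : 1 ≤ C)
    (hX : ∀ᶠ n in atTop, CenteredMoments μ (X n) (C / n) N) (hN : Fintype.card E ≤ N)
    {δ : ℕ → ℝ} (hδ : Tendsto δ atTop (𝓝 0))
    (hthree : ∀ᶠ n in atTop, ∀ p k, 3 ≤ k → k ≤ N → ∫ ω, |X n p ω| ^ k ∂μ ≤ δ n / n)
    (S : ∀ n : ℕ, Fin n → Fin n → ℝ)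
    (hS : ∀ᶠ n in atTop, ∀ i j, ∫ ω, X n (pairIdx i j) ω ^ 2 ∂μ = S n i j / n)
    (hsymm : ∀ᶠ n in atTop, ∀ i j, S n i j = S n j i)
    (hSC : ∀ᶠ n in atTop, ∀ i j, |S n i j| ≤ C)
    (q : ∀ n : ℕ, V → Fin n → ℝ) {M : ℝ}
    (hM : ∀ᶠ n in atTop, momentSum (q n) (Fintype.card V) ≤ M)
    {ε : ∀ s : Setoid V, Quotient s → ℕ → ℝ} (hε : ∀ s b, Tendsto (ε s b) atTop (𝓝 0))
    (hQ : ∀ s b, ∀ᶠ n in atTop, ∀ i, |empAvg (fun j => blockProd (q n) s b j * S n i j)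
      - empAvg (blockProd (q n) s b)| ≤ ε s b n)
    (hq : ∀ v, Tendsto (fun n => empAvg (q n v)) atTop (𝓝 0)) :
    Tendsto (fun n => ∫ ω, netVal (q n) u w (fun p => X n p ω) ∂μ) atTop (𝓝 0) := by
  have hval : ∀ᶠ n : ℕ in atTop, ∑ s : Setoid V, (1 / (n : ℝ)) *
      ∑ i with Setoid.ker i = s, (∏ v, q n v (i v)) * ∫ ω, ∏ e, X n (edgeIdx u w i e) ω ∂μ =
      ∫ ω, netVal (q n) u w (fun p => X n p ω) ∂μ := by
    filter_upwards [hX] with n hn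
    rw [hn.integral_netVal hN, sum_eq_sum_ker, Finset.mul_sum]
  refine Tendsto.congr' hval ?_
  rw [← Finset.sum_const_zero (ι := Setoid V) (s := Finset.univ)]
  refine tendsto_finsetSum _ fun s _ => ?_
  have ht : ∀ {n : ℕ} (i : V → Fin n), Setoid.ker i = s →
      edgeSetoid u w s = Setoid.ker (edgeIdx u w i) := fun i hi => by rw [← edgeSetoid_ker, hi]
  set t := edgeSetoid u w s with htdef
  set r := numClasses t
  have hmr : numClasses s ≤ r + 1 := hc.numClasses_le s
  -- An entry that occurs exactly once: the expectation vanishes.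
  by_cases h1 : ∃ x : Quotient t, (Finset.univ.filter fun e => Quotient.mk t e = x).card = 1
  · obtain ⟨x, hx⟩ := h1
    refine tendsto_const_nhds.congr' ?_
    filter_upwards [hX] with n hn
    rw [Finset.sum_eq_zero, mul_zero]
    intro i hi
    rw [hn.integral_prod_eq_zero _ (ht i (Finset.mem_filter.1 hi).2) x hx, mul_zero]
  -- The quotient graph is not a tree: the contribution is `O(1/n)`.
  by_cases h2 : numClasses s ≤ r
  · have hlim : Tendsto (fun n : ℕ => M * C ^ r * (1 / (n : ℝ))) atTop (𝓝 0) := by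
      simpa using (tendsto_one_div_atTop_nhds_zero_nat (𝕜 := ℝ)).const_mul (M * C ^ r)
    refine squeeze_zero_norm' ?_ hlim
    filter_upwards [hX, hM, eventually_gt_atTop 0] with n hn hMn hn0
    have hn0' : (0 : ℝ) < n := by exact_mod_cast hn0
    have hM0 : 0 ≤ M := zero_le_one.trans ((one_le_momentSum _ _).trans hMn)
    refine (abs_sum_ker_mul_le hn0 (q n) s (B := (C / n) ^ r) (fun i hi =>
      hn.abs_integral_prod_le_pow hN _ (ht i hi)) (by positivity) hMn).trans ?_
    calc M * (C / n) ^ r * ((n : ℝ) ^ numClasses s / n)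
        ≤ M * (C / n) ^ r * ((n : ℝ) ^ r / n) := by
          gcongr
          exact_mod_cast hn0
      _ = _ := by rw [div_pow]; field_simp
  -- An entry of multiplicity at least three replaces one factor `C / n` by `δ n / n`.
  by_cases h3 : ∃ x : Quotient t, 3 ≤ (Finset.univ.filter fun e => Quotient.mk t e = x).card
  · obtain ⟨x, hx⟩ := h3
    have hr1 : r - 1 + 1 = r := by
      have : 0 < r := by
        change 0 < Nat.card (Quotient t)
        rw [Nat.card_eq_fintype_card]
        exact Fintype.card_pos_iff.2 ⟨x⟩
      omega
    have hlim : Tendsto (fun n : ℕ => M * C ^ (r - 1) * |δ n|) atTop (𝓝 0) := by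
      simpa using hδ.abs.const_mul (M * C ^ (r - 1))
    refine squeeze_zero_norm' ?_ hlim
    filter_upwards [hX, hM, hthree, eventually_gt_atTop 0] with n hn hMn h3n hn0
    have hn0' : (0 : ℝ) < n := by exact_mod_cast hn0
    have hM0 : 0 ≤ M := zero_le_one.trans ((one_le_momentSum _ _).trans hMn)
    refine (abs_sum_ker_mul_le hn0 (q n) s (B := |δ n| / n * (C / n) ^ (r - 1)) (fun i hi =>
      hn.abs_integral_prod_le_of_three hN _ (ht i hi) (fun p k hk hk' => (h3n p k hk hk').trans
        (div_le_div_of_nonneg_right (le_abs_self _) hn0'.le)) x hx) (by positivity) hMn).trans ?_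
    calc M * (|δ n| / n * (C / n) ^ (r - 1)) * ((n : ℝ) ^ numClasses s / n)
        ≤ M * (|δ n| / n * (C / n) ^ (r - 1)) * ((n : ℝ) ^ (r + 1) / n) := by
          gcongr
          exact_mod_cast hn0
      _ = M * (|δ n| / n * (C ^ (r - 1) / (n : ℝ) ^ (r - 1))) *
          ((n : ℝ) ^ (r - 1) * n * n / n) := by
          rw [div_pow, ← pow_succ, hr1, ← pow_succ]
      _ = _ := by field_simp
  · push Not at h1 h3
    have htwo : ∀ x : Quotient t, (Finset.univ.filter fun e => Quotient.mk t e = x).card = 2 := by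
      intro x
      have := CenteredMoments.card_class_pos x
      have := h1 x
      have := h3 x
      omega
    have hst : numClasses s = r + 1 := by omega
    have hE : Fintype.card E = r * 2 := by
      rw [← Finset.card_univ, Finset.card_eq_sum_card_fiberwise (f := fun e => Quotient.mk t e)
        (t := Finset.univ) fun _ _ => Finset.mem_coe.2 (Finset.mem_univ _), Finset.sum_congr rfl
        fun x _ => htwo x, Finset.sum_const, smul_eq_mul, Finset.card_univ]
      change _ = Nat.card (Quotient t) * 2
      rw [Nat.card_eq_fintype_card]
    -- Otherwise `2 * (r + 1) ≤ |V|`, whereas `|V| = |E| + 1 = 2 * r + 1`.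
    have hsing : ∃ v, ∀ x, s v x → x = v := by
      by_contra! hcon
      have := two_mul_numClasses_le s fun v => (hcon v).imp fun w hw => ⟨hw.2, hw.1⟩
      omega
    obtain ⟨v, hv⟩ := hsing
    refine (tendsto_sum_ker_mul_prod_profile hc s htdef hst q hM S hsymm hSC hC (hε s) (hQ s) v hv
      (hq v)).congr' ?_
    filter_upwards [hX, hS] with n hn hSn
    congr 1
    refine Finset.sum_congr rfl fun i hi => ?_
    rw [hn.integral_prod_eq_prod_classes _ (ht i (Finset.mem_filter.1 hi).2)]
    congr 1
    refine Finset.prod_congr rfl fun x _ => ?_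
    rw [htwo x, ← hSn]
    rfl

end expectation

/-! ### Almost sure convergence from fourth moments -/

section borelCantelli

variable {Ω : Type*} [MeasurableSpace Ω] {μ : Measure Ω} [IsProbabilityMeasure μ]

omit [IsProbabilityMeasure μ] in
-- The fourth moments are summable from some index on, so the sum of the fourth powers is finite
-- almost surely and its terms tend to zero.
theorem ae_tendsto_zero_of_lintegral_pow_four (f : ℕ → Ω → ℝ) (hf : ∀ n, Measurable (f n)) {C : ℝ}
    (h : ∀ᶠ n : ℕ in atTop, ∫⁻ ω, ENNReal.ofReal (f n ω ^ 4) ∂μ ≤ ENNReal.ofReal (C / n ^ 2)) :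
    ∀ᵐ ω ∂μ, Tendsto (fun n => f n ω) atTop (𝓝 0) := by
  obtain ⟨n0, hn0⟩ := eventually_atTop.1 h
  have hsum : ∑' n, ∫⁻ ω, ENNReal.ofReal (f (n + n0) ω ^ 4) ∂μ ≠ ⊤ := by
    refine ne_top_of_le_ne_top ?_ (ENNReal.tsum_le_tsum fun n => hn0 (n + n0) (Nat.le_add_left _ _))
    have h1 : Summable fun n : ℕ => |C| / (n : ℝ) ^ 2 := by
      simpa [div_eq_mul_inv] using (Real.summable_nat_pow_inv.2 one_lt_two).mul_left |C|
    have h2 : Summable fun n : ℕ => |C| / ((n + n0 : ℕ) : ℝ) ^ 2 := (summable_nat_add_iff n0).2 h1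
    refine ne_top_of_le_ne_top h2.tsum_ofReal_ne_top (ENNReal.tsum_le_tsum fun n => ?_)
    exact ENNReal.ofReal_le_ofReal (div_le_div_of_nonneg_right (le_abs_self _) (by positivity))
  rw [← lintegral_tsum fun n => ((hf _).pow_const 4).ennreal_ofReal.aemeasurable] at hsum
  have hae := ae_lt_top' (AEMeasurable.tsum fun n =>
    ((hf _).pow_const 4).ennreal_ofReal.aemeasurable) hsum
  filter_upwards [hae] with ω hω
  have h3 := ENNReal.tendsto_atTop_zero_of_tsum_ne_top hω.ne
  have h4 : Tendsto (fun n => f (n + n0) ω ^ 4) atTop (𝓝 0) := by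
    have := (ENNReal.tendsto_toReal ENNReal.zero_ne_top).comp h3
    refine (this.congr fun n => ?_)
    simp only [Function.comp_apply]
    rw [ENNReal.toReal_ofReal (by positivity)]
  rw [← tendsto_add_atTop_iff_nat n0]
  have h5 : Tendsto (fun n => |f (n + n0) ω|) atTop (𝓝 0) := by
    have h6 := (Real.continuous_sqrt.tendsto 0).comp h4
    rw [Real.sqrt_zero] at h6
    have := (Real.continuous_sqrt.tendsto 0).comp h6
    rw [Real.sqrt_zero] at this
    refine this.congr fun n => ?_
    simp only [Function.comp_apply]
    rw [show f (n + n0) ω ^ 4 = (f (n + n0) ω ^ 2) ^ 2 by ring, Real.sqrt_sq (by positivity),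
      Real.sqrt_sq_eq_abs]
  exact (tendsto_zero_iff_abs_tendsto_zero _).2 h5

/-- Conditional fourth moments of order `n⁻²`, locally uniform in the condition `Y n`, yield almost
sure convergence. -/
theorem ae_tendsto_zero_of_conditional {α β : ℕ → Type*} [∀ n, MeasurableSpace (α n)]
    [∀ n, MeasurableSpace (β n)] {Z : ∀ n, Ω → α n} {Y : ∀ n, Ω → β n} (hZ : ∀ n, Measurable (Z n))
    (hY : ∀ n, Measurable (Y n)) (hind : ∀ n, IndepFun (Z n) (Y n) μ) {f : ∀ n, α n → β n → ℝ}
    (hf : ∀ n, Measurable fun p : α n × β n => f n p.1 p.2) {G : ℕ → ∀ n, Set (β n)}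
    (hG : ∀ M n, MeasurableSet (G M n))
    (hbound : ∀ M, ∃ C : ℝ, ∀ᶠ n : ℕ in atTop, ∀ y ∈ G M n,
      ∫⁻ ω, ENNReal.ofReal (f n (Z n ω) y ^ 4) ∂μ ≤ ENNReal.ofReal (C / n ^ 2))
    (hgood : ∀ᵐ ω ∂μ, ∃ M, ∀ᶠ n in atTop, Y n ω ∈ G M n) :
    ∀ᵐ ω ∂μ, Tendsto (fun n => f n (Z n ω) (Y n ω)) atTop (𝓝 0) := by
  -- The indicator of `G M n` makes the conditional bound hold for every value of `Y n`, so Fubini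
  -- for the independent pair applies. Countably many `M` cover almost every point.
  have key : ∀ M, ∀ᵐ ω ∂μ, Tendsto (fun n => (G M n).indicator 1 (Y n ω) * f n (Z n ω) (Y n ω))
      atTop (𝓝 0) := by
    intro M
    obtain ⟨C, hC⟩ := hbound M
    have hmeas : ∀ n, Measurable fun p : α n × β n =>
        (G M n).indicator (1 : β n → ℝ) p.2 * f n p.1 p.2 := fun n =>
      ((measurable_one.indicator (hG M n)).comp measurable_snd).mul (hf n)
    refine ae_tendsto_zero_of_lintegral_pow_four (C := C) _
      (fun n => (hmeas n).comp ((hZ n).prodMk (hY n))) ?_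
    filter_upwards [hC] with n hn
    have hp : IsProbabilityMeasure (μ.map (Y n)) := Measure.isProbabilityMeasure_map (hY n).aemeasurable
    have hp' : IsProbabilityMeasure (μ.map (Z n)) := Measure.isProbabilityMeasure_map (hZ n).aemeasurable
    have hm4 : Measurable fun p : α n × β n =>
        ENNReal.ofReal (((G M n).indicator (1 : β n → ℝ) p.2 * f n p.1 p.2) ^ 4) :=
      ((hmeas n).pow_const 4).ennreal_ofReal
    calc ∫⁻ ω, ENNReal.ofReal (((G M n).indicator 1 (Y n ω) * f n (Z n ω) (Y n ω)) ^ 4) ∂μ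
        = ∫⁻ p, ENNReal.ofReal (((G M n).indicator (1 : β n → ℝ) p.2 * f n p.1 p.2) ^ 4)
            ∂(μ.map fun ω => (Z n ω, Y n ω)) := (lintegral_map hm4 ((hZ n).prodMk (hY n))).symm
      _ = ∫⁻ y, ∫⁻ z, ENNReal.ofReal (((G M n).indicator (1 : β n → ℝ) y * f n z y) ^ 4)
            ∂(μ.map (Z n)) ∂(μ.map (Y n)) := by
          rw [(indepFun_iff_map_prod_eq_prod_map_map (hZ n).aemeasurable (hY n).aemeasurable).1
            (hind n), lintegral_prod_symm' _ hm4]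
      _ ≤ ∫⁻ _, ENNReal.ofReal (C / n ^ 2) ∂(μ.map (Y n)) := by
          refine lintegral_mono fun y => ?_
          by_cases hy : y ∈ G M n
          · simp only [Set.indicator_of_mem hy, Pi.one_apply, one_mul]
            have hfy : Measurable fun z => f n z y :=
              (hf n).comp (measurable_id.prodMk measurable_const)
            rw [lintegral_map (hfy.pow_const 4).ennreal_ofReal (hZ n)]
            exact hn y hy
          · simp [Set.indicator_of_notMem hy]
      _ = _ := by simp
  filter_upwards [ae_all_iff.2 key, hgood] with ω hω hgω
  obtain ⟨M, hM⟩ := hgω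
  refine (hω M).congr' ?_
  filter_upwards [hM] with n hn
  simp [Set.indicator_of_mem hn]

end borelCantelli

/-! ### Polynomial rows and networks on trees -/

section polynomial

variable {k : ℕ}

theorem exists_abs_eval_le (q : MvPolynomial (Fin k) ℝ) : ∃ p : ℕ, ∃ C : ℝ, 0 < C ∧
    ∀ v : EuclideanSpace ℝ (Fin k), |MvPolynomial.eval (fun j => v j) q| ≤ C * (1 + ‖v‖) ^ p := by
  induction q using MvPolynomial.induction_on with
  | C a => exact ⟨0, |a| + 1, by positivity, fun v => by simp⟩
  | add q r hq hr =>
    obtain ⟨p, C, hC, h⟩ := hq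
    obtain ⟨p', C', hC', h'⟩ := hr
    refine ⟨max p p', C + C', by positivity, fun v => ?_⟩
    have h1 : 1 ≤ 1 + ‖v‖ := by linarith [norm_nonneg v]
    rw [map_add, add_mul]
    refine (abs_add_le _ _).trans (add_le_add ((h v).trans ?_) ((h' v).trans ?_))
    · gcongr
      exact le_max_left _ _
    · gcongr
      exact le_max_right _ _
  | mul_X q j hq =>
    obtain ⟨p, C, hC, h⟩ := hq
    refine ⟨p + 1, C, hC, fun v => ?_⟩
    rw [map_mul, MvPolynomial.eval_X, abs_mul, pow_succ, ← mul_assoc]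
    have h1 : |v j| ≤ 1 + ‖v‖ := (PiLp.norm_apply_le v j).trans (by linarith)
    exact mul_le_mul (h v) h1 (abs_nonneg _) (by positivity)

theorem continuous_eval_apply (q : MvPolynomial (Fin k) ℝ) :
    Continuous fun v : EuclideanSpace ℝ (Fin k) => MvPolynomial.eval (fun j => v j) q :=
  (MvPolynomial.continuous_eval q).comp (PiLp.continuous_ofLp 2 _)

theorem measurable_polyRow {n : ℕ} (q : MvPolynomial (Fin k) ℝ) (i : Fin n) :
    Measurable fun y : Fin n → EuclideanSpace ℝ (Fin k) => polyRow q y i :=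
  (continuous_eval_apply q).measurable.comp (measurable_pi_apply i)

variable {y : ∀ n : ℕ, Fin n → EuclideanSpace ℝ (Fin k)}
  {ν : Measure (EuclideanSpace ℝ (Fin k))}

theorem WassersteinTendsto.exists_tendsto_abs_pow (h : WassersteinTendsto y ν)
    (q : MvPolynomial (Fin k) ℝ) (m : ℕ) :
    ∃ L, Tendsto (fun n => empAvg fun i => |polyRow q (y n) i| ^ m) atTop (𝓝 L) := by
  obtain ⟨p, C, hC, hp⟩ := exists_abs_eval_le (q ^ m)
  -- The exponent is raised by one because test functions are admitted only with growth exponent at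
  -- least one.
  refine ⟨_, h (p + 1) (Nat.le_add_left _ _)
    (fun v => |MvPolynomial.eval (fun j => v j) q| ^ m)
    ((continuous_eval_apply q).abs.pow m) ⟨C * 2 ^ p, by positivity, fun v => ?_⟩⟩
  rw [abs_pow, abs_abs, ← abs_pow, ← map_pow]
  have h1 : (1 + ‖v‖) ^ p ≤ (1 + ‖v‖) ^ (p + 1) :=
    pow_le_pow_right₀ (by linarith [norm_nonneg v]) (Nat.le_succ p)
  have h2 := add_pow_le (zero_le_one' ℝ) (norm_nonneg v) (p + 1)
  rw [Nat.add_sub_cancel, one_pow] at h2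
  calc _ ≤ C * (1 + ‖v‖) ^ p := hp v
    _ ≤ C * (2 ^ p * (1 + ‖v‖ ^ (p + 1))) := by gcongr; exact h1.trans h2
    _ = _ := by ring

theorem WassersteinTendsto.exists_tendsto (h : WassersteinTendsto y ν)
    (q : MvPolynomial (Fin k) ℝ) :
    ∃ L, Tendsto (fun n => empAvg (polyRow q (y n))) atTop (𝓝 L) := by
  obtain ⟨p, C, hC, hp⟩ := exists_abs_eval_le q
  refine ⟨_, h (p + 1) (Nat.le_add_left _ _)
    (fun v => MvPolynomial.eval (fun j => v j) q)
    (continuous_eval_apply q) ⟨C * 2 ^ p, by positivity, fun v => ?_⟩⟩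
  have h1 : (1 + ‖v‖) ^ p ≤ (1 + ‖v‖) ^ (p + 1) :=
    pow_le_pow_right₀ (by linarith [norm_nonneg v]) (Nat.le_succ p)
  have h2 := add_pow_le (zero_le_one' ℝ) (norm_nonneg v) (p + 1)
  rw [Nat.add_sub_cancel, one_pow] at h2
  calc _ ≤ C * (1 + ‖v‖) ^ p := hp v
    _ ≤ C * (2 ^ p * (1 + ‖v‖ ^ (p + 1))) := by gcongr; exact h1.trans h2
    _ = _ := by ring

theorem exists_eventually_le_of_tendsto {f : ℕ → ℝ} (h : ∃ L, Tendsto f atTop (𝓝 L)) :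
    ∃ M : ℕ, ∀ᶠ n in atTop, f n ≤ M := by
  obtain ⟨L, hL⟩ := h
  obtain ⟨M, hM⟩ := exists_nat_gt L
  exact ⟨M, (hL.eventually_lt_const hM).mono fun _ h => h.le⟩

theorem WassersteinTendsto.exists_momentSum_le (h : WassersteinTendsto y ν) {A : Type*} [Fintype A]
    (q : A → MvPolynomial (Fin k) ℝ) (N : ℕ) :
    ∃ M : ℕ, ∀ᶠ n in atTop, momentSum (fun a => polyRow (q a) (y n)) N ≤ M := by
  choose L hL using fun a => h.exists_tendsto_abs_pow (q a) N
  exact exists_eventually_le_of_tendsto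
    ⟨_, tendsto_const_nhds.add (tendsto_finsetSum Finset.univ fun a _ => hL a)⟩

theorem measurable_empAvg {α : Type*} [MeasurableSpace α] {n : ℕ} {f : α → Fin n → ℝ}
    (hf : ∀ i, Measurable fun a => f a i) : Measurable fun a => empAvg (f a) :=
  (Finset.measurable_sum _ fun i _ => hf i).const_mul _

theorem measurable_momentSum {α : Type*} [MeasurableSpace α] {n : ℕ} {A : Type*} [Fintype A]
    {q : α → A → Fin n → ℝ} (hq : ∀ v i, Measurable fun a => q a v i) (N : ℕ) :
    Measurable fun a => momentSum (q a) N :=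
  measurable_const.add (Finset.measurable_sum _ fun v _ => measurable_empAvg fun i =>
    (hq v i).abs.pow_const N)

/-- Identifying vertices multiplies their polynomials. For this reason the condition on the variance
profile is needed for all polynomials and not just for the labels of the network. -/
theorem blockProd_polyRow {V : Type*} [Fintype V] {n : ℕ} (q : V → MvPolynomial (Fin k) ℝ)
    (s : Setoid V) (b : Quotient s) (x : Fin n → EuclideanSpace ℝ (Fin k)) :
    blockProd (fun v => polyRow (q v) x) s b = polyRow (∏ v with Quotient.mk'' v = b, q v) x := by
  funext i
  simp only [blockProd, polyRow, map_prod]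

end polynomial

namespace DiagonalTensorNetwork

variable {V : Type u} [Fintype V] {k : ℕ} (T : DiagonalTensorNetwork V k)

/-- The first end point of an edge. -/
def fst (e : T.graph.edgeSet) : V := (Quot.out e.1).1

/-- The second end point of an edge. -/
def snd (e : T.graph.edgeSet) : V := (Quot.out e.1).2

omit [Fintype V] in
theorem mk_fst_snd (e : T.graph.edgeSet) : s(T.fst e, T.snd e) = e.1 := Quot.out_eq e.1

omit [Fintype V] in
theorem mConn : MConn T.fst T.snd := by
  intro φ hφ x y
  have hadj : ∀ a b, T.graph.Adj a b → φ a → φ b := by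
    intro a b hab
    have h1 := hφ ⟨s(a, b), hab⟩
    rcases Sym2.eq_iff.1 (T.mk_fst_snd ⟨s(a, b), hab⟩) with ⟨h2, h3⟩ | ⟨h2, h3⟩ <;>
      rw [h2, h3] at h1
    · exact h1.1
    · exact h1.2
  obtain ⟨p⟩ := T.isTree.connected.preconnected x y
  induction p with
  | nil => exact id
  | cons h _ ih => exact fun hx => ih (hadj _ _ h hx)

theorem card_eq : Fintype.card V = Fintype.card T.graph.edgeSet + 1 := by
  rw [← T.isTree.card_edgeFinset, SimpleGraph.edgeFinset_card]

omit [Fintype V] in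
theorem nonempty (T : DiagonalTensorNetwork V k) : Nonempty V := T.isTree.connected.nonempty

theorem val_eq {n : ℕ} (A : Matrix (Fin n) (Fin n) ℝ) (x : Fin n → EuclideanSpace ℝ (Fin k)) :
    T.val A x = (1 / (n : ℝ)) * ∑ i : V → Fin n, (∏ v, polyRow (T.q v) x (i v)) *
      ∏ e : T.graph.edgeSet, A (i (T.fst e)) (i (T.snd e)) := by
  unfold val
  congr 1
  refine Finset.sum_congr (by ext; simp) fun i _ => ?_
  congr 1
  exact Finset.prod_subtype _ (fun e => SimpleGraph.mem_edgeFinset) (fun e => edgeEntry A i e)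

theorem val_eq_netVal {n : ℕ} {A : Matrix (Fin n) (Fin n) ℝ} (hA : A.IsSymm)
    (x : Fin n → EuclideanSpace ℝ (Fin k)) : T.val A x =
      netVal (fun v => polyRow (T.q v) x) T.fst T.snd fun p => A p.1.1 p.1.2 := by
  rw [val_eq, netVal]
  congr 1
  refine Finset.sum_congr rfl fun i _ => ?_
  congr 1
  refine Finset.prod_congr rfl fun e _ => ?_
  rcases le_total (i (T.fst e)) (i (T.snd e)) with h | h
  · simp [edgeIdx, pairIdx, h]
  · simp only [edgeIdx, pairIdx, min_eq_right h, max_eq_left h]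
    exact hA.apply _ _

end DiagonalTensorNetwork

/-! ### Generalized Wigner matrices -/

theorem le_ciSup_fin {n : ℕ} (f : Fin n → ℝ) (i : Fin n) : f i ≤ ⨆ j, f j :=
  le_ciSup (Set.finite_range f).bddAbove i

namespace IsGeneralizedWigner

variable {Ω : Type*} [MeasurableSpace Ω] {μ : Measure Ω} [IsProbabilityMeasure μ]
  {W : ∀ n : ℕ, Ω → Matrix (Fin n) (Fin n) ℝ} {S : ∀ n : ℕ, Matrix (Fin n) (Fin n) ℝ}

omit [IsProbabilityMeasure μ] in
theorem measurable_entry (h : IsGeneralizedWigner μ W S) (n : ℕ) (i j : Fin n) :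
    Measurable fun ω => W n ω i j :=
  (measurable_pi_apply j).comp ((measurable_pi_apply i).comp (h.measurable n))

omit [IsProbabilityMeasure μ] in
theorem integral_sq (h : IsGeneralizedWigner μ W S) (n : ℕ) (i j : Fin n) :
    ∫ ω, W n ω i j ^ 2 ∂μ = S n i j / n := by
  rw [← h.variance, variance_of_integral_eq_zero (h.measurable_entry n i j).aemeasurable
    (h.mean n i j)]

omit [IsProbabilityMeasure μ] in
theorem profile_nonneg (h : IsGeneralizedWigner μ W S) (n : ℕ) (i j : Fin n) : 0 ≤ S n i j := by
  have hn : (0 : ℝ) < n := by exact_mod_cast (Fin.pos i)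
  have h1 := variance_nonneg (fun ω => W n ω i j) μ
  rw [h.variance] at h1
  by_contra! hcon
  exact absurd h1 (not_le.2 (div_neg_of_neg_of_pos hcon hn))

omit [IsProbabilityMeasure μ] in
theorem profile_symm (h : IsGeneralizedWigner μ W S) (n : ℕ) (i j : Fin n) :
    S n i j = S n j i := by
  have hn : (n : ℝ) ≠ 0 := by exact_mod_cast (Fin.pos i).ne'
  have h1 : (fun ω => W n ω i j) =ᵐ[μ] fun ω => W n ω j i := by
    filter_upwards [h.symm n] with ω hω
    exact hω.apply _ _
  have h2 := variance_congr h1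
  rw [h.variance, h.variance] at h2
  field_simp at h2
  exact h2

/-- The supremum of the absolute moments of order `p`, multiplied by the dimension. -/
def momentSup {Ω : Type*} [MeasurableSpace Ω] (μ : Measure Ω)
    (W : ∀ n : ℕ, Ω → Matrix (Fin n) (Fin n) ℝ) (p n : ℕ) : ℝ≥0∞ :=
  n * ⨆ i : Fin n, ⨆ j : Fin n, ∫⁻ ω, ‖W n ω i j‖ₑ ^ p ∂μ

omit [IsProbabilityMeasure μ] in
theorem mul_lintegral_le_momentSup (p n : ℕ) (i j : Fin n) :
    n * ∫⁻ ω, ‖W n ω i j‖ₑ ^ p ∂μ ≤ momentSup μ W p n := by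
  unfold momentSup
  gcongr
  exact le_iSup₂ (f := fun i j => ∫⁻ ω, ‖W n ω i j‖ₑ ^ p ∂μ) i j

omit [IsProbabilityMeasure μ] in
theorem integral_abs_pow (h : IsGeneralizedWigner μ W S) (p n : ℕ) (i j : Fin n) :
    ∫ ω, |W n ω i j| ^ p ∂μ = (∫⁻ ω, ‖W n ω i j‖ₑ ^ p ∂μ).toReal := by
  rw [integral_eq_lintegral_of_nonneg_ae (Eventually.of_forall fun ω => by positivity)
    ((h.measurable_entry n i j).abs.pow_const p).aestronglyMeasurable]
  congr 2 with ω
  rw [ENNReal.ofReal_pow (abs_nonneg _), Real.enorm_eq_ofReal_abs]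

omit [IsProbabilityMeasure μ] in
theorem integral_abs_pow_le (h : IsGeneralizedWigner μ W S) {p n : ℕ}
    (hfin : momentSup μ W p n ≠ ⊤) (i j : Fin n) :
    ∫ ω, |W n ω i j| ^ p ∂μ ≤ (momentSup μ W p n).toReal / n := by
  have hn : (0 : ℝ) < n := by exact_mod_cast (Fin.pos i)
  rw [h.integral_abs_pow, le_div_iff₀ hn, mul_comm]
  have := ENNReal.toReal_mono hfin (mul_lintegral_le_momentSup p n i j)
  rwa [ENNReal.toReal_mul, ENNReal.toReal_natCast] at this

theorem integrable_abs_pow (h : IsGeneralizedWigner μ W S) {p n : ℕ}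
    (hp : 3 ≤ p → momentSup μ W p n ≠ ⊤) (i j : Fin n) :
    Integrable (fun ω => |W n ω i j| ^ p) μ := by
  by_cases h3 : 3 ≤ p
  · have hn : (n : ℝ≥0∞) ≠ 0 := by exact_mod_cast (Fin.pos i).ne'
    refine ⟨((h.measurable_entry n i j).abs.pow_const p).aestronglyMeasurable, ?_⟩
    have h1 := ne_top_of_le_ne_top (hp h3) (mul_lintegral_le_momentSup p n i j)
    have h2 : ∫⁻ ω, ‖W n ω i j‖ₑ ^ p ∂μ ≠ ⊤ := fun h' => h1 (by rw [h', ENNReal.mul_top hn])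
    rw [hasFiniteIntegral_iff_enorm]
    refine lt_of_eq_of_lt (lintegral_congr fun ω => ?_) h2.lt_top
    rw [enorm_pow, Real.enorm_abs]
  · rcases Nat.eq_zero_or_pos p with rfl | hp0
    · simp
    · have h1 : MemLp (fun ω => W n ω i j) (p : ℝ≥0∞) μ :=
        (h.memLp_two n i j).mono_exponent (by exact_mod_cast (by omega : p ≤ 2))
      exact h1.integrable_norm_pow hp0.ne'

/-- Second moments are at most `C / n` by the bounded profile. Higher ones are at most `δ n / n`,
where `δ n` sums `n` times the maximal moments of the orders `3, …, N`. -/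
theorem exists_centeredMoments (h : IsGeneralizedWigner μ W S) (N : ℕ) :
    ∃ C : ℝ, 1 ≤ C ∧ (∀ n i j, |S n i j| ≤ C) ∧ ∃ δ : ℕ → ℝ, Tendsto δ atTop (𝓝 0) ∧
      ∀ᶠ n : ℕ in atTop,
        CenteredMoments μ (fun (p : {p : Fin n × Fin n // p.1 ≤ p.2}) ω => W n ω p.1.1 p.1.2)
          (C / n) N ∧
        ∀ (p : {p : Fin n × Fin n // p.1 ≤ p.2}) k, 3 ≤ k → k ≤ N →
          ∫ ω, |W n ω p.1.1 p.1.2| ^ k ∂μ ≤ δ n / n := by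
  obtain ⟨C₀, hC₀, hS⟩ := h.profile_bounded
  set C := max 1 C₀
  have hC : 1 ≤ C := le_max_left _ _
  refine ⟨C, hC, fun n i j => ?_, fun n => ∑ k ∈ Finset.Icc 3 N, (momentSup μ W k n).toReal, ?_, ?_⟩
  · rw [abs_of_nonneg (h.profile_nonneg n i j)]
    exact (hS n i j).trans (le_max_right _ _)
  · rw [← Finset.sum_const_zero (ι := ℕ) (s := Finset.Icc 3 N)]
    refine tendsto_finsetSum _ fun k hk => ?_
    exact (ENNReal.tendsto_toReal ENNReal.zero_ne_top).comp (h.moments k (Finset.mem_Icc.1 hk).1)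
  · have hsmall : ∀ᶠ n in atTop, ∀ k ∈ Finset.Icc 3 N, momentSup μ W k n < 1 :=
      (Finset.eventually_all _).2 fun k hk =>
        (h.moments k (Finset.mem_Icc.1 hk).1).eventually_lt_const one_pos
    filter_upwards [hsmall, eventually_ge_atTop ⌈C⌉₊, eventually_gt_atTop 0] with n hn hnC hn0
    have hn' : (0 : ℝ) < n := by exact_mod_cast hn0
    have hfin : ∀ k, 3 ≤ k → k ≤ N → momentSup μ W k n ≠ ⊤ := fun k hk hk' =>
      ((hn k (Finset.mem_Icc.2 ⟨hk, hk'⟩)).trans ENNReal.one_lt_top).ne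
    refine ⟨⟨fun p => h.measurable_entry n _ _, h.indep n,
      fun p k hk => h.integrable_abs_pow (fun hk3 => hfin k hk3 hk) _ _, fun p => h.mean n _ _,
      by positivity, ?_, fun p k hk hkN => ?_⟩, fun p k hk hkN => ?_⟩
    · rw [div_le_one hn']
      exact (Nat.le_ceil C).trans (by exact_mod_cast hnC)
    · rcases Nat.lt_or_ge k 3 with hk3 | hk3
      · have : k = 2 := by omega
        subst this
        simp_rw [sq_abs]
        rw [h.integral_sq]
        gcongr
        exact (hS n _ _).trans (le_max_right _ _)
      · refine (h.integral_abs_pow_le (hfin k hk3 hkN) _ _).trans ?_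
        gcongr
        refine le_trans ?_ hC
        have := ENNReal.toReal_mono ENNReal.one_ne_top (hn k (Finset.mem_Icc.2 ⟨hk3, hkN⟩)).le
        simpa using this
    · refine (h.integral_abs_pow_le (hfin k hk hkN) _ _).trans ?_
      gcongr
      exact Finset.single_le_sum (f := fun k => (momentSup μ W k n).toReal)
        (fun _ _ => ENNReal.toReal_nonneg) (Finset.mem_Icc.2 ⟨hk, hkN⟩)

end IsGeneralizedWigner

/-! ### Almost sure limits of networks of generalized Wigner matrices -/

section network

variable {Ω : Type*} [MeasurableSpace Ω] {μ : Measure Ω} [IsProbabilityMeasure μ] {k : ℕ}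
  {x : ∀ n : ℕ, Ω → Fin n → EuclideanSpace ℝ (Fin k)} {νX : Measure (EuclideanSpace ℝ (Fin k))}
  {V E : Type u} [Fintype V] [Fintype E] {u w : E → V} (q : V → MvPolynomial (Fin k) ℝ)
  {W : ∀ n : ℕ, Ω → Matrix (Fin n) (Fin n) ℝ} {S : ∀ n : ℕ, Matrix (Fin n) (Fin n) ℝ}

/-- The value of a network with the products of the matrix entries replaced by weights. -/
def weightVal {n : ℕ} (m : (V → Fin n) → ℝ) (y : Fin n → EuclideanSpace ℝ (Fin k)) : ℝ :=
  (1 / (n : ℝ)) * ∑ i : V → Fin n, (∏ v, polyRow (q v) y (i v)) * m i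

theorem measurable_weightVal {n : ℕ} (m : (V → Fin n) → ℝ) : Measurable (weightVal q m) :=
  (Finset.measurable_sum _ fun _ _ => (Finset.measurable_prod _ fun v _ =>
    measurable_polyRow (q v) _).mul_const _).const_mul _

theorem measurable_netVal {n : ℕ} (u w : E → V) : Measurable fun p : Matrix (Fin n) (Fin n) ℝ ×
    (Fin n → EuclideanSpace ℝ (Fin k)) =>
      netVal (fun v => polyRow (q v) p.2) u w fun r => p.1 r.1.1 r.1.2 := by
  have hz : ∀ i j : Fin n, Measurable fun p : Matrix (Fin n) (Fin n) ℝ ×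
      (Fin n → EuclideanSpace ℝ (Fin k)) => p.1 i j := fun i j =>
    (measurable_pi_apply j).comp ((measurable_pi_apply i).comp measurable_fst)
  have hq : ∀ v i, Measurable fun p : Matrix (Fin n) (Fin n) ℝ ×
      (Fin n → EuclideanSpace ℝ (Fin k)) => polyRow (q v) p.2 i := fun v i =>
    (measurable_polyRow (q v) i).comp measurable_snd
  exact (Finset.measurable_sum _ fun i _ => (Finset.measurable_prod _ fun v _ => hq v _).mul
    (Finset.measurable_prod _ fun e _ => hz _ _)).const_mul _

/-- The mean weights of a network of random matrices. -/
def wignerWeight {Ω : Type*} [MeasurableSpace Ω] (μ : Measure Ω)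
    (W : ∀ n : ℕ, Ω → Matrix (Fin n) (Fin n) ℝ) (u w : E → V) (n : ℕ) (i : V → Fin n) : ℝ :=
  ∫ ω, ∏ e, W n ω (edgeIdx u w i e).1.1 (edgeIdx u w i e).1.2 ∂μ

/-- The weights are expectations over `W` alone. With the vectors frozen, `weightVal` is the mean of
the network value, so the conditional fourth moment bound applies. -/
theorem ae_tendsto_netVal_sub (hx : ∀ n, Measurable (x n))
    (hconv : ∀ᵐ ω ∂μ, WassersteinTendsto (fun n => x n ω) νX) (hc : MConn u w) [Nonempty V]
    (hW : IsGeneralizedWigner μ W S) (hind : ∀ n, IndepFun (W n) (x n) μ) :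
    ∀ᵐ ω ∂μ, Tendsto (fun n => netVal (fun v => polyRow (q v) (x n ω)) u w
      (fun p => W n ω p.1.1 p.1.2) - weightVal q (wignerWeight μ W u w n) (x n ω)) atTop (𝓝 0) := by
  have hN : Fintype.card E ≤ Fintype.card (Four E) := by rw [Four.card]; omega
  obtain ⟨C, hC, hSC, δ, hδ, hX⟩ := hW.exists_centeredMoments (Fintype.card (Four E))
  refine ae_tendsto_zero_of_conditional (Z := W) (Y := x)
    (f := fun n z y => netVal (fun v => polyRow (q v) y) u w (fun p => z p.1.1 p.1.2)
      - weightVal q (wignerWeight μ W u w n) y)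
    (G := fun M n => {y | momentSum (fun v : Four V => polyRow (q v.pt) y)
      (Fintype.card (Four V)) ≤ M})
    hW.measurable hx hind (fun n => ?_) (fun M n => ?_) (fun M => ?_) ?_
  · exact (measurable_netVal q u w).sub ((measurable_weightVal q _).comp measurable_snd)
  · have h1 : Measurable fun y : Fin n → EuclideanSpace ℝ (Fin k) =>
        momentSum (fun v : Four V => polyRow (q v.pt) y) (Fintype.card (Four V)) :=
      measurable_momentSum (q := fun y (v : Four V) => polyRow (q v.pt) y)
        (fun v i => measurable_polyRow (q v.pt) i) _
    exact measurableSet_le h1 measurable_const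
  · refine ⟨16 * C ^ Fintype.card (Four E) * Fintype.card (Setoid (Four V)) * M, ?_⟩
    filter_upwards [hX, eventually_gt_atTop 0] with n hn hn0 y hy
    have h1 := hn.1.netVal_concentration hc le_rfl hn0 hC rfl (fun v => polyRow (q v) y)
    rw [hn.1.integral_netVal hN] at h1
    refine le_trans (le_of_eq (ofReal_integral_eq_lintegral_ofReal h1.1
      (Eventually.of_forall fun ω => by positivity)).symm) ?_
    refine ENNReal.ofReal_le_ofReal (h1.2.trans ?_)
    gcongr
  · filter_upwards [hconv] with ω hω
    exact hω.exists_momentSum_le (fun v : Four V => q v.pt) _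

theorem ae_tendsto_weightVal
    (hconv : ∀ᵐ ω ∂μ, WassersteinTendsto (fun n => x n ω) νX) (hc : MConn u w)
    (hcard : Fintype.card V = Fintype.card E + 1)
    (hT : ∀ v : V, ∀ᵐ ω ∂μ,
      Tendsto (fun n : ℕ => empAvg (polyRow (q v) (x n ω))) atTop (𝓝 0))
    (hW : IsGeneralizedWigner μ W S)
    (hprofile : ∀ q : MvPolynomial (Fin k) ℝ, ∀ᵐ ω ∂μ,
        Tendsto (fun n : ℕ => ⨆ i : Fin n,
          |empAvg (fun j => polyRow q (x n ω) j * S n i j)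
            - empAvg (polyRow q (x n ω)) * empAvg (fun j => S n i j)|) atTop (𝓝 0)) :
    ∀ᵐ ω ∂μ, Tendsto (fun n => weightVal q (wignerWeight μ W u w n) (x n ω)) atTop (𝓝 0) := by
  obtain ⟨C, hC, hSC, δ, hδ, hX⟩ := hW.exists_centeredMoments (Fintype.card E)
  set X : ∀ n : ℕ, {p : Fin n × Fin n // p.1 ≤ p.2} → Ω → ℝ := fun n p ω => W n ω p.1.1 p.1.2
    with hXdef
  set D : Ω → ∀ s : Setoid V, Quotient s → ∀ n : ℕ, Fin n → ℝ := fun ω s b n i =>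
    |empAvg (fun j => blockProd (fun v => polyRow (q v) (x n ω)) s b j * S n i j)
      - empAvg (blockProd (fun v => polyRow (q v) (x n ω)) s b) * empAvg (fun j => S n i j)| with hD
  have hprof : ∀ᵐ ω ∂μ, ∀ (s : Setoid V) (b : Quotient s),
      Tendsto (fun n : ℕ => ⨆ i : Fin n, D ω s b n i) atTop (𝓝 0) := by
    refine ae_all_iff.2 fun s => ae_all_iff.2 fun b => ?_
    filter_upwards [hprofile (∏ v with Quotient.mk'' v = b, q v)] with ω hω
    simp only [hD, blockProd_polyRow]
    exact hω
  filter_upwards [hconv, ae_all_iff.2 hT, hprof] with ω hω hTω hpω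
  obtain ⟨M, hM⟩ := hω.exists_momentSum_le q (Fintype.card V)
  set A : ∀ s : Setoid V, Quotient s → ℕ → ℝ := fun s b n =>
    empAvg (blockProd (fun v => polyRow (q v) (x n ω)) s b) with hA
  set R : ∀ n : ℕ, Fin n → ℝ := fun n i => |(1 / (n : ℝ)) * ∑ j, S n i j - 1| with hR
  -- The mean against row `i` is close to `⟨Q⟩⟨s_i⟩` by the profile condition, and `⟨s_i⟩` is close
  -- to `1`; the averages `A s b n` converge and so stay bounded.
  have hε : ∀ s b, Tendsto (fun n => (⨆ i, D ω s b n i) + |A s b n| * ⨆ i, R n i) atTop (𝓝 0) := by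
    intro s b
    obtain ⟨L, hL⟩ := hω.exists_tendsto (∏ v with Quotient.mk'' v = b, q v)
    have h1 : Tendsto (A s b) atTop (𝓝 L) := by
      refine hL.congr fun n => ?_
      simp only [hA, blockProd_polyRow]
    have := (hpω s b).add (h1.abs.mul hW.profile_rows)
    simpa only [mul_zero, add_zero] using this
  have hlim := tendsto_integral_netVal hc hcard X hC (hX.mono fun n hn => hn.1) le_rfl hδ
    (hX.mono fun n hn => hn.2) S (Eventually.of_forall fun n i j => by
      rcases le_total i j with h | h
      · simp only [hXdef, pairIdx, min_eq_left h, max_eq_right h]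
        exact hW.integral_sq n i j
      · simp only [hXdef, pairIdx, min_eq_right h, max_eq_left h]
        rw [hW.integral_sq, hW.profile_symm])
    (Eventually.of_forall hW.profile_symm) (Eventually.of_forall hSC)
    (fun n v => polyRow (q v) (x n ω)) hM hε (fun s b => Eventually.of_forall fun n i => by
      refine (abs_sub_le _ (A s b n * empAvg (fun j => S n i j)) _).trans
        (add_le_add (le_ciSup_fin (D ω s b n) i) ?_)
      have h1 : A s b n * empAvg (fun j => S n i j) - A s b n =
          A s b n * (empAvg (fun j => S n i j) - 1) := by ring
      change |A s b n * empAvg (fun j => S n i j) - A s b n| ≤ _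
      rw [h1, abs_mul]
      exact mul_le_mul_of_nonneg_left (le_ciSup_fin (R n) i) (abs_nonneg _)) hTω
  refine hlim.congr' ?_
  filter_upwards [hX] with n hn
  exact hn.1.integral_netVal le_rfl _ u w

end network

theorem ae_tendsto_val_of_wigner {Ω : Type*} [MeasurableSpace Ω] {μ : Measure Ω}
    [IsProbabilityMeasure μ] {k : ℕ} {x : ∀ n : ℕ, Ω → Fin n → EuclideanSpace ℝ (Fin k)}
    (hx : ∀ n, Measurable (x n)) {νX : Measure (EuclideanSpace ℝ (Fin k))}
    (hconv : ∀ᵐ ω ∂μ, WassersteinTendsto (fun n => x n ω) νX)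
    {V : Type u} [Fintype V] (T : DiagonalTensorNetwork V k)
    (hT : ∀ v : V, ∀ᵐ ω ∂μ,
      Tendsto (fun n : ℕ => empAvg (polyRow (T.q v) (x n ω))) atTop (𝓝 0))
    {W : ∀ n : ℕ, Ω → Matrix (Fin n) (Fin n) ℝ} {S : ∀ n : ℕ, Matrix (Fin n) (Fin n) ℝ}
    (hW : IsGeneralizedWigner μ W S) (hind : ∀ n, IndepFun (W n) (x n) μ)
    (hprofile : ∀ q : MvPolynomial (Fin k) ℝ, ∀ᵐ ω ∂μ,
        Tendsto (fun n : ℕ => ⨆ i : Fin n,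
          |empAvg (fun j => polyRow q (x n ω) j * S n i j)
            - empAvg (polyRow q (x n ω)) * empAvg (fun j => S n i j)|) atTop (𝓝 0)) :
    ∀ᵐ ω ∂μ, Tendsto (fun n : ℕ => T.val (W n ω) (x n ω)) atTop (𝓝 0) := by
  have := T.nonempty
  filter_upwards [ae_tendsto_netVal_sub T.q hx hconv T.mConn hW hind,
    ae_tendsto_weightVal T.q hconv T.mConn T.card_eq hT hW hprofile, ae_all_iff.2 hW.symm]
    with ω h1 h2 h3
  have h4 := h1.add h2
  simp only [sub_add_cancel, add_zero] at h4
  exact h4.congr fun n => (T.val_eq_netVal (h3 n) (x n ω)).symm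

/-! ### Uniformly random signed permutation matrices -/

/-- A signed permutation: a permutation with a choice of signs. -/
abbrev SignedPerm (n : ℕ) : Type := Equiv.Perm (Fin n) × (Fin n → ℤˣ)

/-- The matrix of a signed permutation. -/
def SignedPerm.matrix {n : ℕ} (s : SignedPerm n) : Matrix (Fin n) (Fin n) ℝ :=
  signedPermMatrix s.1 s.2

theorem signedPermMatrix_apply {n : ℕ} (σ : Equiv.Perm (Fin n)) (ξ : Fin n → ℤˣ) (a b : Fin n) :
    signedPermMatrix σ ξ a b = if σ a = b then ((ξ b : ℤ) : ℝ) else 0 := by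
  unfold signedPermMatrix
  rw [Matrix.mul_diagonal, Equiv.Perm.permMatrix, PEquiv.toMatrix_apply]
  simp [eq_comm]

theorem signedPermMatrix_mul_mul {n : ℕ} (H : Matrix (Fin n) (Fin n) ℝ) (s t : SignedPerm n)
    (a c : Fin n) : (s.matrix * H * t.matrix) a c =
      ((s.2 (s.1 a) : ℤ) : ℝ) * H (s.1 a) (t.1.symm c) * ((t.2 c : ℤ) : ℝ) := by
  have h1 : ∀ b, (s.matrix * H) a b = ((s.2 (s.1 a) : ℤ) : ℝ) * H (s.1 a) b := by
    intro b
    simp [Matrix.mul_apply, SignedPerm.matrix, signedPermMatrix_apply]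
  rw [Matrix.mul_apply]
  simp_rw [h1, SignedPerm.matrix, signedPermMatrix_apply]
  rw [Finset.sum_eq_single (t.1.symm c)]
  · simp
  · intro b _ hb
    rw [if_neg, mul_zero]
    rintro rfl
    simp at hb
  · simp

theorem units_cast_mul_self (e : ℤˣ) : ((e : ℤ) : ℝ) * ((e : ℤ) : ℝ) = 1 := by
  rcases Int.units_eq_one_or e with rfl | rfl <;> simp

theorem SignedPerm.transpose_mul_self {n : ℕ} (s : SignedPerm n) :
    s.matrix.transpose * s.matrix = 1 := by
  ext a b
  rw [Matrix.mul_apply]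
  simp_rw [Matrix.transpose_apply, SignedPerm.matrix, signedPermMatrix_apply]
  rw [Finset.sum_eq_single (s.1.symm a)]
  · by_cases h : a = b
    · subst h
      simp [units_cast_mul_self]
    · simp [h]
  · intro c _ hc
    rw [if_neg, zero_mul]
    rintro rfl
    simp at hc
  · simp

/-- The data of two signed permutations, with the signs of the second one split off. -/
def signedPairEquiv (n : ℕ) : SignedPerm n × SignedPerm n ≃ SignedPair n × (Fin n → ℤˣ) where
  toFun p := (((p.1.1, p.2.1.symm), fun a => p.1.2 (p.1.1 a)), p.2.2)
  invFun p := ((p.1.1.1, fun b => p.1.2 (p.1.1.1.symm b)), (p.1.1.2.symm, p.2))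
  left_inv p := by simp
  right_inv p := by simp

/-- Passing to row signs after permutation and to the inverse column permutation is a bijection; the
column signs are left over and average out. -/
theorem uavg_signedPerm {n : ℕ} (f : SignedPair n → ℝ) :
    (uavg fun s : SignedPerm n => uavg fun t : SignedPerm n => f (signedPairEquiv n (s, t)).1)
      = uavg f := by
  rw [← uavg_prod fun p : SignedPerm n × SignedPerm n => f (signedPairEquiv n p).1,
    uavg_comp_equiv (signedPairEquiv n) fun p => f p.1, uavg_prod]
  simp only [uavg_const]

theorem uniformSignedPerm_eq (n : ℕ) : uniformSignedPerm n =
    (Fintype.card (SignedPerm n) : ℝ≥0∞)⁻¹ • ∑ s : SignedPerm n, Measure.dirac s.matrix := by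
  ext A hA
  rw [uniformSignedPerm, PMF.toMeasure_apply_eq_toOuterMeasure_apply _ hA,
    PMF.toOuterMeasure_map_apply, PMF.toOuterMeasure_uniformOfFintype_apply, Measure.smul_apply,
    Measure.finsetSum_apply]
  simp_rw [Measure.dirac_apply' _ hA]
  rw [smul_eq_mul, ENNReal.div_eq_inv_mul]
  congr 1
  simp only [Set.indicator_apply, Pi.one_apply]
  rw [Finset.sum_boole, Fintype.card_subtype]
  rfl

theorem lintegral_uniformSignedPerm {n : ℕ} {f : Matrix (Fin n) (Fin n) ℝ → ℝ} (hf : Measurable f)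
    (h0 : ∀ z, 0 ≤ f z) : ∫⁻ z, ENNReal.ofReal (f z) ∂uniformSignedPerm n =
      ENNReal.ofReal (uavg fun s : SignedPerm n => f s.matrix) := by
  rw [uniformSignedPerm_eq, lintegral_smul_measure, lintegral_finsetSum_measure]
  simp_rw [lintegral_dirac' _ hf.ennreal_ofReal]
  rw [uavg, ENNReal.ofReal_mul (by positivity), ENNReal.ofReal_sum_of_nonneg fun s _ => h0 _,
    ENNReal.ofReal_inv_of_pos (by exact_mod_cast Fintype.card_pos), ENNReal.ofReal_natCast,
    smul_eq_mul]

instance instMeasurableSingletonClassRealMatrix (n : ℕ) :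
    MeasurableSingletonClass (Matrix (Fin n) (Fin n) ℝ) :=
  inferInstanceAs (MeasurableSingletonClass (Fin n → Fin n → ℝ))

theorem ae_uniformSignedPerm (n : ℕ) : ∀ᵐ z ∂uniformSignedPerm n, ∃ s : SignedPerm n, z = s.matrix := by
  have hm : MeasurableSet {z : Matrix (Fin n) (Fin n) ℝ | ∃ s : SignedPerm n, z = s.matrix} := by
    have : {z : Matrix (Fin n) (Fin n) ℝ | ∃ s : SignedPerm n, z = s.matrix} =
        Set.range (SignedPerm.matrix (n := n)) := by
      ext z; simp [eq_comm]
    rw [this]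
    exact (Set.finite_range _).measurableSet
  rw [uniformSignedPerm_eq]
  refine Measure.ae_smul_measure ?_ _
  rw [ae_iff, ← Set.compl_ofPred, Measure.finsetSum_apply]
  refine Finset.sum_eq_zero fun s _ => ?_
  rw [Measure.dirac_apply' _ hm.compl]
  refine Set.indicator_of_notMem ?_ _
  rw [Set.notMem_compl_iff]
  exact ⟨s, rfl⟩

/-! ### Networks of invariant matrices as bipartite networks -/

section bipartite

variable {V E : Type u} [Fintype V] [Fintype E]

/-- The left end points of the bipartite graph in which every edge is subdivided. -/
def halfEdge (u w : E → V) (f : E × Bool) : V := if f.2 then w f.1 else u f.1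

omit [Fintype V] [Fintype E] in
theorem MConn.bipConnected [Nonempty V] {u w : E → V} (h : MConn u w) :
    BipConnected (halfEdge u w) (Prod.fst : E × Bool → E) := by
  intro φ ψ hf he
  have h1 : ∀ e, φ (u e) ↔ ψ e := fun e => hf (e, false)
  have h2 : ∀ e, φ (w e) ↔ ψ e := fun e => hf (e, true)
  have h3 : ∀ x y, φ x → φ y := h φ fun e => (h1 e).trans (h2 e).symm
  have h4 : ∃ x, φ x := by
    rcases he with h | ⟨e, he⟩
    · exact h
    · exact ⟨_, (h1 e).2 he⟩
  obtain ⟨x, hx⟩ := h4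
  exact ⟨fun y => h3 x y hx, fun e => (h1 e).1 (h3 x _ hx)⟩

theorem evenDegrees_fst : EvenDegrees (Prod.fst : E × Bool → E) := by
  intro ε
  rw [Fintype.prod_prod_type]
  simp

omit [Fintype V] in
theorem bipWeight_halfEdge {n : ℕ} (O : Matrix (Fin n) (Fin n) ℝ) (u w : E → V) (i : V → Fin n)
    (k : E → Fin n) : bipWeight O (halfEdge u w) Prod.fst i k =
      ∏ e, O (i (u e)) (k e) * O (i (w e)) (k e) := by
  rw [bipWeight, Fintype.prod_prod_type]
  refine Finset.prod_congr rfl fun e _ => ?_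
  rw [Fintype.prod_bool]
  simp [halfEdge, mul_comm]

theorem sum_prod_conj_eq_bipVal {n : ℕ} (q : V → Fin n → ℝ) (d : Fin n → ℝ) (u w : E → V)
    (O : Matrix (Fin n) (Fin n) ℝ) :
    (1 / (n : ℝ)) * ∑ i : V → Fin n, (∏ v, q v (i v)) *
      ∏ e, (O * Matrix.diagonal d * O.transpose) (i (u e)) (i (w e)) =
    bipVal q (fun _ : E => d) (halfEdge u w) Prod.fst O := by
  unfold bipVal
  congr 1
  refine Finset.sum_congr rfl fun i _ => ?_
  have h1 : ∀ a b, (O * Matrix.diagonal d * O.transpose) a b = ∑ c, d c * (O a c * O b c) := by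
    intro a b
    rw [Matrix.mul_apply]
    refine Finset.sum_congr rfl fun c _ => ?_
    rw [Matrix.mul_diagonal, Matrix.transpose_apply]
    ring
  simp_rw [h1]
  rw [← sum_prod_eq_prod_sum (fun (e : E) c => d c * (O (i (u e)) c * O (i (w e)) c)),
    Finset.mul_sum]
  refine Finset.sum_congr rfl fun k _ => ?_
  rw [bipWeight_halfEdge, Finset.prod_mul_distrib, mul_assoc]

/-- Each column index `k e` occurs in exactly two factors, so its sign is squared away. Only the row
signs remain. -/
theorem bipVal_signedPerm {n : ℕ} (q : V → Fin n → ℝ) (d : Fin n → ℝ) (u w : E → V)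
    (H : Matrix (Fin n) (Fin n) ℝ) (s t : SignedPerm n) :
    bipVal q (fun _ : E => d) (halfEdge u w) Prod.fst (s.matrix * H * t.matrix) =
      bipVal q (fun _ : E => d) (halfEdge u w) Prod.fst
        (signedConj H (signedPairEquiv n (s, t)).1) := by
  unfold bipVal
  congr 1
  refine Finset.sum_congr rfl fun i _ => Finset.sum_congr rfl fun k _ => ?_
  rw [bipWeight_halfEdge, bipWeight_halfEdge]
  congr 1
  refine Finset.prod_congr rfl fun e _ => ?_
  rw [signedPermMatrix_mul_mul, signedPermMatrix_mul_mul]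
  simp only [signedConj, signedPairEquiv, Equiv.coe_fn_mk]
  rw [mul_mul_mul_comm, units_cast_mul_self, mul_one]

theorem DiagonalTensorNetwork.val_conj {k : ℕ} (T : DiagonalTensorNetwork V k) {n : ℕ}
    (O : Matrix (Fin n) (Fin n) ℝ) (d : Fin n → ℝ) (x : Fin n → EuclideanSpace ℝ (Fin k)) :
    T.val (O * Matrix.diagonal d * O.transpose) x =
      bipVal (fun v => polyRow (T.q v) x) (fun _ => d) (halfEdge T.fst T.snd) Prod.fst O := by
  rw [T.val_eq]
  exact sum_prod_conj_eq_bipVal _ d T.fst T.snd O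

theorem trace_conj {n : ℕ} {O : Matrix (Fin n) (Fin n) ℝ} (hO : O.transpose * O = 1)
    (d : Fin n → ℝ) : (1 / (n : ℝ)) * (O * Matrix.diagonal d * O.transpose).trace = empAvg d := by
  rw [Matrix.trace_mul_comm, ← Matrix.mul_assoc, hO, Matrix.one_mul, Matrix.trace_diagonal, empAvg]

theorem measurable_bipVal {α : Type*} [MeasurableSpace α] {F : Type u} [Fintype F] {l : F → V}
    {r : F → E} {n : ℕ} {q : α → V → Fin n → ℝ} {d : α → E → Fin n → ℝ}
    {O : α → Matrix (Fin n) (Fin n) ℝ} (hq : ∀ v i, Measurable fun a => q a v i)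
    (hd : ∀ e i, Measurable fun a => d a e i) (hO : ∀ i j, Measurable fun a => O a i j) :
    Measurable fun a => bipVal (q a) (d a) l r (O a) :=
  (Finset.measurable_sum _ fun _ _ => Finset.measurable_sum _ fun _ _ =>
    ((Finset.measurable_prod _ fun _ _ => hq _ _).mul (Finset.measurable_prod _ fun _ _ =>
      hd _ _)).mul (Finset.measurable_prod _ fun _ _ => hO _ _)).const_mul _

end bipartite

theorem delocalized_iff {n : ℕ} {H : Matrix (Fin n) (Fin n) ℝ} {g : ℝ} {m : ℕ} :
    Delocalized H g m ↔ (∀ a b, ∑ c, H a c * H b c = (1 : Matrix (Fin n) (Fin n) ℝ) a b) ∧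
      (1 ≤ g ∧ g ^ m ≤ n) ∧ ∀ i j, n * H i j ^ 2 ≤ g := by
  have h1 : H ∈ Matrix.orthogonalGroup (Fin n) ℝ ↔
      ∀ a b, ∑ c, H a c * H b c = (1 : Matrix (Fin n) (Fin n) ℝ) a b := by
    rw [Matrix.mem_orthogonalGroup_iff, ← Matrix.ext_iff]
    rfl
  exact ⟨fun h => ⟨h1.1 h.orth, ⟨h.one_le, h.pow_le⟩, h.entry⟩,
    fun h => ⟨h1.2 h.1, h.2.1.1, h.2.1.2, h.2.2⟩⟩

theorem measurableSet_delocalized {n : ℕ} (g : ℝ) (m : ℕ) :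
    MeasurableSet {H : Matrix (Fin n) (Fin n) ℝ | Delocalized H g m} := by
  have he : ∀ i j : Fin n, Measurable fun H : Matrix (Fin n) (Fin n) ℝ => H i j := fun i j =>
    (measurable_pi_apply j).comp (measurable_pi_apply i)
  have h1 : MeasurableSet {H : Matrix (Fin n) (Fin n) ℝ |
      ∀ a b, ∑ c, H a c * H b c = (1 : Matrix (Fin n) (Fin n) ℝ) a b} := by
    simp only [Set.ofPred_forall]
    exact MeasurableSet.iInter fun a => MeasurableSet.iInter fun b => measurableSet_eq_fun
      (Finset.measurable_sum _ fun c _ => (he a c).mul (he b c)) measurable_const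
  have h2 : MeasurableSet {H : Matrix (Fin n) (Fin n) ℝ | ∀ i j, n * H i j ^ 2 ≤ g} := by
    simp only [Set.ofPred_forall]
    exact MeasurableSet.iInter fun a => MeasurableSet.iInter fun b => measurableSet_le
      (((he a b).pow_const 2).const_mul _) measurable_const
  simp_rw [delocalized_iff]
  exact h1.inter ((MeasurableSet.const _).inter h2)

/-- Delocalization is used with `ε = 1 / (2m)`: then `n * H i j ^ 2 ≤ n ^ (1 / m)`, whose `m`-th
power is `n`. -/
theorem delocalized_of_lt {n : ℕ} (hn : 0 < n) {H : Matrix (Fin n) (Fin n) ℝ}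
    (horth : H ∈ Matrix.orthogonalGroup (Fin n) ℝ) {m : ℕ} (hm : 0 < m)
    (h : ∀ i j, |H i j| < (n : ℝ) ^ (-(1 / 2 : ℝ) + 1 / (2 * m))) :
    Delocalized H ((n : ℝ) ^ (1 / m : ℝ)) m := by
  have hn0 : (0 : ℝ) < n := by exact_mod_cast hn
  have hn1 : (1 : ℝ) ≤ n := by exact_mod_cast hn
  have hm0 : (m : ℝ) ≠ 0 := by exact_mod_cast hm.ne'
  refine ⟨horth, Real.one_le_rpow hn1 (by positivity), ?_, fun i j => ?_⟩
  · rw [← Real.rpow_natCast, ← Real.rpow_mul hn0.le, one_div_mul_cancel hm0, Real.rpow_one]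
  · calc n * H i j ^ 2 = n * |H i j| ^ 2 := by rw [sq_abs]
      _ ≤ n * ((n : ℝ) ^ (-(1 / 2 : ℝ) + 1 / (2 * m))) ^ 2 := by
          gcongr
          exact (h i j).le
      _ = (n : ℝ) ^ (1 : ℝ) * (n : ℝ) ^ ((-(1 / 2 : ℝ) + 1 / (2 * m)) * (2 : ℕ)) := by
          rw [Real.rpow_mul hn0.le, Real.rpow_natCast, Real.rpow_one]
      _ = _ := by
          rw [← Real.rpow_add hn0]
          congr 1
          push_cast
          field_simp
          ring

/-! ### Generalized invariant matrices -/

instance instIsProbabilityMeasureUniformSignedPerm (n : ℕ) :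
    IsProbabilityMeasure (uniformSignedPerm n) := by
  unfold uniformSignedPerm
  infer_instance

theorem WassersteinTendsto.exists_momentSum_le_of_real {y : ∀ n : ℕ, Fin n → ℝ} {ν : Measure ℝ}
    (h : WassersteinTendsto y ν) (A : Type*) [Fintype A] (N : ℕ) :
    ∃ M : ℕ, ∀ᶠ n in atTop, momentSum (fun _ : A => y n) N ≤ M := by
  have h1 : ∃ L, Tendsto (fun n => empAvg fun i => |y n i| ^ N) atTop (𝓝 L) := by
    refine ⟨_, h (N + 1) (Nat.le_add_left _ _) (fun v => |v| ^ N) (continuous_abs.pow N)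
      ⟨2, two_pos, fun v => ?_⟩⟩
    rw [abs_pow, abs_abs, Real.norm_eq_abs]
    rcases le_total |v| 1 with hv | hv
    · have := pow_le_one₀ (abs_nonneg v) hv (n := N)
      have : 0 ≤ |v| ^ (N + 1) := by positivity
      linarith
    · have := pow_le_pow_right₀ hv (Nat.le_add_right N 1)
      have : 0 ≤ |v| ^ (N + 1) := by positivity
      linarith
  obtain ⟨L, hL⟩ := h1
  exact exists_eventually_le_of_tendsto
    ⟨_, tendsto_const_nhds.add (tendsto_finsetSum Finset.univ fun (_ : A) _ => hL)⟩

section independence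

variable {Ω α β γ : Type*} [MeasurableSpace Ω] [MeasurableSpace α] [MeasurableSpace β]
  [MeasurableSpace γ] {μ : Measure Ω} [IsProbabilityMeasure μ]

/-- The law of the triple is the product of the three laws, which may be bracketed either way. This
frees the signed permutations jointly from the spectrum, `H` and the vectors. -/
theorem indepFun_prodMk_right {A : Ω → α} {B : Ω → β} {C : Ω → γ} (hA : Measurable A)
    (hB : Measurable B) (hC : Measurable C) (hAB : IndepFun A B μ)
    (hABC : IndepFun (fun ω => (A ω, B ω)) C μ) : IndepFun A (fun ω => (B ω, C ω)) μ := by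
  have := Measure.isProbabilityMeasure_map (μ := μ) hA.aemeasurable
  have := Measure.isProbabilityMeasure_map (μ := μ) hB.aemeasurable
  have := Measure.isProbabilityMeasure_map (μ := μ) hC.aemeasurable
  have hBC : IndepFun B C μ := hABC.comp measurable_snd measurable_id
  rw [indepFun_iff_map_prod_eq_prod_map_map hA.aemeasurable (hB.prodMk hC).aemeasurable,
    (indepFun_iff_map_prod_eq_prod_map_map hB.aemeasurable hC.aemeasurable).1 hBC,
    ← Measure.prodAssoc_prod,
    ← (indepFun_iff_map_prod_eq_prod_map_map hA.aemeasurable hB.aemeasurable).1 hAB,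
    ← (indepFun_iff_map_prod_eq_prod_map_map (hA.prodMk hB).aemeasurable hC.aemeasurable).1 hABC,
    Measure.map_map MeasurableEquiv.prodAssoc.measurable ((hA.prodMk hB).prodMk hC)]
  rfl

theorem lintegral_signedPerm {n : ℕ} {P Q : Ω → Matrix (Fin n) (Fin n) ℝ} (hP : Measurable P)
    (hQ : Measurable Q) (lP : μ.map P = uniformSignedPerm n) (lQ : μ.map Q = uniformSignedPerm n)
    (hPQ : IndepFun P Q μ) {f : Matrix (Fin n) (Fin n) ℝ × Matrix (Fin n) (Fin n) ℝ → ℝ}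
    (hf : Measurable f) (h0 : ∀ z, 0 ≤ f z) : ∫⁻ ω, ENNReal.ofReal (f (P ω, Q ω)) ∂μ =
      ENNReal.ofReal (uavg fun s : SignedPerm n => uavg fun t : SignedPerm n =>
        f (s.matrix, t.matrix)) := by
  rw [← lintegral_map (f := fun z => ENNReal.ofReal (f z)) hf.ennreal_ofReal (hP.prodMk hQ),
    (indepFun_iff_map_prod_eq_prod_map_map hP.aemeasurable hQ.aemeasurable).1 hPQ, lP, lQ,
    lintegral_prod _ hf.ennreal_ofReal.aemeasurable]
  have h1 : ∀ z, ∫⁻ w, ENNReal.ofReal (f (z, w)) ∂uniformSignedPerm n =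
      ENNReal.ofReal (uavg fun t : SignedPerm n => f (z, t.matrix)) := fun z =>
    lintegral_uniformSignedPerm (hf.comp (measurable_const.prodMk measurable_id)) fun w => h0 _
  simp_rw [h1]
  refine lintegral_uniformSignedPerm ?_ fun z => uavg_nonneg fun t => h0 _
  exact (Finset.measurable_sum _ fun t _ =>
    hf.comp (measurable_id.prodMk measurable_const)).const_mul _

end independence

theorem measurable_entry {α : Type*} [MeasurableSpace α] {n : ℕ}
    {A : α → Matrix (Fin n) (Fin n) ℝ} (hA : Measurable A) (i j : Fin n) :
    Measurable fun a => A a i j :=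
  (measurable_pi_apply j).comp ((measurable_pi_apply i).comp hA)

theorem measurable_matrix_mul {α : Type*} [MeasurableSpace α] {n : ℕ}
    {A B : α → Matrix (Fin n) (Fin n) ℝ} (hA : Measurable A) (hB : Measurable B) :
    Measurable fun a => A a * B a :=
  measurable_pi_lambda _ fun i => measurable_pi_lambda _ fun j => by
    simp_rw [Matrix.mul_apply]
    exact Finset.measurable_sum _ fun c _ => (measurable_entry hA i c).mul (measurable_entry hB c j)

section invariant

variable {V E : Type u} [Fintype V] [Fintype E] {k n : ℕ} (q : V → MvPolynomial (Fin k) ℝ)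
  (u w : E → V)

/-- The data that are independent of the signed permutations: the spectrum, the orthogonal matrix
and the vectors. -/
abbrev InvariantData (k n : ℕ) : Type :=
  ((Fin n → ℝ) × Matrix (Fin n) (Fin n) ℝ) × (Fin n → EuclideanSpace ℝ (Fin k))

/-- The value of a network of generalized invariant matrices. -/
def dataVal (y : InvariantData k n) (O : Matrix (Fin n) (Fin n) ℝ) : ℝ :=
  bipVal (fun v => polyRow (q v) y.2) (fun _ : E => y.1.1) (halfEdge u w) Prod.fst O

/-- The average of the value over the signed permutations. -/
def dataMean (y : InvariantData k n) : ℝ :=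
  uavg fun θ : SignedPair n => dataVal q u w y (signedConj y.1.2 θ)

theorem measurable_dataVal {α : Type*} [MeasurableSpace α] {y : α → InvariantData k n}
    (hy : Measurable y) {O : α → Matrix (Fin n) (Fin n) ℝ} (hO : ∀ i j, Measurable fun a => O a i j) :
    Measurable fun a => dataVal q u w (y a) (O a) :=
  measurable_bipVal (q := fun a v => polyRow (q v) (y a).2) (d := fun a _ => (y a).1.1)
    (fun v i => (measurable_polyRow (q v) i).comp hy.snd)
    (fun _ i => (measurable_pi_apply i).comp hy.fst.fst) hO

theorem measurable_dataMean : Measurable (dataMean (n := n) q u w) := by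
  refine (Finset.measurable_sum _ fun θ _ => ?_).const_mul _
  exact measurable_dataVal q u w measurable_id fun i j =>
    (measurable_entry measurable_fst.snd _ _).const_mul _

/-- The data with delocalized orthogonal matrix and moments bounded by `M`. -/
def goodData (m M n : ℕ) : Set (InvariantData k n) :=
  {y | Delocalized y.1.2 ((n : ℝ) ^ (1 / m : ℝ)) m ∧
    momentSum (fun v : Four V => polyRow (q v.pt) y.2) (Fintype.card (Four V)) ≤ M ∧
    momentSum (fun _ : Four E => y.1.1) (Fintype.card (Four E)) ≤ M}

theorem measurableSet_goodData (m M : ℕ) : MeasurableSet (goodData (E := E) q m M n) := by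
  have h1 : Measurable fun y : InvariantData k n =>
      momentSum (fun v : Four V => polyRow (q v.pt) y.2) (Fintype.card (Four V)) :=
    measurable_momentSum (q := fun (y : InvariantData k n) (v : Four V) => polyRow (q v.pt) y.2)
      (fun v i => (measurable_polyRow (q v.pt) i).comp measurable_snd) _
  have h2 : Measurable fun y : InvariantData k n =>
      momentSum (fun _ : Four E => y.1.1) (Fintype.card (Four E)) :=
    measurable_momentSum (q := fun (y : InvariantData k n) (_ : Four E) => y.1.1)
      (fun _ i => (measurable_pi_apply i).comp measurable_fst.fst) _
  exact ((measurableSet_delocalized _ m).preimage measurable_fst.snd).inter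
    ((measurableSet_le h1 measurable_const).inter (measurableSet_le h2 measurable_const))

variable {q u w}

theorem exists_uavg_dataVal_sub_pow_four_le [Nonempty V] (hc : MConn u w) {m : ℕ}
    (hm : Fintype.card (Four (E × Bool)) ≤ 2 * m) (M : ℕ) :
    ∃ C : ℝ, ∀ {n : ℕ}, ∀ y ∈ goodData (k := k) (E := E) q m M n,
      (uavg fun s : SignedPerm n => uavg fun t : SignedPerm n =>
        (dataVal q u w y (s.matrix * y.1.2 * t.matrix) - dataMean q u w y) ^ 4) ≤ C / n ^ 2 := by
  obtain ⟨C, hC0, hC⟩ := exists_uavg_bipVal_sub_pow_four_le hc.bipConnected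
    (evenDegrees_fst (E := E))
  refine ⟨C * (M * M), fun {n} y hy => ?_⟩
  obtain ⟨h1, h2, h3⟩ := hy
  have h4 := hC h1 hm (fun v => polyRow (q v) y.2) (fun _ => y.1.1)
  have h5 : ∀ s t : SignedPerm n, dataVal q u w y (s.matrix * y.1.2 * t.matrix) =
      dataVal q u w y (signedConj y.1.2 (signedPairEquiv n (s, t)).1) := fun s t =>
    bipVal_signedPerm _ _ u w _ s t
  simp_rw [h5]
  rw [uavg_signedPerm fun θ => (dataVal q u w y (signedConj y.1.2 θ) - dataMean q u w y) ^ 4]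
  refine h4.trans ?_
  have h6 := one_le_momentSum (fun _ : Four E => y.1.1) (Fintype.card (Four E))
  gcongr

end invariant

/-- Conditionally on the spectrum, `H` and the vectors, the only randomness is that of the two
signed permutations. The value concentrates around its average over them, and this average tends to
zero. -/
theorem ae_tendsto_val_of_indep {Ω : Type*} [MeasurableSpace Ω] {μ : Measure Ω}
    [IsProbabilityMeasure μ] {k : ℕ} {x : ∀ n : ℕ, Ω → Fin n → EuclideanSpace ℝ (Fin k)}
    (hx : ∀ n, Measurable (x n)) {νX : Measure (EuclideanSpace ℝ (Fin k))}
    (hconv : ∀ᵐ ω ∂μ, WassersteinTendsto (fun n => x n ω) νX)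
    {V : Type u} [Fintype V] (T : DiagonalTensorNetwork V k)
    (hT : ∀ v : V, ∀ᵐ ω ∂μ,
      Tendsto (fun n : ℕ => empAvg (polyRow (T.q v) (x n ω))) atTop (𝓝 0))
    {W : ∀ n : ℕ, Ω → Matrix (Fin n) (Fin n) ℝ} {d : ∀ n : ℕ, Ω → Fin n → ℝ}
    {H PV PE : ∀ n : ℕ, Ω → Matrix (Fin n) (Fin n) ℝ} {νD : Measure ℝ}
    (hW : IsSymGeneralizedInvariant μ W d H PV PE νD)
    (hind : ∀ n, IndepFun (fun ω => (PV n ω, PE n ω, d n ω, H n ω)) (x n) μ)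
    (htrace : ∀ᵐ ω ∂μ, Tendsto (fun n : ℕ => (1 / (n : ℝ)) * (W n ω).trace) atTop (𝓝 0)) :
    ∀ᵐ ω ∂μ, Tendsto (fun n : ℕ => T.val (W n ω) (x n ω)) atTop (𝓝 0) := by
  have := T.nonempty
  -- The second condition is for the sums over four copies of the subdivided tree, the third for the
  -- mean.
  obtain ⟨m, hm0, hm1, hm2⟩ : ∃ m : ℕ, 0 < m ∧
      Fintype.card (Four (T.graph.edgeSet × Bool)) ≤ 2 * m ∧
      2 * Fintype.card T.graph.edgeSet ≤ m :=
    ⟨Fintype.card (Four (T.graph.edgeSet × Bool)) + 2 * Fintype.card T.graph.edgeSet + 1,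
      by omega, by omega, by omega⟩
  set Y : ∀ n, Ω → InvariantData k n := fun n ω => ((d n ω, H n ω), x n ω) with hY
  have hYm : ∀ n, Measurable (Y n) := fun n =>
    ((hW.measurable_d n).prodMk (hW.measurable_H n)).prodMk (hx n)
  have hdeloc : ∀ᵐ ω ∂μ, ∀ᶠ n : ℕ in atTop, Delocalized (H n ω) ((n : ℝ) ^ (1 / m : ℝ)) m := by
    have hm0' : (0 : ℝ) < m := by exact_mod_cast hm0
    filter_upwards [hW.delocalized (1 / (2 * m)) (by positivity), ae_all_iff.2 hW.orthogonal]
      with ω h1 h2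
    filter_upwards [h1, eventually_gt_atTop 0] with n hn hn0
    exact delocalized_of_lt hn0 (h2 n) hm0 hn
  have hgood : ∀ᵐ ω ∂μ, ∃ M, ∀ᶠ n in atTop,
      Y n ω ∈ goodData (E := T.graph.edgeSet) T.q m M n := by
    filter_upwards [hdeloc, hconv, hW.spectrum_tendsto] with ω h1 h2 h3
    obtain ⟨M, hM⟩ := h2.exists_momentSum_le (fun v : Four V => T.q v.pt) (Fintype.card (Four V))
    obtain ⟨M', hM'⟩ := h3.exists_momentSum_le_of_real (Four T.graph.edgeSet)
      (Fintype.card (Four T.graph.edgeSet))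
    refine ⟨max M M', ?_⟩
    filter_upwards [h1, hM, hM'] with n hn hMn hMn'
    exact ⟨hn, hMn.trans (by exact_mod_cast le_max_left _ _),
      hMn'.trans (by exact_mod_cast le_max_right _ _)⟩
  have hconc : ∀ᵐ ω ∂μ, Tendsto (fun n =>
      dataVal T.q T.fst T.snd (Y n ω) (PV n ω * H n ω * PE n ω)
        - dataMean T.q T.fst T.snd (Y n ω)) atTop (𝓝 0) := by
    have hf : ∀ n, Measurable fun p : (Matrix (Fin n) (Fin n) ℝ × Matrix (Fin n) (Fin n) ℝ) ×
        InvariantData k n => dataVal T.q T.fst T.snd p.2 (p.1.1 * p.2.1.2 * p.1.2)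
          - dataMean T.q T.fst T.snd p.2 := fun n =>
      (measurable_dataVal _ _ _ measurable_snd (measurable_entry (measurable_matrix_mul
        (measurable_matrix_mul measurable_fst.fst measurable_snd.fst.snd) measurable_fst.snd))).sub
        ((measurable_dataMean _ _ _).comp measurable_snd)
    refine ae_tendsto_zero_of_conditional (Z := fun n ω => (PV n ω, PE n ω)) (Y := Y)
      (f := fun n z y => dataVal T.q T.fst T.snd y (z.1 * y.1.2 * z.2)
        - dataMean T.q T.fst T.snd y) (G := fun M n => goodData (E := T.graph.edgeSet) T.q m M n)
      (fun n => (hW.measurable_PV n).prodMk (hW.measurable_PE n)) hYm (fun n => ?_) hf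
      (fun M n => measurableSet_goodData T.q m M) (fun M => ?_) hgood
    · refine indepFun_prodMk_right ((hW.measurable_PV n).prodMk (hW.measurable_PE n))
        ((hW.measurable_d n).prodMk (hW.measurable_H n)) (hx n) (hW.indep_perm n) ?_
      exact (hind n).comp (φ := fun p => ((p.1, p.2.1), (p.2.2.1, p.2.2.2)))
        (by fun_prop) measurable_id
    · obtain ⟨C, hC⟩ := exists_uavg_dataVal_sub_pow_four_le (k := k) (q := T.q) T.mConn hm1 M
      refine ⟨C, Eventually.of_forall fun n y hy => ?_⟩
      have hfy : Measurable fun z : Matrix (Fin n) (Fin n) ℝ × Matrix (Fin n) (Fin n) ℝ =>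
          (dataVal T.q T.fst T.snd y (z.1 * y.1.2 * z.2) - dataMean T.q T.fst T.snd y) ^ 4 :=
        ((hf n).comp (measurable_id.prodMk measurable_const)).pow_const 4
      rw [lintegral_signedPerm (hW.measurable_PV n) (hW.measurable_PE n) (hW.law_PV n)
        (hW.law_PE n) (hW.indep_PV_PE n) hfy fun z => by positivity]
      exact ENNReal.ofReal_le_ofReal (hC y hy)
  have hmatrix : ∀ᵐ ω ∂μ, ∀ n, (∃ s : SignedPerm n, PV n ω = s.matrix) ∧
      ∃ s : SignedPerm n, PE n ω = s.matrix := by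
    refine ae_all_iff.2 fun n => ?_
    have h1 := ae_uniformSignedPerm n
    have h2 := h1
    rw [← hW.law_PV n] at h1
    rw [← hW.law_PE n] at h2
    filter_upwards [ae_of_ae_map (hW.measurable_PV n).aemeasurable h1,
      ae_of_ae_map (hW.measurable_PE n).aemeasurable h2] with ω h3 h4
    exact ⟨h3, h4⟩
  filter_upwards [hconc, hdeloc, hgood, hmatrix, ae_all_iff.2 hW.orthogonal, htrace, hconv,
    hW.spectrum_tendsto, ae_all_iff.2 hT] with ω h1 h2 h3 h4 h5 h6 h7 h8 h9
  -- Conjugation by the orthogonal matrix `Π_V H Π_E` preserves the trace, so the hypothesis on `Tr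
  -- W` says that the eigenvalues are centred in the limit.
  have hd : Tendsto (fun n => empAvg (d n ω)) atTop (𝓝 0) := by
    refine h6.congr fun n => ?_
    rw [hW.eq n ω]
    refine trace_conj ?_ _
    obtain ⟨⟨s, hs⟩, ⟨t, ht⟩⟩ := h4 n
    have hH : (H n ω).transpose * H n ω = 1 := by
      have := h5 n
      rw [Matrix.mem_orthogonalGroup_iff'] at this
      exact this
    rw [hs, ht, Matrix.transpose_mul, Matrix.transpose_mul]
    calc _ = t.matrix.transpose * ((H n ω).transpose * (s.matrix.transpose * s.matrix) * H n ω) *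
          t.matrix := by simp only [Matrix.mul_assoc]
      _ = 1 := by rw [s.transpose_mul_self, Matrix.mul_one, hH, Matrix.mul_one,
            t.transpose_mul_self]
  obtain ⟨M, hM⟩ := h7.exists_momentSum_le T.q (Fintype.card V)
  obtain ⟨M', hM'⟩ := h8.exists_momentSum_le_of_real T.graph.edgeSet
    (Fintype.card T.graph.edgeSet)
  have hmean : Tendsto (fun n => dataMean T.q T.fst T.snd (Y n ω)) atTop (𝓝 0) :=
    tendsto_uavg_bipVal T.mConn.bipConnected evenDegrees_fst
      (by rw [Fintype.card_prod, Fintype.card_bool, mul_comm]) T.card_eq (fun n => H n ω)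
      (fun n => (n : ℝ) ^ (1 / m : ℝ)) hm2 h2 (fun n v => polyRow (T.q v) (x n ω))
      (fun n _ => d n ω) (M := max M M') (hM.mono fun n hn => hn.trans (le_max_left _ _))
      (hM'.mono fun n hn => hn.trans (le_max_right _ _)) h9 fun _ => hd
  have h10 := h1.add hmean
  simp only [sub_add_cancel, add_zero] at h10
  refine h10.congr fun n => ?_
  rw [hW.eq n ω, T.val_conj]
  rfl

/-! ### Independence of the sequences -/

section transfer

variable {Ω α β : Type*} [MeasurableSpace Ω] [MeasurableSpace α] [MeasurableSpace β]
  {μ : Measure Ω} [IsProbabilityMeasure μ]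

theorem IndepFun.comp_fst {f : Ω → α} {g : Ω → β} (hf : Measurable f) (hg : Measurable g)
    (h : IndepFun f g μ) : IndepFun (fun p : Ω × Ω => f p.1) (fun p => g p.1) (μ.prod μ) := by
  have hm : (μ.prod μ).map Prod.fst = μ := measurePreserving_fst.map_eq
  rw [indepFun_iff_map_prod_eq_prod_map_map hf.aemeasurable hg.aemeasurable, ← hm,
    Measure.map_map (hf.prodMk hg) measurable_fst, Measure.map_map hf measurable_fst,
    Measure.map_map hg measurable_fst] at h
  exact (indepFun_iff_map_prod_eq_prod_map_map (hf.comp measurable_fst).aemeasurable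
    (hg.comp measurable_fst).aemeasurable).2 h

/-- Independent random variables have the joint law of independent copies. -/
theorem IndepFun.ae_of_ae_prod {f : Ω → α} {g : Ω → β} (hf : Measurable f) (hg : Measurable g)
    (h : IndepFun f g μ) {P : α × β → Prop} (hP : MeasurableSet {z | P z})
    (hae : ∀ᵐ p ∂μ.prod μ, P (f p.1, g p.2)) : ∀ᵐ ω ∂μ, P (f ω, g ω) := by
  have h1 := (indepFun_iff_map_prod_eq_prod_map_map hf.aemeasurable hg.aemeasurable).1 h
  rw [Measure.map_prod_map _ _ hf hg] at h1
  rw [← ae_map_iff (p := P) (hf.prodMk hg).aemeasurable hP, h1, ae_map_iff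
    (hf.prodMap hg).aemeasurable hP]
  exact hae

end transfer

theorem IsSymGeneralizedInvariant.comp_fst {Ω : Type*} [MeasurableSpace Ω] {μ : Measure Ω}
    [IsProbabilityMeasure μ] {W : ∀ n : ℕ, Ω → Matrix (Fin n) (Fin n) ℝ}
    {d : ∀ n : ℕ, Ω → Fin n → ℝ} {H PV PE : ∀ n : ℕ, Ω → Matrix (Fin n) (Fin n) ℝ} {νD : Measure ℝ}
    (hW : IsSymGeneralizedInvariant μ W d H PV PE νD) :
    IsSymGeneralizedInvariant (μ.prod μ) (fun n p => W n p.1) (fun n p => d n p.1)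
      (fun n p => H n p.1) (fun n p => PV n p.1) (fun n p => PE n p.1) νD where
  measurable_d n := (hW.measurable_d n).comp measurable_fst
  measurable_H n := (hW.measurable_H n).comp measurable_fst
  measurable_PV n := (hW.measurable_PV n).comp measurable_fst
  measurable_PE n := (hW.measurable_PE n).comp measurable_fst
  eq n p := hW.eq n p.1
  spectrum_tendsto := Measure.quasiMeasurePreserving_fst.ae hW.spectrum_tendsto
  compact_support := hW.compact_support
  variance_pos := hW.variance_pos
  orthogonal n := Measure.quasiMeasurePreserving_fst.ae (hW.orthogonal n)
  law_PV n := by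
    rw [← hW.law_PV n, ← (measurePreserving_fst (μ := μ) (ν := μ)).map_eq,
      Measure.map_map (hW.measurable_PV n) measurable_fst, measurePreserving_fst.map_eq]
    rfl
  law_PE n := by
    rw [← hW.law_PE n, ← (measurePreserving_fst (μ := μ) (ν := μ)).map_eq,
      Measure.map_map (hW.measurable_PE n) measurable_fst, measurePreserving_fst.map_eq]
    rfl
  indep_PV_PE n := IndepFun.comp_fst (hW.measurable_PV n) (hW.measurable_PE n) (hW.indep_PV_PE n)
  indep_perm n := IndepFun.comp_fst ((hW.measurable_PV n).prodMk (hW.measurable_PE n))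
    ((hW.measurable_d n).prodMk (hW.measurable_H n)) (hW.indep_perm n)
  delocalized ε hε := Measure.quasiMeasurePreserving_fst.ae (hW.delocalized ε hε)

theorem IsSymGeneralizedInvariant.measurable {Ω : Type*} [MeasurableSpace Ω] {μ : Measure Ω}
    {W : ∀ n : ℕ, Ω → Matrix (Fin n) (Fin n) ℝ}
    {d : ∀ n : ℕ, Ω → Fin n → ℝ} {H PV PE : ∀ n : ℕ, Ω → Matrix (Fin n) (Fin n) ℝ} {νD : Measure ℝ}
    (hW : IsSymGeneralizedInvariant μ W d H PV PE νD) (n : ℕ) : Measurable (W n) := by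
  have hO := measurable_matrix_mul (measurable_matrix_mul (hW.measurable_PV n)
    (hW.measurable_H n)) (hW.measurable_PE n)
  have hd : Measurable fun ω => Matrix.diagonal (d n ω) := by
    refine measurable_pi_lambda _ fun i => measurable_pi_lambda _ fun j => ?_
    simp only [Matrix.diagonal_apply]
    split_ifs
    · exact (measurable_pi_apply i).comp (hW.measurable_d n)
    · exact measurable_const
  have hT : Measurable fun ω => (PV n ω * H n ω * PE n ω).transpose :=
    measurable_pi_lambda _ fun i => measurable_pi_lambda _ fun j => measurable_entry hO j i
  rw [funext (hW.eq n)]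
  exact measurable_matrix_mul (measurable_matrix_mul hO hd) hT

theorem DiagonalTensorNetwork.measurable_val {α : Type*} [MeasurableSpace α] {V : Type u}
    [Fintype V] {k n : ℕ} (T : DiagonalTensorNetwork V k) {A : α → Matrix (Fin n) (Fin n) ℝ}
    {y : α → Fin n → EuclideanSpace ℝ (Fin k)} (hA : Measurable A) (hy : Measurable y) :
    Measurable fun a => T.val (A a) (y a) := by
  simp_rw [T.val_eq]
  exact (Finset.measurable_sum _ fun i _ => (Finset.measurable_prod _ fun v _ =>
    (measurable_polyRow (T.q v) _).comp hy).mul (Finset.measurable_prod _ fun e _ =>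
      measurable_entry hA _ _)).const_mul _

/-- The limit statement depends only on the sequences `W` and `x`, whose joint law is that of
independent copies. On the product space `W` keeps its decomposition in the first coordinate and `x`
is read from the second, so the factors are independent of the vectors. -/
theorem ae_tendsto_val_of_indep_sequences {Ω : Type*} [MeasurableSpace Ω] {μ : Measure Ω}
    [IsProbabilityMeasure μ] {k : ℕ} {x : ∀ n : ℕ, Ω → Fin n → EuclideanSpace ℝ (Fin k)}
    (hx : ∀ n, Measurable (x n)) {νX : Measure (EuclideanSpace ℝ (Fin k))}
    (hconv : ∀ᵐ ω ∂μ, WassersteinTendsto (fun n => x n ω) νX)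
    {V : Type u} [Fintype V] (T : DiagonalTensorNetwork V k)
    (hT : ∀ v : V, ∀ᵐ ω ∂μ,
      Tendsto (fun n : ℕ => empAvg (polyRow (T.q v) (x n ω))) atTop (𝓝 0))
    {W : ∀ n : ℕ, Ω → Matrix (Fin n) (Fin n) ℝ} {d : ∀ n : ℕ, Ω → Fin n → ℝ}
    {H PV PE : ∀ n : ℕ, Ω → Matrix (Fin n) (Fin n) ℝ} {νD : Measure ℝ}
    (hW : IsSymGeneralizedInvariant μ W d H PV PE νD)
    (hind : IndepFun (fun ω n => W n ω) (fun ω n => x n ω) μ)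
    (htrace : ∀ᵐ ω ∂μ, Tendsto (fun n : ℕ => (1 / (n : ℝ)) * (W n ω).trace) atTop (𝓝 0)) :
    ∀ᵐ ω ∂μ, Tendsto (fun n : ℕ => T.val (W n ω) (x n ω)) atTop (𝓝 0) := by
  have hae : ∀ᵐ p ∂μ.prod μ, Tendsto (fun n : ℕ => T.val (W n p.1) (x n p.2)) atTop (𝓝 0) := by
    have hi : ∀ n, IndepFun (fun p : Ω × Ω => (PV n p.1, PE n p.1, d n p.1, H n p.1))
        (fun p => x n p.2) (μ.prod μ) := fun n =>
      indepFun_prod ((hW.measurable_PV n).prodMk ((hW.measurable_PE n).prodMk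
        ((hW.measurable_d n).prodMk (hW.measurable_H n)))) (hx n)
    have hconv' : ∀ᵐ p ∂μ.prod μ, WassersteinTendsto (fun n => x n p.2) νX :=
      Measure.quasiMeasurePreserving_snd.ae hconv
    have hT' : ∀ v, ∀ᵐ p ∂μ.prod μ,
        Tendsto (fun n : ℕ => empAvg (polyRow (T.q v) (x n p.2))) atTop (𝓝 0) := fun v =>
      Measure.quasiMeasurePreserving_snd.ae (hT v)
    have htrace' : ∀ᵐ p ∂μ.prod μ,
        Tendsto (fun n : ℕ => (1 / (n : ℝ)) * (W n p.1).trace) atTop (𝓝 0) :=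
      Measure.quasiMeasurePreserving_fst.ae htrace
    exact ae_tendsto_val_of_indep (x := fun n (p : Ω × Ω) => x n p.2)
      (fun n => (hx n).comp measurable_snd) hconv' T hT' hW.comp_fst hi htrace'
  have hval : ∀ n, Measurable fun z : (∀ n : ℕ, Matrix (Fin n) (Fin n) ℝ) ×
      (∀ n : ℕ, Fin n → EuclideanSpace ℝ (Fin k)) => T.val (z.1 n) (z.2 n) := fun n =>
    T.measurable_val ((measurable_pi_apply n).comp measurable_fst)
      ((measurable_pi_apply n).comp measurable_snd)
  have hWm : Measurable fun ω n => W n ω := measurable_pi_lambda _ hW.measurable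
  have hxm : Measurable fun ω n => x n ω := measurable_pi_lambda _ hx
  -- The transfer requires the convergence to be a measurable event in the pair of sequences.
  exact IndepFun.ae_of_ae_prod hWm hxm hind (measurableSet_tendsto (𝓝 0) hval) hae

end

theorem proposition2p8 {Ω : Type*} [MeasurableSpace Ω] (μ : Measure Ω) [IsProbabilityMeasure μ]
    {k : ℕ} (x : ∀ n : ℕ, Ω → Fin n → EuclideanSpace ℝ (Fin k)) (hx : ∀ n, Measurable (x n))
    (νX : Measure (EuclideanSpace ℝ (Fin k))) [IsProbabilityMeasure νX]
    (hνX : FiniteMoments νX)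
    (hconv : ∀ᵐ ω ∂μ, WassersteinTendsto (fun n => x n ω) νX)
    {V : Type*} [Fintype V] (T : DiagonalTensorNetwork V k)
    (hT : ∀ v : V, ∀ᵐ ω ∂μ,
      Tendsto (fun n : ℕ => empAvg (polyRow (T.q v) (x n ω))) atTop (𝓝 0)) :
    -- (a) generalized Wigner matrices
    (∀ (W : ∀ n : ℕ, Ω → Matrix (Fin n) (Fin n) ℝ) (S : ∀ n : ℕ, Matrix (Fin n) (Fin n) ℝ),
      IsGeneralizedWigner μ W S →
      (∀ n, IndepFun (W n) (x n) μ) →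
      (∀ q : MvPolynomial (Fin k) ℝ, ∀ᵐ ω ∂μ,
        Tendsto (fun n : ℕ => ⨆ i : Fin n,
          |empAvg (fun j => polyRow q (x n ω) j * S n i j)
            - empAvg (polyRow q (x n ω)) * empAvg (fun j => S n i j)|) atTop (𝓝 0)) →
      ∀ᵐ ω ∂μ, Tendsto (fun n : ℕ => T.val (W n ω) (x n ω)) atTop (𝓝 0)) ∧
    -- (b) symmetric generalized invariant matrices
    (∀ (W : ∀ n : ℕ, Ω → Matrix (Fin n) (Fin n) ℝ) (d : ∀ n : ℕ, Ω → Fin n → ℝ)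
      (H PV PE : ∀ n : ℕ, Ω → Matrix (Fin n) (Fin n) ℝ)
      (νD : Measure ℝ) [IsProbabilityMeasure νD],
      IsSymGeneralizedInvariant μ W d H PV PE νD →
      (IndepFun (fun ω n => W n ω) (fun ω n => x n ω) μ ∨
        ∀ n, IndepFun (fun ω => (PV n ω, PE n ω, d n ω, H n ω)) (x n) μ) →
      (∀ᵐ ω ∂μ, Tendsto (fun n : ℕ => (1 / (n : ℝ)) * (W n ω).trace) atTop (𝓝 0)) →
      ∀ᵐ ω ∂μ, Tendsto (fun n : ℕ => T.val (W n ω) (x n ω)) atTop (𝓝 0)) := by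
  refine ⟨fun W S hW hind hprofile => ae_tendsto_val_of_wigner hx hconv T hT hW hind hprofile,
    fun W d H PV PE νD _ hW hind htrace => ?_⟩
  rcases hind with hind | hind
  · exact ae_tendsto_val_of_indep_sequences hx hconv T hT hW hind htrace
  · exact ae_tendsto_val_of_indep hx hconv T hT hW hind htrace
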